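/- Let $n\ge 3$ be an integer and let $\lambda\in\mathbb{C}\setminus\{0\}$ with $0<\arg\lambda<\frac{2\pi}{n-1}$. Let $f_\lambda(z)=z^n+\lambda z^{-n}$, as a map of the Riemann sphere $\widehat{\mathbb{C}}$ to itself. Identify $\mathbb{R}/\mathbb{Z}$ with $(0,1]$ and let $\tau(\theta)=n\theta \bmod 1$. For $1\le k\le n-1$ let $\Theta_k=(\frac{k}{2n},\frac{k+1}{2n}]$ and $\Theta_{-k}=(\frac{k}{2n}+\frac12,\frac{k+1}{2n}+\frac12]$, and let $\Theta$ be the set of all $\theta\in(0,1]$ such that $\tau^k(\theta)\in\bigcup_{j=1}^{n-1}(\Theta_j\cup\Theta_{-j})$ for all $k\ge 0$. The itinerary of $\theta\in\Theta$ is the sequence $(s_k)_{k\ge0}$ in $\{\pm1,\dots,\pm(n-1)\}$ with $\tau^k(\theta)\in\Theta_{s_k}$ for all $k\ge 0$. Let $c_0=|\lambda|^{1/(2n)}e^{i\arg(\lambda)/(2n)}$. For $1\le k\le n-1$ let $S^\lambda_k\subset\widehat{\mathbb{C}}$ be the closed sector, containing $0$ and $\infty$, that consists of the points $r c_0e^{it}$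 with $r\in[0,+\infty]$ and $\frac{k\pi}{n}\le t\le\frac{(k+1)\pi}{n}$, and let $S^\lambda_{-k}=-S^\lambda_k$. The cut ray of an angle $\theta\in\Theta$ with itinerary $(s_k)_{k\ge 0}$ is $$\Omega^\theta_\lambda=\bigcap_{k\ge0}f_\lambda^{-k}\big(S^\lambda_{s_k}\cup S^\lambda_{-s_k}\big).$$ If $\theta\in\Theta$ is periodic, that is, if $\tau^p(\theta)=\theta$ for some $p\ge1$, then $\Omega^\theta_\lambda$ is a quasicircle: it is a Jordan curve in $\widehat{\mathbb{C}}$ and there is a constant $K$ such that, for any two distinct points $z_1,z_2\in\Omega^\theta_\lambda$, one of the two components of $\Omega^\theta_\lambda\setminus\{z_1,z_2\}$ has chordal diameter at most $K$ times the chordal distance of $z_1$ and $z_2$. -/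

import Mathlib

open scoped OnePoint

noncomputable section

namespace McMullen

/-- The map `f z = z ^ n + lam * z ^ (-n)` of the Riemann sphere `OnePoint ℂ`;
`0` and `∞` are sent to `∞`. -/
def map (n : ℕ) (lam : ℂ) : OnePoint ℂ → OnePoint ℂ
  | ∞ => ∞
  | (z : ℂ) => if z = 0 then ∞ else ((z ^ n + lam / z ^ n : ℂ) : OnePoint ℂ)

/-- The open sector `0 < arg lam < 2π / (n - 1)` of parameters. For `3 ≤ n` the upper bound is at
most `π`, so that the branch of the argument with values in `(-π, π]` can be used. -/
def paramSector (n : ℕ) : Set ℂ :=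
  {lam | lam ≠ 0 ∧ 0 < lam.arg ∧ lam.arg < 2 * Real.pi / ((n : ℝ) - 1)}

/-- The map `θ ↦ n θ mod 1` of the circle `ℝ / ℤ`, which is identified with `(0, 1]`. -/
def tau (n : ℕ) (θ : ℝ) : ℝ := toIocMod (zero_lt_one' ℝ) 0 ((n : ℝ) * θ)

/-- The set `{±1, …, ±(n - 1)}` of symbols. -/
def symbols (n : ℕ) : Set ℤ := {s | 1 ≤ |s| ∧ |s| ≤ (n : ℤ) - 1}

/-- The arc of angles with symbol `s`: `(s / 2n, (s + 1) / 2n]` for `s ≥ 0`, and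
`(k / 2n + 1 / 2, (k + 1) / 2n + 1 / 2]` for `s = -k < 0`. -/
def arc (n : ℕ) (s : ℤ) : Set ℝ :=
  if 0 ≤ s then Set.Ioc ((s : ℝ) / (2 * n)) (((s : ℝ) + 1) / (2 * n))
  else Set.Ioc ((-s : ℝ) / (2 * n) + 1 / 2) (((-s : ℝ) + 1) / (2 * n) + 1 / 2)

/-- The set of angles in `(0, 1]` whose whole orbit under `tau` stays in the union of the arcs with
symbols `±1, …, ±(n - 1)`. -/
def Theta (n : ℕ) : Set ℝ :=
  {θ | θ ∈ Set.Ioc (0 : ℝ) 1 ∧ ∀ k : ℕ, ∃ s ∈ symbols n, (tau n)^[k] θ ∈ arc n s}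

/-- The critical point `lam ^ (1 / 2n)` of argument `arg lam / 2n`. -/
def c₀ (n : ℕ) (lam : ℂ) : ℂ := lam ^ ((1 : ℂ) / (2 * n))

/-- The finite points of the closed sector between the rays from `0` through
`c₀ * exp (i k π / n)` and `c₀ * exp (i (k + 1) π / n)`. -/
def planeSector (n : ℕ) (lam : ℂ) (k : ℤ) : Set ℂ :=
  {z | ∃ r t : ℝ, 0 ≤ r ∧ (k : ℝ) * Real.pi / n ≤ t ∧ t ≤ ((k : ℝ) + 1) * Real.pi / n ∧
    z = r * c₀ n lam * Complex.exp (t * Complex.I)}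

/-- The closed sector with symbol `s` in the Riemann sphere (it contains `0` and `∞`). The one with
a negative symbol `-k` is the image under `z ↦ -z` of the one with symbol `k`. -/
def sector (n : ℕ) (lam : ℂ) (s : ℤ) : Set (OnePoint ℂ) :=
  insert ∞ ((fun z : ℂ => (z : OnePoint ℂ)) ''
    (if 0 ≤ s then planeSector n lam s else {z : ℂ | -z ∈ planeSector n lam (-s)}))

/-- The cut ray of angle `θ`: the set of all points whose `k`-th iterate lies in the sectors with
symbols `s k` and `-s k` for all `k`, where `s` is the itinerary of `θ`, i.e. `s k` is the unique
symbol such that `tau ^ k θ` is in the arc of that symbol. -/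
def cutRay (n : ℕ) (lam : ℂ) (θ : ℝ) : Set (OnePoint ℂ) :=
  {z | ∀ k : ℕ, ∀ s ∈ symbols n, (tau n)^[k] θ ∈ arc n s →
    (map n lam)^[k] z ∈ sector n lam s ∪ sector n lam (-s)}

/-- The chordal distance of the Riemann sphere, which is comparable to the spherical distance. -/
def chordal : OnePoint ℂ → OnePoint ℂ → ℝ
  | ∞, ∞ => 0
  | ∞, (w : ℂ) => 2 / Real.sqrt (1 + ‖w‖ ^ 2)
  | (z : ℂ), ∞ => 2 / Real.sqrt (1 + ‖z‖ ^ 2)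
  | (z : ℂ), (w : ℂ) => 2 * ‖z - w‖ / (Real.sqrt (1 + ‖z‖ ^ 2) * Real.sqrt (1 + ‖w‖ ^ 2))

/-- A Jordan curve in the Riemann sphere: a homeomorphic image of the unit circle. -/
def IsJordanCurve (Γ : Set (OnePoint ℂ)) : Prop :=
  ∃ g : Circle → OnePoint ℂ, Continuous g ∧ Function.Injective g ∧ Set.range g = Γ

/-- A quasicircle in the Riemann sphere: a Jordan curve of bounded turning. There is a constant `K`
such that for any two distinct points `z₁`, `z₂` of the curve one of the two components of
`Γ \ {z₁, z₂}` has (chordal) diameter at most `K` times the (chordal) distance of `z₁`, `z₂`. -/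
def IsQuasicircle (Γ : Set (OnePoint ℂ)) : Prop :=
  IsJordanCurve Γ ∧ ∃ K : ℝ, ∀ z₁ ∈ Γ, ∀ z₂ ∈ Γ, z₁ ≠ z₂ →
    ∃ w ∈ Γ \ {z₁, z₂}, ∀ a ∈ connectedComponentIn (Γ \ {z₁, z₂}) w,
      ∀ b ∈ connectedComponentIn (Γ \ {z₁, z₂}) w, chordal a b ≤ K * chordal z₁ z₂

end McMullen

end

noncomputable section

namespace StripDynamics

open Complex

/-! ### Elementary estimates for the hyperbolic functions -/

/-! Write `z = c₀ * exp u`. Then `f(z) = c₀ ^ n * 2 cosh (n u)`, and `x = n u - s π i` identifies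
the sector of symbol `s` with the closed strip `0 ≤ Im x ≤ π`. In this coordinate a point of the
sector is `c₀ ^ n * exp (x / n + b)` with a translation `b` depending on `s`, so an orbit follows a
symbol sequence up to signs exactly when `2 cosh x = ± exp (y / n + b)` for consecutive coordinates
`x`, `y`. The bounds on `arg lam` make `x ↦ x / n + b` send the strip into a substrip at a positive
distance from its boundary, for every symbol `1, …, n - 1`. Such a map contracts the hyperbolic
metric by a uniform factor `k < 1` (`hyp_affine_le`); `exp` is an isometry onto the upper half
plane; and the inverse of `2 cosh` takes values in the half strip `Re > 0`, hence does not expand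
(`hyp_le_of_cosh_eq`). So all inverse branches contract by `k` (`Params.hyp_branch_le`).

A graph transform now yields the curves. The line `Im x = π / 2` is invariant up to a bounded error,
with dynamics `model` on its positive half and the symmetry `x ↦ π i - x`. Its successive pullbacks
converge geometrically to a curve at bounded distance from the line. Expansion of `model` makes the
curve injective (`Params.curve_injective`), contraction of the branches forces every coordinate of
an orbit onto it (`Params.mem_range_curve`), and exponentiating gives the cut ray as a curve through
`0` and `∞` (`symbolSet_eq`).

For bounded turning, a short arc is expanded by `model` until it straddles `0` or its next image is
long. At that moment the `2 cosh` images of its endpoints lie in opposite sectors or have moduli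
differing by a definite factor, so the turning is controlled. Pulling back costs a distortion factor
at each step, but the diameters decay like `k ^ j`, so the logarithms of these factors have a
bounded geometric sum (`Params.exists_turning_const`). The exponential carries the bound to the
plane, and `isQuasicircle_range` carries it to the chordal metric. -/

lemma sinh_re (z : ℂ) : (sinh z).re = Real.sinh z.re * Real.cos z.im := by
  conv_lhs => rw [← re_add_im z, sinh_add, sinh_mul_I, cosh_mul_I]
  simp [← ofReal_sinh, ← ofReal_cosh, ← ofReal_sin, ← ofReal_cos]

lemma sinh_im (z : ℂ) : (sinh z).im = Real.cosh z.re * Real.sin z.im := by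
  conv_lhs => rw [← re_add_im z, sinh_add, sinh_mul_I, cosh_mul_I]
  simp [← ofReal_sinh, ← ofReal_cosh, ← ofReal_sin, ← ofReal_cos]

lemma cosh_re (z : ℂ) : (cosh z).re = Real.cosh z.re * Real.cos z.im := by
  conv_lhs => rw [← re_add_im z, cosh_add, sinh_mul_I, cosh_mul_I]
  simp [← ofReal_sinh, ← ofReal_cosh, ← ofReal_sin, ← ofReal_cos]

lemma cosh_im (z : ℂ) : (cosh z).im = Real.sinh z.re * Real.sin z.im := by
  conv_lhs => rw [← re_add_im z, cosh_add, sinh_mul_I, cosh_mul_I]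
  simp [← ofReal_sinh, ← ofReal_cosh, ← ofReal_sin, ← ofReal_cos]

lemma norm_sinh_sq (z : ℂ) : ‖sinh z‖ ^ 2 = Real.sinh z.re ^ 2 + Real.sin z.im ^ 2 := by
  rw [← normSq_eq_norm_sq, normSq_apply, sinh_re, sinh_im]
  have h1 := Real.cosh_sq z.re
  have h2 := Real.sin_sq_add_cos_sq z.im
  linear_combination Real.sinh z.re ^ 2 * h2 + Real.sin z.im ^ 2 * h1

lemma norm_cosh_sq (z : ℂ) : ‖cosh z‖ ^ 2 = Real.sinh z.re ^ 2 + Real.cos z.im ^ 2 := by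
  rw [← normSq_eq_norm_sq, normSq_apply, cosh_re, cosh_im]
  have h1 := Real.cosh_sq z.re
  have h2 := Real.sin_sq_add_cos_sq z.im
  linear_combination Real.sinh z.re ^ 2 * h2 + Real.cos z.im ^ 2 * h1

lemma cosh_sub_cosh (x y : ℂ) :
    cosh x - cosh y = 2 * (sinh ((x + y) / 2) * sinh ((x - y) / 2)) := by
  have hx : x = (x + y) / 2 + (x - y) / 2 := by ring
  have hy : y = (x + y) / 2 - (x - y) / 2 := by ring
  conv_lhs => rw [hx]
  conv_lhs => rw [hy]
  rw [show (x + ((x + y) / 2 - (x - y) / 2)) / 2 + (x - ((x + y) / 2 - (x - y) / 2)) / 2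
    = (x + y) / 2 + (x - y) / 2 by ring, cosh_add, cosh_sub]
  ring

lemma exp_sub_exp (x y : ℂ) :
    exp x - exp y = 2 * (exp ((x + y) / 2) * sinh ((x - y) / 2)) := by
  rw [show 2 * (exp ((x + y) / 2) * sinh ((x - y) / 2))
    = exp ((x + y) / 2) * (2 * sinh ((x - y) / 2)) by ring, two_sinh, mul_sub, ← exp_add, ← exp_add]
  congr 2 <;> ring

/-- From `|sinh z|² = sinh² (Re z) + sin² (Im z)`, using `|sinh r| ≥ |r|` and Jordan's inequality.
The restriction on `Im z` is met by half differences of points of the strip, on which `sinh`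
therefore has no zero but `0`. -/
lemma norm_le_norm_sinh {z : ℂ} (hz : |z.im| ≤ Real.pi / 2) :
    ‖z‖ ≤ Real.pi / 2 * ‖sinh z‖ := by
  have hp := Real.pi_pos
  have h1 : z.re ^ 2 ≤ Real.sinh z.re ^ 2 := by
    rw [sq_le_sq]
    rcases le_total 0 z.re with h | h
    · have := Real.self_le_sinh_iff.2 h
      rw [abs_of_nonneg h, abs_of_nonneg (by linarith)]; exact this
    · have := Real.sinh_le_self_iff.2 h
      rw [abs_of_nonpos h, abs_of_nonpos (by linarith)]; linarith
  have h2 : z.im ^ 2 ≤ (Real.pi / 2) ^ 2 * Real.sin z.im ^ 2 := by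
    have h3 : |z.im| ≤ Real.pi / 2 * |Real.sin z.im| := by
      have h4 : 2 / Real.pi * |z.im| ≤ |Real.sin z.im| := by
        have := Real.mul_le_sin (abs_nonneg z.im) hz
        rcases le_total 0 z.im with h | h
        · rw [abs_of_nonneg h] at this ⊢
          exact this.trans (le_abs_self _)
        · rw [abs_of_nonpos h] at this ⊢
          rw [Real.sin_neg] at this
          exact this.trans (neg_le_abs _)
      calc |z.im| = Real.pi / 2 * (2 / Real.pi * |z.im|) := by field_simp
        _ ≤ _ := by gcongr
    rw [← mul_pow, sq_le_sq, abs_mul, abs_of_pos (by positivity : 0 < Real.pi / 2)]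
    exact h3
  refine abs_le_of_sq_le_sq' ?_ (by positivity) |>.2
  rw [mul_pow, norm_sinh_sq, ← normSq_eq_norm_sq, normSq_apply]
  have h5 : 1 ≤ (Real.pi / 2) ^ 2 := by nlinarith [Real.pi_gt_three]
  nlinarith [sq_nonneg (Real.sinh z.re)]

lemma norm_sinh_le (z : ℂ) : ‖sinh z‖ ≤ ‖z‖ * Real.exp ‖z‖ := by
  have h0 : ∀ w : ℂ, ‖exp w - 1‖ ≤ ‖w‖ * Real.exp ‖w‖ := fun w => by
    simpa using norm_exp_sub_sum_le_norm_mul_exp w 1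
  have h1 := h0 z
  have h2 := h0 (-z)
  rw [norm_neg] at h2
  have h3 : 2 * sinh z = (exp z - 1) - (exp (-z) - 1) := by rw [two_sinh]; ring
  have h4 : 2 * ‖sinh z‖ ≤ ‖exp z - 1‖ + ‖exp (-z) - 1‖ := by
    calc 2 * ‖sinh z‖ = ‖2 * sinh z‖ := by simp
      _ ≤ _ := by rw [h3]; exact norm_sub_le _ _
  linarith

lemma norm_cosh_le (z : ℂ) : ‖cosh z‖ ≤ Real.exp ‖z‖ := by
  have h3 : 2 * cosh z = exp z + exp (-z) := two_cosh z
  have h4 : 2 * ‖cosh z‖ ≤ ‖exp z‖ + ‖exp (-z)‖ := by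
    calc 2 * ‖cosh z‖ = ‖2 * cosh z‖ := by simp
      _ ≤ _ := by rw [h3]; exact norm_add_le _ _
  have h1 := norm_exp_le_exp_norm z
  have h2 := norm_exp_le_exp_norm (-z)
  rw [norm_neg] at h2
  linarith

/-- Unlike in `norm_le_norm_sinh`, the constant tends to `1` as `z` tends to `0`. This is essential
later: distortion factors over infinitely many steps have to form a convergent product. -/
lemma norm_le_norm_sinh_mul_exp {z : ℂ} (hz : |z.im| ≤ Real.pi / 2) :
    ‖z‖ ≤ ‖sinh z‖ * Real.exp (2 * ‖z‖) := by
  have h0 := norm_le_norm_sinh hz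
  have h1 : Real.pi / 2 ≤ 2 := by linarith [Real.pi_le_four]
  -- For small `z` the Taylor remainders give `‖z‖ ≤ ‖sinh z‖ + ‖z‖ ^ 2`, and one factor of the
  -- square is replaced by `2 * ‖sinh z‖`. For `1 ≤ ‖z‖` the crude constant `2` suffices.
  have h2 : ‖z‖ ≤ ‖sinh z‖ * (1 + 2 * ‖z‖) := by
    rcases le_total ‖z‖ 1 with h | h
    · have h3 := norm_exp_sub_one_sub_id_le h
      have h4 := norm_exp_sub_one_sub_id_le (x := -z) (by rwa [norm_neg])
      rw [norm_neg] at h4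
      have h5 : 2 * z = 2 * sinh z - ((exp z - 1 - z) - (exp (-z) - 1 - -z)) := by
        rw [two_sinh]; ring
      have h6 : 2 * ‖z‖ ≤ 2 * ‖sinh z‖ + (‖exp z - 1 - z‖ + ‖exp (-z) - 1 - -z‖) := by
        calc 2 * ‖z‖ = ‖2 * z‖ := by simp
          _ ≤ ‖2 * sinh z‖ + ‖(exp z - 1 - z) - (exp (-z) - 1 - -z)‖ := by
            conv_lhs => rw [h5]
            exact norm_sub_le _ _
          _ ≤ _ := by
            gcongr
            · simp
            · exact norm_sub_le _ _
      have h7 : ‖z‖ ≤ 2 * ‖sinh z‖ := h0.trans (by gcongr)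
      nlinarith [mul_le_mul_of_nonneg_left h7 (norm_nonneg z)]
    · nlinarith [norm_nonneg z, norm_nonneg (sinh z)]
  refine h2.trans ?_
  gcongr
  linarith [Real.add_one_le_exp (2 * ‖z‖)]

/-- The strip `0 < Im z < π`. -/
def strip : Set ℂ := {z | 0 < z.im ∧ z.im < Real.pi}

/-- The closed substrip of `0 ≤ Im z ≤ π` on which `sin (Im z) ≥ ε`. -/
def band (ε : ℝ) : Set ℂ := {z | 0 ≤ z.im ∧ z.im ≤ Real.pi ∧ ε ≤ Real.sin z.im}

lemma isClosed_band (ε : ℝ) : IsClosed (band ε) :=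
  (isClosed_le continuous_const continuous_im).inter
    ((isClosed_le continuous_im continuous_const).inter
      (isClosed_le continuous_const (Real.continuous_sin.comp continuous_im)))

lemma band_subset_strip {ε : ℝ} (hε : 0 < ε) : band ε ⊆ strip := by
  rintro z ⟨h0, h1, h2⟩
  refine ⟨lt_of_le_of_ne h0 fun h => ?_, lt_of_le_of_ne h1 fun h => ?_⟩
  · rw [← h, Real.sin_zero] at h2; linarith
  · rw [h, Real.sin_pi] at h2; linarith

lemma sin_im_pos {z : ℂ} (hz : z ∈ strip) : 0 < Real.sin z.im :=
  Real.sin_pos_of_pos_of_lt_pi hz.1 hz.2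

/-- Concavity of `sin` on `[0, π]`. Midpoints matter because `cosh x - cosh y` contains the factor
`sinh ((x + y) / 2)`. -/
lemma midpoint_mem_band {ε : ℝ} {x y : ℂ} (hx : x ∈ band ε) (hy : y ∈ band ε) :
    (x + y) / 2 ∈ band ε := by
  have him : ((x + y) / 2).im = (1 / 2 : ℝ) • x.im + (1 / 2 : ℝ) • y.im := by
    simp
    ring
  obtain ⟨hx0, hx1, hx2⟩ := hx
  obtain ⟨hy0, hy1, hy2⟩ := hy
  have hx' : x.im ∈ Set.Icc 0 Real.pi := ⟨hx0, hx1⟩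
  have hy' : y.im ∈ Set.Icc 0 Real.pi := ⟨hy0, hy1⟩
  have hc := strictConcaveOn_sin_Icc.concaveOn.2 hx' hy' (by norm_num : (0 : ℝ) ≤ 1 / 2)
    (by norm_num : (0 : ℝ) ≤ 1 / 2) (by norm_num)
  rw [← him] at hc
  simp only [smul_eq_mul] at hc him
  exact ⟨by rw [him]; linarith, by rw [him]; linarith, by linarith⟩

lemma abs_im_half_sub_le {x y : ℂ} (hx : x ∈ strip) (hy : y ∈ strip) :
    |((x - y) / 2).im| ≤ Real.pi / 2 := by
  have : ((x - y) / 2).im = (x.im - y.im) / 2 := by simp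
  rw [this, abs_le]
  constructor <;> linarith [hx.1, hx.2, hy.1, hy.2]

/-! ### Distortion of `cosh` and `exp`. -/

lemma norm_cosh_le_norm_sinh {ε : ℝ} (hε : 0 < ε) {w : ℂ} (hw : ε ≤ Real.sin w.im) :
    ‖cosh w‖ ≤ 1 / ε * ‖sinh w‖ := by
  have h1 := norm_sinh_sq w
  have h2 := norm_cosh_sq w
  have h3 := Real.sin_sq_add_cos_sq w.im
  have h4 := Real.sin_le_one w.im
  have h5 : ε * ‖cosh w‖ ≤ ‖sinh w‖ := by
    refine (abs_le_of_sq_le_sq' ?_ (norm_nonneg _)).2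
    rw [mul_pow, h1, h2]
    have h6 : ε ^ 2 ≤ Real.sin w.im ^ 2 := by gcongr
    have h7 : ε ^ 2 ≤ 1 := by nlinarith
    nlinarith [sq_nonneg (Real.sinh w.re), sq_nonneg (Real.cos w.im)]
  rw [one_div, ← div_eq_inv_mul, le_div_iff₀ hε]
  linarith

/-- On the band `coth` is bounded by `1 / ε`, so the addition formula bounds the relative growth of
`sinh`. It compares the factors `sinh ((x + z) / 2)` and `sinh ((x + y) / 2)` in `cosh_distortion`.
-/
lemma norm_sinh_add_le {ε : ℝ} (hε : 0 < ε) {w : ℂ} (hw : ε ≤ Real.sin w.im) (d : ℂ) :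
    ‖sinh (w + d)‖ ≤ ‖sinh w‖ * Real.exp ((1 + 1 / ε) * ‖d‖) := by
  rw [sinh_add]
  have h1 := norm_cosh_le_norm_sinh hε hw
  have h2 := norm_cosh_le d
  have h3 := norm_sinh_le d
  have h4 := Real.add_one_le_exp (1 / ε * ‖d‖)
  calc ‖sinh w * cosh d + cosh w * sinh d‖
      ≤ ‖sinh w‖ * ‖cosh d‖ + ‖cosh w‖ * ‖sinh d‖ := by
        rw [← norm_mul, ← norm_mul]; exact norm_add_le _ _
    _ ≤ ‖sinh w‖ * Real.exp ‖d‖ + (1 / ε * ‖sinh w‖) * (‖d‖ * Real.exp ‖d‖) := by gcongr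
    _ = ‖sinh w‖ * (Real.exp ‖d‖ * (1 / ε * ‖d‖ + 1)) := by ring
    _ ≤ ‖sinh w‖ * (Real.exp ‖d‖ * Real.exp (1 / ε * ‖d‖)) := by gcongr
    _ = _ := by rw [← Real.exp_add]; congr 2; ring

/-- Distortion of `cosh` on a substrip. -/
lemma cosh_distortion {ε D : ℝ} (hε : 0 < ε) {x y z : ℂ} (hx : x ∈ band ε) (hy : y ∈ band ε)
    (hxy : ‖x - y‖ ≤ D) (hxz : ‖x - z‖ ≤ D) (hyz : ‖y - z‖ ≤ D) :
    ‖x - y‖ * ‖cosh x - cosh z‖ ≤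
      Real.exp ((2 + 1 / ε) * D) * (‖x - z‖ * ‖cosh x - cosh y‖) := by
  have hb := band_subset_strip hε
  have hD : 0 ≤ D := (norm_nonneg _).trans hxy
  rw [cosh_sub_cosh, cosh_sub_cosh]
  simp only [norm_mul, norm_ofNat]
  have half : ∀ u : ℂ, ‖u / 2‖ = ‖u‖ / 2 := fun u => by simp
  have h1 : ‖x - y‖ ≤ 2 * (‖sinh ((x - y) / 2)‖ * Real.exp D) := by
    have := norm_le_norm_sinh_mul_exp (abs_im_half_sub_le (hb hx) (hb hy))
    rw [half] at this
    have h : Real.exp (2 * (‖x - y‖ / 2)) ≤ Real.exp D := Real.exp_le_exp.2 (by linarith)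
    nlinarith [mul_le_mul_of_nonneg_left h (norm_nonneg (sinh ((x - y) / 2)))]
  have h2 : ‖sinh ((x - z) / 2)‖ ≤ ‖x - z‖ / 2 * Real.exp (D / 2) := by
    refine (norm_sinh_le _).trans ?_
    rw [half]
    gcongr
  have h3 : ‖sinh ((x + z) / 2)‖ ≤
      ‖sinh ((x + y) / 2)‖ * Real.exp ((1 + 1 / ε) * (D / 2)) := by
    have := norm_sinh_add_le hε (midpoint_mem_band hx hy).2.2 ((z - y) / 2)
    rw [show (x + y) / 2 + (z - y) / 2 = (x + z) / 2 by ring, half, norm_sub_rev z y] at this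
    refine this.trans ?_
    gcongr
  calc ‖x - y‖ * (2 * (‖sinh ((x + z) / 2)‖ * ‖sinh ((x - z) / 2)‖))
      ≤ 2 * (‖sinh ((x - y) / 2)‖ * Real.exp D) *
        (2 * ((‖sinh ((x + y) / 2)‖ * Real.exp ((1 + 1 / ε) * (D / 2))) *
          (‖x - z‖ / 2 * Real.exp (D / 2)))) := by gcongr
    _ = (Real.exp D * Real.exp ((1 + 1 / ε) * (D / 2)) * Real.exp (D / 2)) *
        (‖x - z‖ * (2 * (‖sinh ((x + y) / 2)‖ * ‖sinh ((x - y) / 2)‖))) := by ring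
    _ ≤ _ := by
      rw [← Real.exp_add, ← Real.exp_add]
      gcongr
      have : 0 ≤ 1 / ε * D := by positivity
      linarith

/-- Distortion of `exp` on a horizontal strip. -/
lemma exp_distortion {D : ℝ} {x y z : ℂ} (him : |((x - z) / 2).im| ≤ Real.pi / 2)
    (hxy : ‖x - y‖ ≤ D) (hxz : ‖x - z‖ ≤ D) (hyz : ‖y - z‖ ≤ D) :
    ‖exp x - exp y‖ * ‖x - z‖ ≤ Real.exp (2 * D) * (‖exp x - exp z‖ * ‖x - y‖) := by
  have hD : 0 ≤ D := (norm_nonneg _).trans hxy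
  rw [exp_sub_exp, exp_sub_exp]
  simp only [norm_mul, norm_ofNat]
  have half : ∀ u : ℂ, ‖u / 2‖ = ‖u‖ / 2 := fun u => by simp
  have h1 : ‖x - z‖ ≤ 2 * (‖sinh ((x - z) / 2)‖ * Real.exp D) := by
    have := norm_le_norm_sinh_mul_exp him
    rw [half] at this
    have h : Real.exp (2 * (‖x - z‖ / 2)) ≤ Real.exp D := Real.exp_le_exp.2 (by linarith)
    nlinarith [mul_le_mul_of_nonneg_left h (norm_nonneg (sinh ((x - z) / 2)))]
  have h2 : ‖sinh ((x - y) / 2)‖ ≤ ‖x - y‖ / 2 * Real.exp (D / 2) := by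
    refine (norm_sinh_le _).trans ?_
    rw [half]
    gcongr
  have h3 : ‖exp ((x + y) / 2)‖ ≤ ‖exp ((x + z) / 2)‖ * Real.exp (D / 2) := by
    rw [show (x + y) / 2 = (x + z) / 2 + (y - z) / 2 by ring, exp_add, norm_mul]
    gcongr
    refine (norm_exp_le_exp_norm _).trans ?_
    rw [half]
    gcongr
  calc 2 * (‖exp ((x + y) / 2)‖ * ‖sinh ((x - y) / 2)‖) * ‖x - z‖
      ≤ 2 * ((‖exp ((x + z) / 2)‖ * Real.exp (D / 2)) * (‖x - y‖ / 2 * Real.exp (D / 2))) *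
        (2 * (‖sinh ((x - z) / 2)‖ * Real.exp D)) := by gcongr
    _ = (Real.exp (D / 2) * Real.exp (D / 2) * Real.exp D) *
        (2 * (‖exp ((x + z) / 2)‖ * ‖sinh ((x - z) / 2)‖) * ‖x - y‖) := by ring
    _ = _ := by
      rw [← Real.exp_add, ← Real.exp_add]
      congr 2
      ring

end StripDynamics
end

noncomputable section

namespace StripDynamics

open Complex

/-! ### The hyperbolic metric of the strip and the contraction -/

/-- `sinh² (d / 2)` for the hyperbolic distance `d` of the strip. -/
def hyp (x y : ℂ) : ℝ := ‖sinh ((x - y) / 2)‖ ^ 2 / (Real.sin x.im * Real.sin y.im)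

lemma hyp_reflect (x y : ℂ) : hyp (Real.pi * I - x) (Real.pi * I - y) = hyp x y := by
  unfold hyp
  rw [show (Real.pi * I - x - (Real.pi * I - y)) / 2 = -((x - y) / 2) by ring, sinh_neg, norm_neg]
  simp [Real.sin_pi_sub]

lemma reflect_mem_strip {x : ℂ} (hx : x ∈ strip) : Real.pi * I - x ∈ strip := by
  obtain ⟨h0, h1⟩ := hx
  constructor <;> simp <;> linarith

lemma reflect_mem_band {ε : ℝ} {x : ℂ} (hx : x ∈ band ε) : Real.pi * I - x ∈ band ε := by
  obtain ⟨h0, h1, h2⟩ := hx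
  refine ⟨?_, ?_, ?_⟩
  · simp; linarith
  · simp; linarith
  · simpa [Real.sin_pi_sub] using h2

/-- The hyperbolic density of the strip is `1 / sin (Im z) ≥ 1`, so hyperbolic contraction yields
Euclidean smallness. -/
lemma norm_sub_le_hyp {x y : ℂ} (hx : x ∈ strip) (hy : y ∈ strip) :
    ‖x - y‖ ≤ Real.pi * √(hyp x y) := by
  have h := norm_le_norm_sinh (abs_im_half_sub_le hx hy)
  have h2 : ‖sinh ((x - y) / 2)‖ ≤ √(hyp x y) := by
    apply Real.le_sqrt_of_sq_le
    unfold hyp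
    rw [le_div_iff₀ (mul_pos (sin_im_pos hx) (sin_im_pos hy))]
    have : Real.sin x.im * Real.sin y.im ≤ 1 :=
      mul_le_one₀ (Real.sin_le_one _) (sin_im_pos hy).le (Real.sin_le_one _)
    nlinarith [sq_nonneg ‖sinh ((x - y) / 2)‖]
  have h3 : ‖(x - y) / 2‖ = ‖x - y‖ / 2 := by simp
  rw [h3] at h
  have := mul_le_mul_of_nonneg_left h2 Real.pi_pos.le
  linarith

lemma norm_sinh_sq_le (z : ℂ) : ‖sinh z‖ ^ 2 ≤ Real.cosh z.re ^ 2 := by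
  rw [norm_sinh_sq, Real.cosh_sq]
  have := Real.sin_sq_le_one z.im
  linarith

lemma hyp_le {ε : ℝ} (hε : 0 < ε) {x y : ℂ} (hx : x ∈ band ε) (hy : y ∈ band ε) {r : ℝ}
    (hr : |x.re - y.re| ≤ r) : hyp x y ≤ (Real.cosh r / ε) ^ 2 := by
  unfold hyp
  rw [div_pow]
  have h : Real.cosh ((x - y) / 2).re ≤ Real.cosh r := by
    rw [Real.cosh_le_cosh]
    have : ((x - y) / 2).re = (x.re - y.re) / 2 := by simp
    rw [this, abs_div, abs_two]
    have := le_abs_self r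
    have := abs_nonneg (x.re - y.re)
    linarith
  have h1 := norm_sinh_sq_le ((x - y) / 2)
  have h2 := Real.cosh_pos ((x - y) / 2).re
  gcongr
  · nlinarith
  · nlinarith [hx.2.2, hy.2.2]

lemma continuousAt_hyp {x : ℂ} (hx : x ∈ strip) : ContinuousAt (fun y => hyp x y) x := by
  unfold hyp
  have : Real.sin x.im * Real.sin x.im ≠ 0 := (mul_pos (sin_im_pos hx) (sin_im_pos hx)).ne'
  refine ContinuousAt.div ?_ ?_ this
  · exact (by fun_prop : Continuous fun y => ‖sinh ((x - y) / 2)‖ ^ 2).continuousAt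
  · exact (by fun_prop : Continuous fun y : ℂ => Real.sin x.im * Real.sin y.im).continuousAt

lemma hyp_self (x : ℂ) : hyp x x = 0 := by simp [hyp]

lemma hyp_nonneg {x y : ℂ} (hx : x ∈ strip) (hy : y ∈ strip) : 0 ≤ hyp x y :=
  div_nonneg (by positivity) (mul_pos (sin_im_pos hx) (sin_im_pos hy)).le

/-! ### Inverting `2 cosh` on the half strip `Re > 0`. -/

lemma cosh_inj_of_mem_strip {x y : ℂ} (hx : x ∈ strip) (hy : y ∈ strip) (hx0 : 0 < x.re)
    (hy0 : 0 < y.re) (h : cosh x = cosh y) : x = y := by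
  have h1 := cosh_sub_cosh x y
  rw [h, sub_self, eq_comm, mul_eq_zero, or_iff_right two_ne_zero, mul_eq_zero] at h1
  have h2 : sinh ((x + y) / 2) ≠ 0 := fun h3 => by
    have := norm_sinh_sq ((x + y) / 2)
    have h4 : 0 < Real.sinh ((x + y) / 2).re := Real.sinh_pos_iff.2 (by simp; linarith)
    rw [h3, norm_zero] at this
    nlinarith [sq_nonneg (Real.sin ((x + y) / 2).im)]
  have h3 := norm_le_norm_sinh (abs_im_half_sub_le hx hy)
  rw [h1.resolve_left h2, norm_zero, mul_zero] at h3
  have h4 : (x - y) / 2 = 0 := norm_le_zero_iff.1 h3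
  linear_combination 2 * h4

lemma cosh_surjective : Function.Surjective cosh := fun w => by
  obtain ⟨z, hz⟩ := cos_surjective w
  exact ⟨z * I, by rw [cosh_mul_I, hz]⟩

/-- Any preimage works after changing its sign, to get `Re > 0`, and translating by a multiple of `2
π i`. -/
lemma exists_cosh_eq {q : ℂ} (hq : 0 < q.im) : ∃ x ∈ strip, 0 < x.re ∧ 2 * cosh x = q := by
  have hp := Real.pi_pos
  obtain ⟨z, hz⟩ := cosh_surjective (q / 2)
  have key : ∀ z : ℂ, cosh z = q / 2 → 0 < z.re → ∃ x ∈ strip, 0 < x.re ∧ 2 * cosh x = q := by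
    intro z hz hre
    set k := toIocDiv Real.two_pi_pos (-Real.pi) z.im with hk
    set x : ℂ := z - k * (2 * Real.pi * I) with hx
    have hc : cosh x = q / 2 := by
      rw [← hz, hx]
      rw [← cos_mul_I, ← cos_mul_I, ← cos_add_int_mul_two_pi (z * I) k]
      congr 1
      linear_combination -(k * (2 * Real.pi) : ℂ) * I_mul_I
    have him : x.im = toIocMod Real.two_pi_pos (-Real.pi) z.im := by
      rw [hx, toIocMod]; simp [hk]
    have hmem := toIocMod_mem_Ioc Real.two_pi_pos (-Real.pi) z.im
    rw [← him] at hmem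
    have hxre : x.re = z.re := by simp [hx]
    -- Since `Im cosh x = sinh (Re x) * sin (Im x)` is positive, `sin (Im x)` is positive; with `Im
    -- x` in `(-π, π]` this leaves only `0 < Im x < π`.
    have him2 : 0 < Real.sinh x.re * Real.sin x.im := by
      rw [← cosh_im, hc]; simpa using hq
    have hsin : 0 < Real.sin x.im :=
      (mul_pos_iff_of_pos_left (Real.sinh_pos_iff.2 (hxre ▸ hre))).1 him2
    refine ⟨x, ⟨?_, ?_⟩, hxre ▸ hre, by rw [hc]; ring⟩
    · by_contra! h
      exact absurd (Real.sin_nonpos_of_nonpos_of_neg_pi_le h hmem.1.le) (by linarith)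
    · refine lt_of_le_of_ne (by linarith [hmem.2]) fun h => ?_
      rw [h, Real.sin_pi] at hsin
      exact lt_irrefl _ hsin
  rcases lt_trichotomy z.re 0 with h | h | h
  · exact key (-z) (by rw [cosh_neg, hz]) (by simpa using h)
  · have := cosh_im z
    rw [hz, h] at this
    simp at this
    linarith
  · exact key z hz h

/-- As `Im q = 2 sinh (Re x) sin (Im x)` and `2 sinh (Re x) ≤ |q|`, the height of the preimage
satisfies `sin (Im x) ≥ sin (arg q)`. This keeps the images of the branches in a fixed band. -/
lemma sin_im_ge_of_cosh_eq {x q : ℂ} (hx0 : 0 < x.re) (h : 2 * cosh x = q) {ε : ℝ}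
    (hq : ε * ‖q‖ ≤ q.im) (hε : 0 ≤ ε) : ε ≤ Real.sin x.im := by
  have h1 : q.im = 2 * (Real.sinh x.re * Real.sin x.im) := by
    rw [← h, ← cosh_im]; simp
  have h2 : Real.sinh x.re ≤ ‖cosh x‖ := by
    refine (abs_le_of_sq_le_sq' ?_ (norm_nonneg _)).2
    rw [norm_cosh_sq]
    nlinarith [sq_nonneg (Real.cos x.im)]
  have h3 : ‖q‖ = 2 * ‖cosh x‖ := by rw [← h]; simp
  have h4 := Real.sinh_pos_iff.2 hx0
  rw [h1, h3] at hq
  have h5 : Real.sinh x.re * ε ≤ Real.sinh x.re * Real.sin x.im := by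
    nlinarith [mul_le_mul_of_nonneg_left h2 hε]
  exact le_of_mul_le_mul_left h5 h4

/-- Schwarz–Pick for the inclusion of the half strip in the strip, made explicit: the quotient of
the two sides equals `sinh (Re x) * sinh (Re y) / |sinh ((x + y) / 2)|²`, which is at most `1`. -/
lemma hyp_le_of_cosh_eq {x y p q : ℂ} (hx : x ∈ strip) (hy : y ∈ strip) (hx0 : 0 < x.re)
    (hy0 : 0 < y.re) (hp : 2 * cosh x = exp p) (hq : 2 * cosh y = exp q) : hyp x y ≤ hyp p q := by
  have him : ∀ {z w : ℂ}, 2 * cosh z = exp w →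
      Real.exp w.re * Real.sin w.im = 2 * (Real.sinh z.re * Real.sin z.im) := by
    intro z w h
    rw [← exp_im, ← h, ← cosh_im]
    simp
  have hsx := sin_im_pos hx
  have hsy := sin_im_pos hy
  have hx1 := Real.sinh_pos_iff.2 hx0
  have hy1 := Real.sinh_pos_iff.2 hy0
  have hsub : exp ((p + q) / 2) * sinh ((p - q) / 2) =
      2 * (sinh ((x + y) / 2) * sinh ((x - y) / 2)) := by
    have h1 := exp_sub_exp p q
    have h2 := cosh_sub_cosh x y
    linear_combination -h1 / 2 - hp / 2 + hq / 2 + h2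
  have hnorm : ‖exp ((p + q) / 2)‖ ^ 2 = Real.exp p.re * Real.exp q.re := by
    rw [norm_exp, ← Real.exp_nat_mul, ← Real.exp_add]
    congr 1
    simp
    ring
  have h1 := congrArg (fun z => ‖z‖ ^ 2) hsub
  simp only [norm_mul, mul_pow, norm_ofNat, hnorm] at h1
  have hpq : Real.exp p.re * Real.exp q.re * (Real.sin p.im * Real.sin q.im) =
      4 * (Real.sinh x.re * Real.sinh y.re * (Real.sin x.im * Real.sin y.im)) := by
    linear_combination Real.exp q.re * Real.sin q.im * him hp +
      2 * (Real.sinh x.re * Real.sin x.im) * him hq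
  have hE : 0 < Real.exp p.re * Real.exp q.re := by positivity
  -- By the half angle formula this reduces to `cosh (Re x - Re y) ≥ 1`.
  have hkey : Real.sinh x.re * Real.sinh y.re ≤ ‖sinh ((x + y) / 2)‖ ^ 2 := by
    rw [norm_sinh_sq]
    have h2 : ((x + y) / 2).re = (x.re + y.re) / 2 := by simp
    have h3 := Real.cosh_two_mul ((x.re + y.re) / 2)
    have h4 := Real.cosh_sq ((x.re + y.re) / 2)
    rw [show 2 * ((x.re + y.re) / 2) = x.re + y.re by ring, Real.cosh_add] at h3
    have h5 := Real.one_le_cosh (x.re - y.re)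
    rw [Real.cosh_sub] at h5
    rw [h2]
    nlinarith [sq_nonneg (Real.sin ((x + y) / 2).im)]
  have hpos : 0 < Real.sin p.im * Real.sin q.im := by
    refine (mul_pos_iff_of_pos_left hE).1 ?_
    rw [hpq]; positivity
  unfold hyp
  rw [div_le_div_iff₀ (by positivity) hpos]
  have h6 : Real.exp p.re * Real.exp q.re * (‖sinh ((x - y) / 2)‖ ^ 2 *
      (Real.sin p.im * Real.sin q.im)) ≤ Real.exp p.re * Real.exp q.re *
      (‖sinh ((p - q) / 2)‖ ^ 2 * (Real.sin x.im * Real.sin y.im)) := by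
    have h7 : 0 ≤ 4 * ‖sinh ((x - y) / 2)‖ ^ 2 * (Real.sin x.im * Real.sin y.im) := by positivity
    calc _ = 4 * ‖sinh ((x - y) / 2)‖ ^ 2 * (Real.sin x.im * Real.sin y.im) *
          (Real.sinh x.re * Real.sinh y.re) := by
          linear_combination ‖sinh ((x - y) / 2)‖ ^ 2 * hpq
      _ ≤ 4 * ‖sinh ((x - y) / 2)‖ ^ 2 * (Real.sin x.im * Real.sin y.im) *
          ‖sinh ((x + y) / 2)‖ ^ 2 := by gcongr
      _ = _ := by
        linear_combination -(Real.sin x.im * Real.sin y.im) * h1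
  exact le_of_mul_le_mul_left h6 hE

/-! ### The contraction factor -/

/-- Concavity gives `sin t ≤ n sin (t / n)`. If `t / n + b ≤ π / 2`, adding `b` increases the right
side strictly; otherwise the same argument applies to `π - t`, where `b + π / n < π` takes the role
of `0 < b`. -/
lemma sin_lt_mul_sin {n : ℕ} (hn : 1 ≤ n) {t b : ℝ} (ht : 0 ≤ t) (ht' : t ≤ Real.pi)
    (hb : 0 < b) (hb' : b + Real.pi / n < Real.pi) : Real.sin t < n * Real.sin (t / n + b) := by
  have hn0 : (0 : ℝ) < n := by exact_mod_cast hn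
  have hn1 : (1 : ℝ) ≤ n := by exact_mod_cast hn
  have hp := Real.pi_pos
  have hsmall : ∀ u : ℝ, 0 ≤ u → u ≤ Real.pi → Real.sin u ≤ n * Real.sin (u / n) := by
    intro u h0 h1
    have hu' : u ∈ Set.Icc 0 Real.pi := ⟨h0, h1⟩
    have h0' : (0 : ℝ) ∈ Set.Icc 0 Real.pi := ⟨le_rfl, hp.le⟩
    have hc := strictConcaveOn_sin_Icc.concaveOn.2 hu' h0' (by positivity : (0 : ℝ) ≤ 1 / n)
      (by rw [sub_nonneg, div_le_one hn0]; exact hn1 : (0 : ℝ) ≤ 1 - 1 / n) (by ring)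
    simp only [smul_eq_mul, Real.sin_zero, mul_zero, add_zero] at hc
    rw [show u / n = 1 / n * u by ring]
    calc Real.sin u = n * (1 / n * Real.sin u) := by field_simp
      _ ≤ _ := by gcongr
  have htn : 0 ≤ t / n := by positivity
  have htn' : t / n ≤ Real.pi / n := by gcongr
  rcases le_total (t / n + b) (Real.pi / 2) with h | h
  · refine (hsmall t ht ht').trans_lt ?_
    gcongr
    exact Real.sin_lt_sin_of_lt_of_le_pi_div_two (by linarith) h (by linarith)
  · rw [← Real.sin_pi_sub, ← Real.sin_pi_sub (t / n + b)]
    refine (hsmall (Real.pi - t) (by linarith) (by linarith)).trans_lt ?_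
    gcongr
    have : (Real.pi - t) / n = Real.pi / n - t / n := by ring
    exact Real.sin_lt_sin_of_lt_of_le_pi_div_two (by linarith) (by linarith) (by linarith)

/-- The quotient of the two sides of the strict inequality attains its maximum on a compact box.
Geometrically it is the ratio of hyperbolic densities `1 / (n sin (t / n + b))` and `1 / sin t`,
that is, the derivative of the affine map in the hyperbolic metric. -/
lemma exists_contraction_factor {n : ℕ} (hn : 1 ≤ n) {β : ℝ} (hβ : 0 < β) :
    ∃ k : ℝ, 0 < k ∧ k < 1 ∧ ∀ t b : ℝ, 0 ≤ t → t ≤ Real.pi → β ≤ b →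
      b + Real.pi / n ≤ Real.pi - β → Real.sin t ≤ k * (n * Real.sin (t / n + b)) := by
  have hp := Real.pi_pos
  have hn0 : (0 : ℝ) < n := by exact_mod_cast hn
  set K := Set.Icc 0 Real.pi ×ˢ Set.Icc β (Real.pi - β - Real.pi / n) with hK
  have hlt : ∀ p ∈ K, Real.sin p.1 < n * Real.sin (p.1 / n + p.2) := fun p hp =>
    sin_lt_mul_sin hn hp.1.1 hp.1.2 (hβ.trans_le hp.2.1) (by linarith [hp.2.2])
  have hpos : ∀ p ∈ K, 0 < n * Real.sin (p.1 / n + p.2) := fun p hp =>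
    (Real.sin_nonneg_of_nonneg_of_le_pi hp.1.1 hp.1.2).trans_lt (hlt p hp)
  rcases K.eq_empty_or_nonempty with h | h
  · refine ⟨1 / 2, by norm_num, by norm_num, fun t b h0 h1 h2 h3 => ?_⟩
    have : (t, b) ∈ K := ⟨⟨h0, h1⟩, ⟨h2, by simp only; linarith⟩⟩
    rw [h] at this
    exact this.elim
  · have hcont : ContinuousOn (fun p : ℝ × ℝ => Real.sin p.1 / (n * Real.sin (p.1 / n + p.2))) K :=
      ContinuousOn.div (by fun_prop) (by fun_prop) fun p hp => (hpos p hp).ne'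
    obtain ⟨p, hpK, hmax⟩ := (isCompact_Icc.prod isCompact_Icc).exists_isMaxOn h hcont
    -- The maximum with `1 / 2` only ensures a positive factor.
    refine ⟨max (1 / 2) (Real.sin p.1 / (n * Real.sin (p.1 / n + p.2))), by positivity, ?_, ?_⟩
    · refine max_lt (by norm_num) ?_
      rw [div_lt_one (hpos p hpK)]
      exact hlt p hpK
    · intro t b h0 h1 h2 h3
      have hm : (t, b) ∈ K := ⟨⟨h0, h1⟩, ⟨h2, by simp only; linarith⟩⟩
      have h4 := hmax hm
      simp only [Set.mem_ofPred_eq] at h4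
      rw [← div_le_iff₀ (hpos _ hm)]
      exact h4.trans (le_max_right _ _)

lemma sinh_mul_le {k v : ℝ} (hk : 0 ≤ k) (hk1 : k ≤ 1) (hv : 0 ≤ v) :
    Real.sinh (k * v) ≤ k * Real.sinh v := by
  have hm : MonotoneOn (fun v => k * Real.sinh v - Real.sinh (k * v)) (Set.Ici 0) := by
    refine monotoneOn_of_hasDerivWithinAt_nonneg
      (f' := fun v => k * Real.cosh v - Real.cosh (k * v) * k)
      (convex_Ici 0) (by fun_prop) ?_ ?_
    · intro x _
      have h1 := ((Real.hasDerivAt_sinh x).const_mul k).sub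
        ((Real.hasDerivAt_sinh (k * x)).comp x ((hasDerivAt_id x).const_mul k))
      simpa using! h1.hasDerivWithinAt
    · intro x hx
      rw [interior_Ici, Set.mem_Ioi] at hx
      have : Real.cosh (k * x) ≤ Real.cosh x := by
        rw [Real.cosh_le_cosh, abs_mul, abs_of_nonneg hk]
        exact mul_le_of_le_one_left (abs_nonneg _) hk1
      nlinarith
  have := hm (Set.mem_Ici.2 le_rfl) (Set.mem_Ici.2 hv) hv
  simp at this
  linarith

/-- The hyperbolic length coordinate on the vertical lines of the strip. -/
def heightCoord (t : ℝ) : ℝ := Real.log (Real.tan (t / 2))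

lemma tan_half_pos {t : ℝ} (h0 : 0 < t) (h1 : t < Real.pi) : 0 < Real.tan (t / 2) :=
  Real.tan_pos_of_pos_of_lt_pi_div_two (by linarith) (by linarith)

lemma hasDerivAt_heightCoord {t : ℝ} (h0 : 0 < t) (h1 : t < Real.pi) :
    HasDerivAt heightCoord (1 / Real.sin t) t := by
  have hc : Real.cos (t / 2) ≠ 0 :=
    (Real.cos_pos_of_mem_Ioo ⟨by linarith, by linarith⟩).ne'
  have hs : Real.sin (t / 2) ≠ 0 := (Real.sin_pos_of_pos_of_lt_pi (by linarith) (by linarith)).ne'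
  have h2 := (Real.hasDerivAt_tan hc).comp t ((hasDerivAt_id t).div_const 2)
  have h3 := h2.log (tan_half_pos h0 h1).ne'
  convert! h3 using 1
  have : Real.sin t = 2 * Real.sin (t / 2) * Real.cos (t / 2) := by
    rw [← Real.sin_two_mul]; congr 1; ring
  rw [this]
  simp only [Function.comp, id, Real.tan_eq_sin_div_cos]
  field_simp

/-- On a vertical line the right side is `hyp`, so `heightCoord` measures hyperbolic length there,
consistently with its derivative `1 / sin t`. -/
lemma sinh_heightCoord_sub {s t : ℝ} (hs : 0 < s) (hs' : s < Real.pi) (ht : 0 < t)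
    (ht' : t < Real.pi) : Real.sinh ((heightCoord s - heightCoord t) / 2) ^ 2 =
      Real.sin ((s - t) / 2) ^ 2 / (Real.sin s * Real.sin t) := by
  have hT := tan_half_pos ht ht'
  have hS := tan_half_pos hs hs'
  have h1 : Real.sinh ((heightCoord s - heightCoord t) / 2) ^ 2 =
      (Real.exp (heightCoord s - heightCoord t) + Real.exp (-(heightCoord s - heightCoord t)) - 2)
        / 4 := by
    have h2 := Real.cosh_sq ((heightCoord s - heightCoord t) / 2)
    have h3 := Real.cosh_two_mul ((heightCoord s - heightCoord t) / 2)
    rw [show 2 * ((heightCoord s - heightCoord t) / 2) = heightCoord s - heightCoord t by ring,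
      Real.cosh_eq] at h3
    linarith
  have hcs : Real.cos (s / 2) ≠ 0 := (Real.cos_pos_of_mem_Ioo ⟨by linarith, by linarith⟩).ne'
  have hct : Real.cos (t / 2) ≠ 0 := (Real.cos_pos_of_mem_Ioo ⟨by linarith, by linarith⟩).ne'
  have hss : Real.sin (s / 2) ≠ 0 := (Real.sin_pos_of_pos_of_lt_pi (by linarith) (by linarith)).ne'
  have hst : Real.sin (t / 2) ≠ 0 := (Real.sin_pos_of_pos_of_lt_pi (by linarith) (by linarith)).ne'
  rw [h1, neg_sub, Real.exp_sub, Real.exp_sub, heightCoord, heightCoord, Real.exp_log hS,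
    Real.exp_log hT, Real.tan_eq_sin_div_cos, Real.tan_eq_sin_div_cos,
    show (s - t) / 2 = s / 2 - t / 2 by ring, Real.sin_sub,
    show Real.sin s = 2 * Real.sin (s / 2) * Real.cos (s / 2) by
      rw [← Real.sin_two_mul]; congr 1; ring,
    show Real.sin t = 2 * Real.sin (t / 2) * Real.cos (t / 2) by
      rw [← Real.sin_two_mul]; congr 1; ring]
  field_simp
  ring

/-- The infinitesimal bound `hkb` integrates: both `heightCoord (u / n + b)` and `k * heightCoord u
- heightCoord (u / n + b)` increase in `u`, so differences of heights shrink by `k`. Then `sinh (k *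
v) ≤ k * sinh v` passes from lengths to `sinh²` of half lengths. -/
lemma sin_sq_contraction {n : ℕ} (hn : 1 ≤ n) {k b : ℝ} (hk : 0 < k) (hk1 : k < 1)
    (hb : 0 < b) (hb' : b + Real.pi / n < Real.pi)
    (hkb : ∀ t, 0 ≤ t → t ≤ Real.pi → Real.sin t ≤ k * (n * Real.sin (t / n + b)))
    {s t : ℝ} (hs : 0 < s) (hs' : s < Real.pi) (ht : 0 < t) (ht' : t < Real.pi) :
    Real.sin ((s - t) / 2 / n) ^ 2 / (Real.sin (s / n + b) * Real.sin (t / n + b)) ≤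
      k ^ 2 * (Real.sin ((s - t) / 2) ^ 2 / (Real.sin s * Real.sin t)) := by
  have hn0 : (0 : ℝ) < n := by exact_mod_cast hn
  wlog hst : t ≤ s generalizing s t
  · have := this ht ht' hs hs' (le_of_not_ge hst)
    rw [show (s - t) / 2 / n = -((t - s) / 2 / n) by ring,
      show (s - t) / 2 = -((t - s) / 2) by ring,
      Real.sin_neg, Real.sin_neg, neg_sq, neg_sq, mul_comm (Real.sin (s / n + b)),
      mul_comm (Real.sin s)]
    exact this
  have hr : ∀ u, 0 < u → u < Real.pi → 0 < u / n + b ∧ u / n + b < Real.pi := fun u h0 h1 => by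
    have h2 : u / n < Real.pi / n := by gcongr
    exact ⟨by positivity, by linarith⟩
  have hder : ∀ u, 0 < u → u < Real.pi → HasDerivAt
      (fun u => heightCoord (u / n + b)) (1 / (n * Real.sin (u / n + b))) u := fun u h0 h1 => by
    have h2 := (hasDerivAt_heightCoord (hr u h0 h1).1 (hr u h0 h1).2).comp u
      (((hasDerivAt_id u).div_const (n : ℝ)).add_const b)
    convert! h2 using 1
    field_simp
  have hpos : ∀ u, 0 < u → u < Real.pi → 0 < n * Real.sin (u / n + b) := fun u h0 h1 =>
    mul_pos hn0 (Real.sin_pos_of_pos_of_lt_pi (hr u h0 h1).1 (hr u h0 h1).2)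
  have hder2 : ∀ u, 0 < u → u < Real.pi → HasDerivAt
      (fun u => k * heightCoord u - heightCoord (u / n + b))
      (k * (1 / Real.sin u) - 1 / (n * Real.sin (u / n + b))) u := fun u h0 h1 =>
    ((hasDerivAt_heightCoord h0 h1).const_mul k).sub (hder u h0 h1)
  have hm1 : MonotoneOn (fun u => heightCoord (u / n + b)) (Set.Ioo 0 Real.pi) := by
    refine monotoneOn_of_hasDerivWithinAt_nonneg
      (f' := fun u => 1 / (n * Real.sin (u / n + b)))
      (convex_Ioo _ _)
      (fun u hu => (hder u hu.1 hu.2).continuousAt.continuousWithinAt) ?_ ?_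
    · intro u hu
      rw [interior_Ioo] at hu
      exact (hder u hu.1 hu.2).hasDerivWithinAt
    · intro u hu
      rw [interior_Ioo] at hu
      exact (one_div_pos.2 (hpos u hu.1 hu.2)).le
  have hm2 : MonotoneOn (fun u => k * heightCoord u - heightCoord (u / n + b))
      (Set.Ioo 0 Real.pi) := by
    refine monotoneOn_of_hasDerivWithinAt_nonneg
      (f' := fun u => k * (1 / Real.sin u) - 1 / (n * Real.sin (u / n + b))) (convex_Ioo _ _)
      (fun u hu => (hder2 u hu.1 hu.2).continuousAt.continuousWithinAt) ?_ ?_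
    · intro u hu
      rw [interior_Ioo] at hu
      exact (hder2 u hu.1 hu.2).hasDerivWithinAt
    · intro u hu
      rw [interior_Ioo] at hu
      have h1 := hkb u hu.1.le hu.2.le
      have h2 := hpos u hu.1 hu.2
      have h3 := Real.sin_pos_of_pos_of_lt_pi hu.1 hu.2
      rw [sub_nonneg, mul_one_div, div_le_div_iff₀ h2 h3]
      linarith
  have hs2 : s ∈ Set.Ioo 0 Real.pi := ⟨hs, hs'⟩
  have ht2 : t ∈ Set.Ioo 0 Real.pi := ⟨ht, ht'⟩
  have h1 := hm1 ht2 hs2 hst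
  have h2 := hm2 ht2 hs2 hst
  simp only at h1 h2
  have h3 := sinh_heightCoord_sub (hr s hs hs').1 (hr s hs hs').2 (hr t ht ht').1 (hr t ht ht').2
  rw [show (s / n + b - (t / n + b)) / 2 = (s - t) / 2 / n by ring] at h3
  rw [← h3, ← sinh_heightCoord_sub hs hs' ht ht', ← mul_pow]
  have h4 : 0 ≤ heightCoord s - heightCoord t := by
    by_contra! h
    nlinarith
  refine pow_le_pow_left₀ (Real.sinh_nonneg_iff.2 (by linarith)) ?_ 2
  calc _ ≤ Real.sinh (k * ((heightCoord s - heightCoord t) / 2)) := by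
        rw [Real.sinh_le_sinh]; linarith
    _ ≤ _ := sinh_mul_le hk.le hk1.le (by linarith)

/-- The numerator `|sinh|²` splits into `sinh²` of the real part and `sin²` of the imaginary part.
The second term is the vertical contraction. In the first, `sinh (r / n) ≤ sinh r / n` for `r ≥ 0`
gains `1 / n ^ 2`, and `hkb` at both points bounds the change of the denominators by `k ^ 2 * n ^
2`. -/
lemma hyp_affine_le {n : ℕ} (hn : 1 ≤ n) {k : ℝ} {b : ℂ} (hk : 0 < k) (hk1 : k < 1)
    (hb : 0 < b.im) (hb' : b.im + Real.pi / n < Real.pi)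
    (hkb : ∀ t, 0 ≤ t → t ≤ Real.pi → Real.sin t ≤ k * (n * Real.sin (t / n + b.im)))
    {x y : ℂ} (hx : x ∈ strip) (hy : y ∈ strip) :
    hyp (x / n + b) (y / n + b) ≤ k ^ 2 * hyp x y := by
  have hn0 : (0 : ℝ) < n := by exact_mod_cast hn
  have him : ∀ z : ℂ, (z / n + b).im = z.im / n + b.im := fun z => by simp
  unfold hyp
  rw [him, him, norm_sinh_sq, norm_sinh_sq, add_div, add_div, mul_add]
  have e1 : ((x / n + b - (y / n + b)) / 2).im = (x.im - y.im) / 2 / n := by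
    simp; ring
  have e2 : ((x / n + b - (y / n + b)) / 2).re = (x.re - y.re) / 2 / n := by
    simp; ring
  have e3 : ((x - y) / 2).im = (x.im - y.im) / 2 := by simp
  have e4 : ((x - y) / 2).re = (x.re - y.re) / 2 := by simp
  rw [e1, e2, e3, e4]
  have hsx := sin_im_pos hx
  have hsy := sin_im_pos hy
  refine add_le_add ?_ (sin_sq_contraction hn hk hk1 hb hb' hkb hx.1 hx.2 hy.1 hy.2)
  have h1 := hkb x.im hx.1.le hx.2.le
  have h2 := hkb y.im hy.1.le hy.2.le
  have hpx : 0 < Real.sin (x.im / n + b.im) := by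
    have := hsx.trans_le h1
    rwa [mul_pos_iff_of_pos_left hk, mul_pos_iff_of_pos_left hn0] at this
  have hpy : 0 < Real.sin (y.im / n + b.im) := by
    have := hsy.trans_le h2
    rwa [mul_pos_iff_of_pos_left hk, mul_pos_iff_of_pos_left hn0] at this
  have h3 : ∀ r : ℝ, Real.sinh (r / n) ^ 2 ≤ 1 / n ^ 2 * Real.sinh r ^ 2 := by
    have h4 : ∀ r : ℝ, 0 ≤ r → Real.sinh (r / n) ^ 2 ≤ 1 / n ^ 2 * Real.sinh r ^ 2 := fun r hr => by
      have h5 := sinh_mul_le (by positivity : (0 : ℝ) ≤ 1 / n)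
        (by rw [div_le_one hn0]; exact_mod_cast hn) hr
      rw [show r / n = 1 / n * r by ring, ← one_div_pow, ← mul_pow]
      exact pow_le_pow_left₀ (Real.sinh_nonneg_iff.2 (by positivity)) h5 2
    intro r
    rcases le_total 0 r with hr | hr
    · exact h4 r hr
    · have := h4 (-r) (by linarith)
      rwa [neg_div, Real.sinh_neg, Real.sinh_neg, neg_sq, neg_sq] at this
  rw [← mul_div_assoc, div_le_div_iff₀ (by positivity) (by positivity)]
  have h5 : Real.sin x.im * Real.sin y.im ≤
      k ^ 2 * n ^ 2 * (Real.sin (x.im / n + b.im) * Real.sin (y.im / n + b.im)) := by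
    calc _ ≤ (k * (n * Real.sin (x.im / n + b.im))) * (k * (n * Real.sin (y.im / n + b.im))) := by
          gcongr
      _ = _ := by ring
  calc _ ≤ (1 / n ^ 2 * Real.sinh ((x.re - y.re) / 2) ^ 2) *
        (k ^ 2 * n ^ 2 * (Real.sin (x.im / n + b.im) * Real.sin (y.im / n + b.im))) := by
        gcongr
        exact h3 _
    _ = _ := by field_simp

end StripDynamics
end

noncomputable section

namespace StripDynamics

open Complex Filter Topology

/-! ### Odd extensions and the expanding model map -/

/-- The odd extension of a function on the positive reals. -/
def oddExt (G : ℝ → ℂ) (t : ℝ) : ℂ := if 0 < t then G t else if t < 0 then -G (-t) else 0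

lemma oddExt_pos (G : ℝ → ℂ) {t : ℝ} (ht : 0 < t) : oddExt G t = G t := if_pos ht

lemma oddExt_zero (G : ℝ → ℂ) : oddExt G 0 = 0 := by simp [oddExt]

lemma oddExt_neg (G : ℝ → ℂ) (t : ℝ) : oddExt G (-t) = -oddExt G t := by
  unfold oddExt
  rcases lt_trichotomy t 0 with h | h | h
  · simp [h, not_lt_of_gt h]
  · simp [h]
  · simp [h, not_lt_of_gt h]

lemma continuous_oddExt {G : ℝ → ℂ} (hG : ContinuousOn G (Set.Ioi 0))
    (h0 : Tendsto G (𝓝[>] 0) (𝓝 0)) : Continuous (oddExt G) := by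
  have hpos : ∀ t : ℝ, 0 < t → ContinuousAt (oddExt G) t := fun t ht => by
    refine (hG.continuousAt (Ioi_mem_nhds ht)).congr ?_
    filter_upwards [Ioi_mem_nhds ht] with s hs
    exact (oddExt_pos G hs).symm
  have hodd : oddExt G = fun t => -oddExt G (-t) := by
    funext t; rw [oddExt_neg, neg_neg]
  rw [continuous_iff_continuousAt]
  intro t
  rcases lt_trichotomy t 0 with h | h | h
  · rw [hodd]
    exact (ContinuousAt.comp (hpos (-t) (by linarith)) continuous_neg.continuousAt).neg
  · subst h
    have hr : Tendsto (oddExt G) (𝓝[>] 0) (𝓝 0) := by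
      refine h0.congr' ?_
      filter_upwards [self_mem_nhdsWithin] with s hs
      exact (oddExt_pos G hs).symm
    have hl : Tendsto (oddExt G) (𝓝[<] 0) (𝓝 0) := by
      rw [hodd]
      have hneg : Tendsto (fun t : ℝ => -t) (𝓝[<] 0) (𝓝[>] 0) := by
        have := tendsto_neg_nhdsLT (a := (0 : ℝ))
        rwa [neg_zero] at this
      simpa using (hr.comp hneg).neg
    rw [continuousAt_iff_punctured_nhds, ← nhdsLT_sup_nhdsGT, oddExt_zero]
    exact hl.sup hr
  · exact hpos t h

/-- The model map `t ↦ n log (2 sinh t)` on the positive reals. -/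
def model (n : ℕ) (t : ℝ) : ℝ := n * Real.log (2 * Real.sinh t)

/-- The inverse of `model`. -/
def modelInv (n : ℕ) (u : ℝ) : ℝ := Real.arsinh (Real.exp (u / n) / 2)

lemma modelInv_pos (n : ℕ) (u : ℝ) : 0 < modelInv n u := by
  rw [modelInv, Real.arsinh_pos_iff]; positivity

lemma model_modelInv {n : ℕ} (hn : 1 ≤ n) (u : ℝ) : model n (modelInv n u) = u := by
  have hn0 : (n : ℝ) ≠ 0 := by positivity
  rw [model, modelInv, Real.sinh_arsinh, mul_div_cancel₀ _ two_ne_zero, Real.log_exp]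
  field_simp

lemma exp_model_div {n : ℕ} (hn : 1 ≤ n) {t : ℝ} (ht : 0 < t) :
    Real.exp (model n t / n) = 2 * Real.sinh t := by
  have hn0 : (n : ℝ) ≠ 0 := by positivity
  have := Real.sinh_pos_iff.2 ht
  rw [model, mul_div_cancel_left₀ _ hn0, Real.exp_log (by positivity)]

/-- The derivative of `log (2 sinh t)` is `coth t ≥ 1`, so the model map expands by at least `n`.
Here this is read off from the exponentials. -/
lemma model_sub_ge {n : ℕ} {s t : ℝ} (hs : 0 < s) (hst : s ≤ t) :
    n * (t - s) ≤ model n t - model n s := by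
  have h1 := Real.sinh_pos_iff.2 hs
  have h2 := Real.sinh_pos_iff.2 (hs.trans_le hst)
  unfold model
  rw [← mul_sub]
  refine mul_le_mul_of_nonneg_left ?_ n.cast_nonneg
  rw [← Real.log_div (by positivity) (by positivity), Real.le_log_iff_exp_le (by positivity),
    le_div_iff₀ (by positivity), Real.sinh_eq, Real.sinh_eq]
  have h3 : Real.exp (t - s) * Real.exp s = Real.exp t := by rw [← Real.exp_add]; congr 1; ring
  have h4 : Real.exp (-t) ≤ Real.exp (t - s) * Real.exp (-s) := by
    rw [← Real.exp_add, Real.exp_le_exp]; linarith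
  linarith

lemma model_mono {n : ℕ} {s t : ℝ} (hs : 0 < s) (hst : s ≤ t) : model n s ≤ model n t := by
  have h1 := Real.sinh_pos_iff.2 hs
  have h2 := Real.sinh_le_sinh.2 hst
  unfold model
  gcongr

lemma continuousOn_model (n : ℕ) : ContinuousOn (model n) (Set.Ioi 0) := by
  unfold model
  refine ContinuousOn.mul continuousOn_const (ContinuousOn.log (by fun_prop) fun t ht => ?_)
  have := Real.sinh_pos_iff.2 (Set.mem_Ioi.1 ht)
  positivity

/-! ### The inverse branches -/

/-- Parameters of the family of inverse branches: the degree, the bounds for the translations. -/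
structure Params where
  /-- the degree -/
  n : ℕ
  /-- distance of the sectors to the cut -/
  β : ℝ
  /-- bound for the real part of the translation -/
  L : ℝ
  two_le : 2 ≤ n
  pos : 0 < β
  le_half : β ≤ Real.pi / 2

namespace Params

variable (P : Params)

/-- Admissible translations. -/
def adm : Set ℂ := {b | |b.re| ≤ P.L ∧ P.β ≤ b.im ∧ b.im + Real.pi / P.n ≤ Real.pi - P.β}

/-- Admissible sequences of translations. -/
def Adm : Set (ℕ → ℂ) := {b | ∀ m, b m ∈ P.adm}

lemma one_le : 1 ≤ P.n := by have := P.two_le; omega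

lemma n_pos : (0 : ℝ) < P.n := by exact_mod_cast P.one_le

/-- The contraction factor of the inverse branches. -/
def k : ℝ := (exists_contraction_factor P.one_le P.pos).choose

lemma k_pos : 0 < P.k := (exists_contraction_factor P.one_le P.pos).choose_spec.1

lemma k_lt_one : P.k < 1 := (exists_contraction_factor P.one_le P.pos).choose_spec.2.1

lemma k_spec : ∀ t b : ℝ, 0 ≤ t → t ≤ Real.pi → P.β ≤ b →
    b + Real.pi / P.n ≤ Real.pi - P.β → Real.sin t ≤ P.k * (P.n * Real.sin (t / P.n + b)) :=
  (exists_contraction_factor P.one_le P.pos).choose_spec.2.2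

/-- All curves lie in `band ε`. -/
def ε : ℝ := Real.sin P.β

lemma ε_pos : 0 < P.ε :=
  Real.sin_pos_of_pos_of_lt_pi P.pos (by linarith [P.le_half, Real.pi_pos])

lemma mem_band {z : ℂ} (h0 : P.β ≤ z.im) (h1 : z.im ≤ Real.pi - P.β) : z ∈ band P.ε := by
  have hβ := P.pos
  have hβ' := P.le_half
  refine ⟨by linarith, by linarith, ?_⟩
  unfold ε
  rcases le_total z.im (Real.pi / 2) with h | h
  · exact Real.sin_le_sin_of_le_of_le_pi_div_two (by linarith) h h0
  · rw [← Real.sin_pi_sub z.im]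
    exact Real.sin_le_sin_of_le_of_le_pi_div_two (by linarith) (by linarith) (by linarith)

lemma band_subset : band P.ε ⊆ strip := band_subset_strip P.ε_pos

lemma center_mem : (Real.pi / 2 * I : ℂ) ∈ band P.ε := by
  have h : (Real.pi / 2 * I : ℂ).im = Real.pi / 2 := by
    rw [show (Real.pi / 2 * I : ℂ) = ((Real.pi / 2 : ℝ) : ℂ) * I by push_cast; ring]; simp
  exact P.mem_band (by rw [h]; exact P.le_half) (by rw [h]; linarith [P.le_half])

open Classical in
/-- The inverse branch `x ↦ X` with `2 cosh X = exp (x / n + b)`. -/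
def branch (b x : ℂ) : ℂ :=
  if h : ∃ X ∈ strip, 0 < X.re ∧ 2 * cosh X = exp (x / P.n + b) then h.choose else 0

variable {P}

lemma affine_im (b x : ℂ) : (x / P.n + b).im = x.im / P.n + b.im := by simp

lemma affine_mem_band {b x : ℂ} (hb : b ∈ P.adm) (hx : x ∈ strip) :
    x / P.n + b ∈ band P.ε := by
  have h1 : 0 ≤ x.im / P.n := div_nonneg hx.1.le P.n_pos.le
  have h2 : x.im / P.n ≤ Real.pi / P.n := div_le_div_of_nonneg_right hx.2.le P.n_pos.le
  exact P.mem_band (by rw [affine_im]; linarith [hb.2.1]) (by rw [affine_im]; linarith [hb.2.2])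

lemma branch_spec {b x : ℂ} (hb : b ∈ P.adm) (hx : x ∈ strip) :
    P.branch b x ∈ strip ∧ 0 < (P.branch b x).re ∧
      2 * cosh (P.branch b x) = exp (x / P.n + b) := by
  have hex : ∃ X ∈ strip, 0 < X.re ∧ 2 * cosh X = exp (x / P.n + b) := by
    apply exists_cosh_eq
    rw [exp_im]
    have := sin_im_pos (P.band_subset (affine_mem_band hb hx))
    positivity
  unfold branch
  rw [dif_pos hex]
  exact hex.choose_spec

lemma branch_mem_band {b x : ℂ} (hb : b ∈ P.adm) (hx : x ∈ strip) :
    P.branch b x ∈ band P.ε := by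
  obtain ⟨h1, h2, h3⟩ := branch_spec hb hx
  refine ⟨h1.1.le, h1.2.le, sin_im_ge_of_cosh_eq h2 h3 ?_ P.ε_pos.le⟩
  rw [exp_im, norm_exp, mul_comm]
  gcongr
  exact (affine_mem_band hb hx).2.2

lemma branch_unique {b x X : ℂ} (hb : b ∈ P.adm) (hx : x ∈ strip) (hX : X ∈ strip)
    (hX0 : 0 < X.re) (h : 2 * cosh X = exp (x / P.n + b)) : P.branch b x = X := by
  obtain ⟨h1, h2, h3⟩ := branch_spec hb hx
  exact cosh_inj_of_mem_strip h1 hX h2 hX0 (by linear_combination h3 / 2 - h / 2)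

/-- A branch is the affine contraction, followed by the isometry `exp` and the nonexpanding inverse
of `2 cosh`. The factor is the same for all admissible translations. -/
lemma hyp_branch_le {b x y : ℂ} (hb : b ∈ P.adm) (hx : x ∈ strip) (hy : y ∈ strip) :
    hyp (P.branch b x) (P.branch b y) ≤ P.k ^ 2 * hyp x y := by
  obtain ⟨h1, h2, h3⟩ := branch_spec hb hx
  obtain ⟨h1', h2', h3'⟩ := branch_spec hb hy
  refine (hyp_le_of_cosh_eq h1 h1' h2 h2' h3 h3').trans ?_
  exact hyp_affine_le P.one_le P.k_pos P.k_lt_one (P.pos.trans_le hb.2.1)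
    (by linarith [hb.2.2, P.pos]) (fun t h0 h1 => P.k_spec t b.im h0 h1 hb.2.1 hb.2.2) hx hy

lemma continuousOn_branch {b : ℂ} (hb : b ∈ P.adm) : ContinuousOn (P.branch b) strip := by
  intro x hx
  rw [ContinuousWithinAt, tendsto_iff_norm_sub_tendsto_zero]
  have h1 : Tendsto (fun y => Real.pi * √(P.k ^ 2 * hyp x y)) (𝓝[strip] x) (𝓝 0) := by
    have h2 : Tendsto (fun y => hyp x y) (𝓝[strip] x) (𝓝 0) := by
      have := (continuousAt_hyp hx).tendsto
      rw [hyp_self] at this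
      exact this.mono_left nhdsWithin_le_nhds
    have h3 := ((h2.const_mul (P.k ^ 2)).sqrt).const_mul Real.pi
    simpa using h3
  refine squeeze_zero' (Eventually.of_forall fun _ => norm_nonneg _) ?_ h1
  filter_upwards [self_mem_nhdsWithin] with y hy
  rw [norm_sub_rev]
  refine (norm_sub_le_hyp (branch_spec hb hx).1 (branch_spec hb hy).1).trans ?_
  gcongr
  exact hyp_branch_le hb hx hy

/-! ### The curves -/

variable (P)

/-- The transform of a curve under the two inverse branches. -/
def fold (b : ℂ) (ψ : ℝ → ℂ) (t : ℝ) : ℂ :=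
  if 0 < t then P.branch b (ψ (model P.n t))
  else if t < 0 then Real.pi * I - P.branch b (ψ (model P.n (-t)))
  else Real.pi / 2 * I

variable {P}

lemma fold_pos {b : ℂ} {ψ : ℝ → ℂ} {t : ℝ} (ht : 0 < t) :
    P.fold b ψ t = P.branch b (ψ (model P.n t)) := if_pos ht

lemma fold_zero {b : ℂ} {ψ : ℝ → ℂ} : P.fold b ψ 0 = Real.pi / 2 * I := by simp [fold]

lemma fold_neg {b : ℂ} {ψ : ℝ → ℂ} (t : ℝ) : P.fold b ψ (-t) = Real.pi * I - P.fold b ψ t := by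
  unfold fold
  rcases lt_trichotomy t 0 with h | h | h
  · simp [h, not_lt_of_gt h]
  · simp [h]; ring
  · simp [h, not_lt_of_gt h]

/-- Transfer of a symmetric property from positive to all parameters. -/
lemma of_pos {p : ℝ → Prop} (hp : ∀ t, 0 < t → p t) (h0 : p 0) (hs : ∀ t, p t → p (-t)) (t : ℝ) :
    p t := by
  rcases lt_trichotomy t 0 with h | h | h
  · simpa using hs (-t) (hp (-t) (by linarith))
  · rwa [h]
  · exact hp t h

lemma fold_mem_band {b : ℂ} (hb : b ∈ P.adm) {ψ : ℝ → ℂ} (hψ : ∀ t, ψ t ∈ strip) (t : ℝ) :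
    P.fold b ψ t ∈ band P.ε := by
  refine of_pos (p := fun t => P.fold b ψ t ∈ band P.ε) (fun t ht => ?_) ?_ (fun t ht => ?_) t
  · rw [fold_pos ht]; exact branch_mem_band hb (hψ _)
  · rw [fold_zero]; exact P.center_mem
  · rw [fold_neg]; exact reflect_mem_band ht

lemma hyp_fold_le {b : ℂ} (hb : b ∈ P.adm) {ψ χ : ℝ → ℂ} (hψ : ∀ t, ψ t ∈ strip)
    (hχ : ∀ t, χ t ∈ strip) {D : ℝ} (hD : ∀ t, hyp (ψ t) (χ t) ≤ D) (t : ℝ) :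
    hyp (P.fold b ψ t) (P.fold b χ t) ≤ P.k ^ 2 * D := by
  have hD0 : 0 ≤ D := (hyp_nonneg (hψ 0) (hχ 0)).trans (hD 0)
  refine of_pos (p := fun t => hyp (P.fold b ψ t) (P.fold b χ t) ≤ P.k ^ 2 * D)
    (fun t ht => ?_) ?_ (fun t ht => ?_) t
  · rw [fold_pos ht, fold_pos ht]
    refine (hyp_branch_le hb (hψ _) (hχ _)).trans ?_
    gcongr
    exact hD _
  · rw [fold_zero, fold_zero, hyp_self]; positivity
  · rwa [fold_neg, fold_neg, hyp_reflect]

/-- As `cosh (π i - x) = -cosh x`, the two halves of the folded curve become one odd curve after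
applying `2 cosh`. -/
lemma two_cosh_fold {b : ℂ} (hb : b ∈ P.adm) {ψ : ℝ → ℂ} (hψ : ∀ t, ψ t ∈ strip) (t : ℝ) :
    2 * cosh (P.fold b ψ t) = oddExt (fun t => exp (ψ (model P.n t) / P.n + b)) t := by
  refine of_pos (p := fun t => 2 * cosh (P.fold b ψ t) =
    oddExt (fun t => exp (ψ (model P.n t) / P.n + b)) t) (fun t ht => ?_) ?_ (fun t ht => ?_) t
  · rw [fold_pos ht, oddExt_pos _ ht, (branch_spec hb (hψ _)).2.2]
  · rw [fold_zero, oddExt_zero, cosh_mul_I, cos_pi_div_two, mul_zero]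
  · rw [fold_neg, oddExt_neg, ← ht, cosh_sub, cosh_mul_I, sinh_mul_I, cos_pi, sin_pi]
    ring

/-- On the band `2 cosh` has no critical points and is injective with a Lipschitz inverse, so
continuity may be tested after applying it. -/
lemma norm_sub_le_norm_cosh_sub {ε : ℝ} (hε : 0 < ε) {x y : ℂ} (hx : x ∈ band ε)
    (hy : y ∈ band ε) : ‖x - y‖ ≤ Real.pi / (2 * ε) * ‖2 * cosh x - 2 * cosh y‖ := by
  have hb := band_subset_strip hε
  have h1 := norm_le_norm_sinh (abs_im_half_sub_le (hb hx) (hb hy))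
  have h2 : ε ≤ ‖sinh ((x + y) / 2)‖ := by
    refine (abs_le_of_sq_le_sq' ?_ (norm_nonneg _)).2
    rw [norm_sinh_sq]
    have := (midpoint_mem_band hx hy).2.2
    nlinarith [sq_nonneg (Real.sinh ((x + y) / 2).re)]
  have h3 : ‖(x - y) / 2‖ = ‖x - y‖ / 2 := by simp
  rw [h3] at h1
  rw [← mul_sub, cosh_sub_cosh]
  simp only [norm_mul, norm_ofNat]
  have h4 := mul_le_mul_of_nonneg_right h2 (norm_nonneg (sinh ((x - y) / 2)))
  rw [div_mul_eq_mul_div, le_div_iff₀ (by positivity)]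
  have := Real.pi_pos
  calc ‖x - y‖ * (2 * ε) ≤ (Real.pi * ‖sinh ((x - y) / 2)‖) * (2 * ε) := by
        gcongr; linarith
    _ = 2 * Real.pi * (ε * ‖sinh ((x - y) / 2)‖) := by ring
    _ ≤ 2 * Real.pi * (‖sinh ((x + y) / 2)‖ * ‖sinh ((x - y) / 2)‖) := by gcongr
    _ ≤ Real.pi * (2 * (2 * (‖sinh ((x + y) / 2)‖ * ‖sinh ((x - y) / 2)‖))) := by
        nlinarith [mul_nonneg Real.pi_pos.le
          (mul_nonneg (norm_nonneg (sinh ((x + y) / 2))) (norm_nonneg (sinh ((x - y) / 2))))]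

lemma norm_exp_affine (b x : ℂ) :
    ‖exp (x / P.n + b)‖ = Real.exp (x.re / P.n) * Real.exp b.re := by
  rw [norm_exp, ← Real.exp_add]; congr 1; simp

/-- The point at issue is `t = 0`, where `model` tends to `-∞` and the two halves are glued. After
applying `2 cosh` the curve is an odd extension whose modulus near `0` is at most a constant times
`sinh t`, because `ψ` stays close to a horizontal line. -/
lemma continuous_fold {b : ℂ} (hb : b ∈ P.adm) {ψ : ℝ → ℂ} (hψ : ∀ t, ψ t ∈ strip)
    (hc : Continuous ψ) {M : ℝ} (hM : ∀ t, |(ψ t).re - t| ≤ M) : Continuous (P.fold b ψ) := by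
  have hW : Continuous fun t => 2 * cosh (P.fold b ψ t) := by
    simp_rw [two_cosh_fold hb hψ]
    refine continuous_oddExt ?_ ?_
    · refine ContinuousOn.cexp (ContinuousOn.add (ContinuousOn.div_const ?_ _) continuousOn_const)
      exact hc.comp_continuousOn (continuousOn_model P.n)
    · rw [tendsto_zero_iff_norm_tendsto_zero]
      have h1 : Tendsto (fun t : ℝ => 2 * Real.sinh t * Real.exp (M / P.n) * Real.exp b.re)
          (𝓝[>] 0) (𝓝 0) := by
        have : Continuous fun t : ℝ => 2 * Real.sinh t * Real.exp (M / P.n) * Real.exp b.re := by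
          fun_prop
        have h2 := this.tendsto 0
        simp only [Real.sinh_zero, mul_zero, zero_mul] at h2
        exact h2.mono_left nhdsWithin_le_nhds
      refine squeeze_zero' (Eventually.of_forall fun _ => norm_nonneg _) ?_ h1
      filter_upwards [self_mem_nhdsWithin] with t ht
      rw [norm_exp_affine, ← exp_model_div P.one_le ht]
      refine mul_le_mul_of_nonneg_right ?_ (Real.exp_pos _).le
      rw [← Real.exp_add, ← add_div, Real.exp_le_exp]
      have := (abs_le.1 (hM (model P.n t))).2
      exact div_le_div_of_nonneg_right (by linarith) P.n_pos.le
  rw [continuous_iff_continuousAt]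
  intro t
  rw [ContinuousAt, tendsto_iff_norm_sub_tendsto_zero]
  have h1 : Tendsto (fun s => Real.pi / (2 * P.ε) *
      ‖2 * cosh (P.fold b ψ s) - 2 * cosh (P.fold b ψ t)‖) (𝓝 t) (𝓝 0) := by
    have h2 := tendsto_iff_norm_sub_tendsto_zero.1 (hW.tendsto t)
    simpa using h2.const_mul (Real.pi / (2 * P.ε))
  exact squeeze_zero (fun _ => norm_nonneg _) (fun s =>
    norm_sub_le_norm_cosh_sub P.ε_pos (fold_mem_band hb hψ s) (fold_mem_band hb hψ t)) h1

/-- The shift of sequences. -/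
def shift (b : ℕ → ℂ) : ℕ → ℂ := fun m => b (m + 1)

lemma shift_mem {b : ℕ → ℂ} (hb : b ∈ P.Adm) : shift b ∈ P.Adm := fun m => hb (m + 1)

variable (P)

/-- The approximations of the curves. -/
def approx : ℕ → (ℕ → ℂ) → ℝ → ℂ
  | 0, _ => fun t => t + Real.pi / 2 * I
  | m + 1, b => P.fold (b 0) (approx m (shift b))

/-- The limit curve. -/
def curve (b : ℕ → ℂ) (t : ℝ) : ℂ := limUnder atTop fun m => P.approx m b t

/-- The bound for the first step. -/
def C₀ : ℝ := Real.cosh P.L / P.ε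

/-- The distance of the curves to a straight line. -/
def M : ℝ := Real.pi * P.C₀ / (1 - P.k)

lemma C₀_pos : 0 < P.C₀ := div_pos (Real.cosh_pos _) P.ε_pos

lemma M_pos : 0 < P.M :=
  div_pos (mul_pos Real.pi_pos P.C₀_pos) (sub_pos.2 P.k_lt_one)

variable {P}

lemma line_mem_band (t : ℝ) : (t + Real.pi / 2 * I : ℂ) ∈ band P.ε := by
  have h : (t + Real.pi / 2 * I : ℂ).im = Real.pi / 2 := by
    rw [show (t + Real.pi / 2 * I : ℂ) = t + ((Real.pi / 2 : ℝ) : ℂ) * I by push_cast; ring]; simp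
  exact P.mem_band (by rw [h]; exact P.le_half) (by rw [h]; linarith [P.le_half])

lemma approx_mem_band (m : ℕ) {b : ℕ → ℂ} (hb : b ∈ P.Adm) (t : ℝ) :
    P.approx m b t ∈ band P.ε := by
  induction m generalizing b t with
  | zero => exact line_mem_band t
  | succ m ih => exact fold_mem_band (hb 0) (fun t => P.band_subset (ih (shift_mem hb) t)) t

lemma approx_mem_strip (m : ℕ) {b : ℕ → ℂ} (hb : b ∈ P.Adm) (t : ℝ) :
    P.approx m b t ∈ strip := P.band_subset (approx_mem_band m hb t)

lemma hyp_line_le {b : ℂ} (hb : b ∈ P.adm) (t : ℝ) :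
    hyp (t + Real.pi / 2 * I) (P.fold b (fun t => t + Real.pi / 2 * I) t) ≤ P.C₀ ^ 2 := by
  refine of_pos (p := fun t : ℝ =>
    hyp (t + Real.pi / 2 * I) (P.fold b (fun t => t + Real.pi / 2 * I) t) ≤ P.C₀ ^ 2)
    (fun t ht => ?_) ?_ (fun t ht => ?_) t
  · rw [fold_pos ht]
    obtain ⟨h1, h2, h3⟩ := branch_spec hb (P.band_subset (line_mem_band (P := P) (model P.n t)))
    have hs := Real.sinh_pos_iff.2 ht
    -- This identity explains the choice of `model`: on the line `Im = π / 2`, the value of `2 cosh`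
    -- at `t` is `exp` of the point with real part `model n t / n`. The line and its transform
    -- therefore solve equations whose right sides are exponentials of points with real parts
    -- differing by `b.re`.
    have h4 : 2 * cosh (t + Real.pi / 2 * I : ℂ) =
        exp ((Real.log (2 * Real.sinh t) : ℝ) + Real.pi / 2 * I) := by
      rw [exp_add, ← ofReal_exp, Real.exp_log (by positivity), exp_pi_div_two_mul_I, cosh_add,
        cosh_mul_I, sinh_mul_I, cos_pi_div_two, sin_pi_div_two]
      push_cast
      ring
    refine (hyp_le_of_cosh_eq (P.band_subset (line_mem_band t)) h1 (by simpa using ht) h2 h4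
      h3).trans ?_
    refine hyp_le P.ε_pos (line_mem_band _)
      (affine_mem_band hb (P.band_subset (line_mem_band (P := P) (model P.n t)))) ?_
    have h5 : (((Real.log (2 * Real.sinh t) : ℝ) : ℂ) + Real.pi / 2 * I).re =
        Real.log (2 * Real.sinh t) := by simp
    have h6 : ((model P.n t + Real.pi / 2 * I : ℂ) / P.n + b).re =
        Real.log (2 * Real.sinh t) + b.re := by
      have := P.n_pos.ne'
      simp [model]
      field_simp
    rw [h5, h6, sub_add_cancel_left, abs_neg]
    exact hb.1
  · simp only [fold_zero, ofReal_zero, zero_add, hyp_self]; positivity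
  · rw [fold_neg, ← hyp_reflect]
    convert ht using 2
    · push_cast; ring
    · ring

/-- The two approximations are images of the line and of its first transform under the same `m`
inverse branches, so the initial bound `C₀` shrinks by `k` at each step. -/
lemma hyp_approx_le (m : ℕ) {b : ℕ → ℂ} (hb : b ∈ P.Adm) (t : ℝ) :
    hyp (P.approx m b t) (P.approx (m + 1) b t) ≤ (P.C₀ * P.k ^ m) ^ 2 := by
  induction m generalizing b t with
  | zero => simpa [approx] using hyp_line_le (hb 0) t
  | succ m ih =>
    refine (hyp_fold_le (hb 0) (approx_mem_strip m (shift_mem hb))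
      (approx_mem_strip (m + 1) (shift_mem hb)) (ih (shift_mem hb)) t).trans (le_of_eq ?_)
    ring

lemma dist_approx_le (m : ℕ) {b : ℕ → ℂ} (hb : b ∈ P.Adm) (t : ℝ) :
    dist (P.approx m b t) (P.approx (m + 1) b t) ≤ Real.pi * P.C₀ * P.k ^ m := by
  rw [dist_eq_norm, mul_assoc]
  refine (norm_sub_le_hyp (approx_mem_strip m hb t) (approx_mem_strip (m + 1) hb t)).trans ?_
  have := Real.pi_pos
  gcongr
  refine (Real.sqrt_le_sqrt (hyp_approx_le m hb t)).trans (le_of_eq ?_)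
  exact Real.sqrt_sq (mul_nonneg P.C₀_pos.le (pow_nonneg P.k_pos.le _))

lemma tendsto_approx {b : ℕ → ℂ} (hb : b ∈ P.Adm) (t : ℝ) :
    Tendsto (fun m => P.approx m b t) atTop (𝓝 (P.curve b t)) :=
  (cauchySeq_of_le_geometric P.k (Real.pi * P.C₀) P.k_lt_one
    fun m => dist_approx_le m hb t).tendsto_limUnder

lemma dist_approx_curve_le (m : ℕ) {b : ℕ → ℂ} (hb : b ∈ P.Adm) (t : ℝ) :
    dist (P.approx m b t) (P.curve b t) ≤ P.M * P.k ^ m := by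
  refine (dist_le_of_le_geometric_of_tendsto P.k (Real.pi * P.C₀) P.k_lt_one
    (fun m => dist_approx_le m hb t) (tendsto_approx hb t) m).trans (le_of_eq ?_)
  unfold M; ring

lemma curve_mem_band {b : ℕ → ℂ} (hb : b ∈ P.Adm) (t : ℝ) : P.curve b t ∈ band P.ε :=
  (isClosed_band _).mem_of_tendsto (tendsto_approx hb t)
    (Eventually.of_forall fun m => approx_mem_band m hb t)

lemma curve_mem_strip {b : ℕ → ℂ} (hb : b ∈ P.Adm) (t : ℝ) : P.curve b t ∈ strip :=
  P.band_subset (curve_mem_band hb t)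

lemma norm_curve_sub_le {b : ℕ → ℂ} (hb : b ∈ P.Adm) (t : ℝ) :
    ‖P.curve b t - (t + Real.pi / 2 * I)‖ ≤ P.M := by
  have := dist_approx_curve_le 0 hb t
  rwa [dist_comm, dist_eq_norm, pow_zero, mul_one] at this

lemma abs_curve_re_sub_le {b : ℕ → ℂ} (hb : b ∈ P.Adm) (t : ℝ) :
    |(P.curve b t).re - t| ≤ P.M := by
  refine le_trans ?_ (norm_curve_sub_le hb t)
  refine le_of_eq_of_le ?_ (abs_re_le_norm _)
  simp

lemma curve_eq_fold {b : ℕ → ℂ} (hb : b ∈ P.Adm) (t : ℝ) :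
    P.curve b t = P.fold (b 0) (P.curve (shift b)) t := by
  have hpos : ∀ t : ℝ, 0 < t → Tendsto (fun m => P.approx (m + 1) b t) atTop
      (𝓝 (P.fold (b 0) (P.curve (shift b)) t)) := fun t ht => by
    have h1 := tendsto_approx (shift_mem hb) (model P.n t)
    have h2 : Tendsto (fun m => P.approx m (shift b) (model P.n t)) atTop
        (𝓝[strip] (P.curve (shift b) (model P.n t))) :=
      tendsto_nhdsWithin_iff.2 ⟨h1, Eventually.of_forall fun m =>
        approx_mem_strip m (shift_mem hb) _⟩
    have h3 := (continuousOn_branch (hb 0) _ (curve_mem_strip (shift_mem hb) _)).tendsto.comp h2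
    rw [fold_pos ht]
    refine h3.congr fun m => ?_
    simp only [Function.comp, approx, fold_pos ht]
  have hall : Tendsto (fun m => P.approx (m + 1) b t) atTop
      (𝓝 (P.fold (b 0) (P.curve (shift b)) t)) := by
    refine of_pos (p := fun t => Tendsto (fun m => P.approx (m + 1) b t) atTop
      (𝓝 (P.fold (b 0) (P.curve (shift b)) t))) hpos ?_ (fun t ht => ?_) t
    · simp only [approx, fold_zero]; exact tendsto_const_nhds
    · simp only [approx, fold_neg] at ht ⊢
      exact ht.const_sub _
  exact tendsto_nhds_unique ((tendsto_add_atTop_iff_nat 1).2 (tendsto_approx hb t)) hall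

lemma abs_approx_re_sub_le (m : ℕ) {b : ℕ → ℂ} (hb : b ∈ P.Adm) (t : ℝ) :
    |(P.approx m b t).re - t| ≤ 2 * P.M := by
  have h1 := dist_approx_curve_le m hb t
  have h2 : P.k ^ m ≤ 1 := pow_le_one₀ P.k_pos.le P.k_lt_one.le
  have h3 : |(P.approx m b t).re - (P.curve b t).re| ≤ P.M := by
    rw [← sub_re]
    refine (abs_re_le_norm _).trans ?_
    rw [dist_eq_norm] at h1
    nlinarith [P.M_pos]
  have h4 := abs_curve_re_sub_le hb t
  calc _ ≤ |(P.approx m b t).re - (P.curve b t).re| + |(P.curve b t).re - t| := abs_sub_le _ _ _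
    _ ≤ _ := by linarith

lemma continuous_approx (m : ℕ) {b : ℕ → ℂ} (hb : b ∈ P.Adm) : Continuous (P.approx m b) := by
  induction m generalizing b with
  | zero => unfold approx; fun_prop
  | succ m ih =>
    exact continuous_fold (hb 0) (approx_mem_strip m (shift_mem hb)) (ih (shift_mem hb))
      (abs_approx_re_sub_le m (shift_mem hb))

lemma continuous_curve {b : ℕ → ℂ} (hb : b ∈ P.Adm) : Continuous (P.curve b) := by
  have hu : TendstoUniformly (fun m => P.approx m b) (P.curve b) atTop := by
    rw [Metric.tendstoUniformly_iff]
    intro e he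
    have h1 : Tendsto (fun m : ℕ => P.M * P.k ^ m) atTop (𝓝 0) := by
      simpa using (tendsto_pow_atTop_nhds_zero_of_lt_one P.k_pos.le P.k_lt_one).const_mul P.M
    filter_upwards [h1.eventually_lt_const he] with m hm t
    rw [dist_comm]
    exact (dist_approx_curve_le m hb t).trans_lt hm
  exact hu.continuous (Eventually.of_forall fun m => continuous_approx m hb).frequently

lemma curve_neg {b : ℕ → ℂ} (hb : b ∈ P.Adm) (t : ℝ) :
    P.curve b (-t) = Real.pi * I - P.curve b t := by
  rw [curve_eq_fold hb, curve_eq_fold hb, fold_neg]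

lemma two_cosh_curve {b : ℕ → ℂ} (hb : b ∈ P.Adm) (t : ℝ) :
    2 * cosh (P.curve b t) =
      oddExt (fun t => exp (P.curve (shift b) (model P.n t) / P.n + b 0)) t := by
  rw [curve_eq_fold hb, two_cosh_fold (hb 0) (curve_mem_strip (shift_mem hb))]

lemma curve_re_pos {b : ℕ → ℂ} (hb : b ∈ P.Adm) {t : ℝ} (ht : 0 < t) : 0 < (P.curve b t).re := by
  rw [curve_eq_fold hb, fold_pos ht]
  exact (branch_spec (hb 0) (curve_mem_strip (shift_mem hb) _)).2.1

lemma curve_zero {b : ℕ → ℂ} (hb : b ∈ P.Adm) : P.curve b 0 = Real.pi / 2 * I := by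
  rw [curve_eq_fold hb, fold_zero]

lemma curve_re_neg {b : ℕ → ℂ} (hb : b ∈ P.Adm) {t : ℝ} (ht : t < 0) : (P.curve b t).re < 0 := by
  have h := curve_re_pos hb (neg_pos.2 ht)
  rw [curve_neg hb] at h
  simpa using h

end Params

end StripDynamics
end

noncomputable section

namespace StripDynamics

open Complex Filter Topology

namespace Params

variable {P : Params}

/-! ### Injectivity and the range of the curves -/

lemma norm_two_cosh_sub (b x y : ℂ) {X Y : ℂ} (hX : 2 * cosh X = exp (x / P.n + b))
    (hY : 2 * cosh Y = exp (y / P.n + b)) :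
    2 * ‖cosh X - cosh Y‖ = ‖exp (x / P.n + b) - exp (y / P.n + b)‖ := by
  rw [← hX, ← hY, ← mul_sub, norm_mul, norm_ofNat]

lemma abs_im_affine_sub_le {b x y : ℂ} (hb : b ∈ P.adm) (hx : x ∈ strip) (hy : y ∈ strip) :
    |(((x / P.n + b) - (y / P.n + b)) / 2).im| ≤ Real.pi / 2 :=
  abs_im_half_sub_le (P.band_subset (affine_mem_band hb hx))
    (P.band_subset (affine_mem_band hb hy))

lemma exp_affine_inj {b x y : ℂ} (hb : b ∈ P.adm) (hx : x ∈ strip) (hy : y ∈ strip)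
    (h : exp (x / P.n + b) = exp (y / P.n + b)) : x = y := by
  have h1 := exp_sub_exp (x / P.n + b) (y / P.n + b)
  rw [h, sub_self, eq_comm, mul_eq_zero, or_iff_right two_ne_zero, mul_eq_zero,
    or_iff_right (exp_ne_zero _)] at h1
  have h2 := norm_le_norm_sinh (abs_im_affine_sub_le hb hx hy)
  rw [h1, norm_zero, mul_zero] at h2
  have h3 := norm_le_zero_iff.1 h2
  have hn : (P.n : ℂ) ≠ 0 := by exact_mod_cast P.n_pos.ne'
  field_simp at h3
  linear_combination h3

lemma branch_inj {b x y : ℂ} (hb : b ∈ P.adm) (hx : x ∈ strip) (hy : y ∈ strip)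
    (h : P.branch b x = P.branch b y) : x = y := by
  apply exp_affine_inj hb hx hy
  rw [← (branch_spec hb hx).2.2, ← (branch_spec hb hy).2.2, h]

lemma model_abs_sub_ge (n : ℕ) {s t : ℝ} (hs : 0 < s) (ht : 0 < t) :
    n * |s - t| ≤ |model n s - model n t| := by
  rcases le_total s t with h | h
  · rw [abs_sub_comm s, abs_sub_comm (model n s), abs_of_nonneg (sub_nonneg.2 h)]
    exact (model_sub_ge hs h).trans (le_abs_self _)
  · rw [abs_of_nonneg (sub_nonneg.2 h)]
    exact (model_sub_ge ht h).trans (le_abs_self _)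

/-- Equality of two curve points persists along the shifts, while `model` separates the parameters
by a factor `n` each time. Points on a curve at distance at most `M` from the line can only coincide
if their parameters differ by at most `2 * M`. -/
lemma abs_sub_le_of_curve_eq (m : ℕ) {b : ℕ → ℂ} (hb : b ∈ P.Adm) {s t : ℝ}
    (h : P.curve b s = P.curve b t) : P.n ^ m * |s - t| ≤ 2 * P.M := by
  induction m generalizing b s t with
  | zero =>
    have h1 := abs_le.1 (abs_curve_re_sub_le hb s)
    have h2 := abs_le.1 (abs_curve_re_sub_le hb t)
    rw [h] at h1
    rw [pow_zero, one_mul, abs_le]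
    constructor <;> linarith
  | succ m ih =>
    have hpos : ∀ s t : ℝ, 0 < s → 0 < t → P.curve b s = P.curve b t →
        P.n ^ (m + 1) * |s - t| ≤ 2 * P.M := fun s t hs ht h => by
      rw [curve_eq_fold hb, curve_eq_fold hb, fold_pos hs, fold_pos ht] at h
      have h1 := ih (shift_mem hb) (branch_inj (hb 0) (curve_mem_strip (shift_mem hb) _)
        (curve_mem_strip (shift_mem hb) _) h)
      refine le_trans ?_ h1
      rw [pow_succ, mul_assoc]
      gcongr
      exact model_abs_sub_ge P.n hs ht
    have hre := congrArg re h
    have hz : (P.curve b 0).re = 0 := by rw [curve_zero hb]; simp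
    rcases lt_trichotomy s 0 with hs | hs | hs <;> rcases lt_trichotomy t 0 with ht | ht | ht
    · have := hpos (-s) (-t) (by linarith) (by linarith) (by rw [curve_neg hb, curve_neg hb, h])
      rwa [show -s - -t = -(s - t) by ring, abs_neg] at this
    · have := curve_re_neg hb hs
      rw [ht] at hre
      linarith
    · linarith [curve_re_neg hb hs, curve_re_pos hb ht]
    · rw [hs] at hre
      linarith [curve_re_neg hb ht]
    · rw [hs, ht, sub_zero, abs_zero, mul_zero]
      linarith [P.M_pos]
    · rw [hs] at hre
      linarith [curve_re_pos hb ht]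
    · linarith [curve_re_neg hb ht, curve_re_pos hb hs]
    · rw [ht] at hre
      linarith [curve_re_pos hb hs]
    · exact hpos s t hs ht h

lemma one_lt_n : (1 : ℝ) < P.n := by exact_mod_cast P.two_le

lemma curve_injective {b : ℕ → ℂ} (hb : b ∈ P.Adm) : Function.Injective (P.curve b) := by
  intro s t h
  by_contra hst
  have hpos : 0 < |s - t| := abs_pos.2 (sub_ne_zero.2 hst)
  obtain ⟨m, hm⟩ := pow_unbounded_of_one_lt (2 * P.M / |s - t|) P.one_lt_n
  rw [div_lt_iff₀ hpos] at hm
  exact absurd (abs_sub_le_of_curve_eq m hb h) (not_le.2 hm)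

lemma isClosed_range_curve {b : ℕ → ℂ} (hb : b ∈ P.Adm) : IsClosed (Set.range (P.curve b)) := by
  refine (isProperMap_iff_tendsto_cocompact.2 ⟨continuous_curve hb, ?_⟩).isClosedMap.isClosed_range
  rw [← Metric.cobounded_eq_cocompact, ← Metric.cobounded_eq_cocompact,
    ← tendsto_norm_atTop_iff_cobounded]
  have h : Tendsto (fun t : ℝ => ‖t‖ - P.M) (Bornology.cobounded ℝ) atTop :=
    tendsto_atTop_add_const_right _ _ tendsto_norm_cobounded_atTop
  refine tendsto_atTop_mono (fun t => ?_) h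
  have h1 := abs_curve_re_sub_le hb t
  have h2 := abs_re_le_norm (P.curve b t)
  have h3 : |t| ≤ |(P.curve b t).re| + |(P.curve b t).re - t| := by
    have := abs_sub (P.curve b t).re ((P.curve b t).re - t)
    rwa [sub_sub_cancel] at this
  rw [Real.norm_eq_abs]
  linarith

/-- A family of sets that is backward invariant under the inverse branches lies on the curves. -/
lemma mem_range_curve {S : Type*} (σ : S → S) (B : S → ℕ → ℂ) (hB : ∀ s, B s ∈ P.Adm)
    (hσ : ∀ s, B (σ s) = shift (B s)) (E : S → Set ℂ) (hE : ∀ s, E s ⊆ strip)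
    (hback : ∀ s, ∀ x ∈ E s, x = Real.pi / 2 * I ∨ ∃ y ∈ E (σ s),
      x = P.branch (B s 0) y ∨ x = Real.pi * I - P.branch (B s 0) y)
    {s : S} {x : ℂ} (hx : x ∈ E s) : x ∈ Set.range (P.curve (B s)) := by
  set H : ℝ := Real.cosh P.M / P.ε with hH
  have hH0 : 0 < H := div_pos (Real.cosh_pos _) P.ε_pos
  have hband : ∀ s, ∀ x ∈ E s, x ∈ band P.ε := fun s x hx => by
    rcases hback s x hx with h | ⟨y, hy, h | h⟩
    · rw [h]; exact P.center_mem
    · rw [h]; exact branch_mem_band (hB s 0) (hE _ hy)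
    · rw [h]; exact reflect_mem_band (branch_mem_band (hB s 0) (hE _ hy))
  -- Every point of `E s` starts at bounded hyperbolic distance from the curve, by comparison with
  -- the parameter `t = Re x`. Applying the bound `m` steps ahead and pulling back gains `k ^ m`;
  -- since the range is closed, the point lies on it.
  have key : ∀ m : ℕ, ∀ s, ∀ x ∈ E s, ∃ t, hyp x (P.curve (B s) t) ≤ (H * P.k ^ m) ^ 2 := by
    intro m
    induction m with
    | zero =>
      intro s x hx
      refine ⟨x.re, ?_⟩
      rw [pow_zero, mul_one]
      refine hyp_le P.ε_pos (hband s x hx) (curve_mem_band (hB s) _) ?_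
      rw [abs_sub_comm]
      exact abs_curve_re_sub_le (hB s) _
    | succ m ih =>
      intro s x hx
      have hstep : ∀ y ∈ E (σ s), ∃ t, hyp (P.branch (B s 0) y) (P.curve (B s) t) ≤
          (H * P.k ^ (m + 1)) ^ 2 := fun y hy => by
        obtain ⟨t, ht⟩ := ih (σ s) y hy
        refine ⟨modelInv P.n t, ?_⟩
        rw [curve_eq_fold (hB s), fold_pos (modelInv_pos _ _), model_modelInv P.one_le, ← hσ]
        refine (hyp_branch_le (hB s 0) (hE _ hy) (curve_mem_strip (hB _) _)).trans ?_
        calc P.k ^ 2 * _ ≤ P.k ^ 2 * (H * P.k ^ m) ^ 2 := by gcongr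
          _ = _ := by ring
      rcases hback s x hx with h | ⟨y, hy, h | h⟩
      · exact ⟨0, by rw [h, curve_zero (hB s), hyp_self]; positivity⟩
      · rw [h]; exact hstep y hy
      · obtain ⟨t, ht⟩ := hstep y hy
        exact ⟨-t, by rw [h, curve_neg (hB s), hyp_reflect]; exact ht⟩
  rw [← (isClosed_range_curve (hB s)).closure_eq, Metric.mem_closure_iff]
  intro e he
  have h1 : Tendsto (fun m : ℕ => Real.pi * (H * P.k ^ m)) atTop (𝓝 0) := by
    simpa using ((tendsto_pow_atTop_nhds_zero_of_lt_one P.k_pos.le P.k_lt_one).const_mul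
      H).const_mul Real.pi
  obtain ⟨m, hm⟩ := (h1.eventually_lt_const he).exists
  obtain ⟨t, ht⟩ := key m s x hx
  refine ⟨_, Set.mem_range_self t, lt_of_le_of_lt ?_ hm⟩
  rw [dist_eq_norm]
  refine (norm_sub_le_hyp (hE s hx) (curve_mem_strip (hB s) t)).trans ?_
  have := Real.pi_pos
  gcongr
  refine (Real.sqrt_le_sqrt ht).trans (le_of_eq (Real.sqrt_sq ?_))
  exact mul_nonneg hH0.le (pow_nonneg P.k_pos.le _)

/-! ### Bounded turning -/

variable (P) in
/-- Comparison constant for the moduli of `2 cosh` along the curves. -/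
def B : ℝ := Real.exp (P.M + |P.L|)

variable (P) in
/-- The scale at which small arcs are stopped. -/
def ℓ : ℝ := 4 * P.M + P.n * (2 * (P.M + |P.L|) + 1)

lemma one_le_B : 1 ≤ P.B := by
  unfold B
  rw [Real.one_le_exp_iff]
  linarith [P.M_pos, abs_nonneg P.L]

lemma ℓ_pos : 0 < P.ℓ := by
  have := P.M_pos
  have := P.n_pos
  unfold ℓ
  positivity

/-- The modulus is `exp` of the real part of the next curve, divided by `n`, plus `Re b`. That real
part is within `M` of `model n t`, and `exp (model n t / n) = 2 sinh t`. -/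
lemma norm_two_cosh_curve_le {b : ℕ → ℂ} (hb : b ∈ P.Adm) (t : ℝ) :
    ‖2 * cosh (P.curve b t)‖ ≤ P.B * (2 * Real.sinh |t|) ∧
    2 * Real.sinh |t| ≤ P.B * ‖2 * cosh (P.curve b t)‖ := by
  refine of_pos (p := fun t => ‖2 * cosh (P.curve b t)‖ ≤ P.B * (2 * Real.sinh |t|) ∧
    2 * Real.sinh |t| ≤ P.B * ‖2 * cosh (P.curve b t)‖) (fun t ht => ?_) ?_ (fun t ht => ?_) t
  · rw [two_cosh_curve hb, oddExt_pos _ ht, norm_exp_affine, abs_of_pos ht,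
      ← exp_model_div P.one_le ht]
    unfold B
    rw [← Real.exp_add, ← Real.exp_add, ← Real.exp_add, Real.exp_le_exp, Real.exp_le_exp]
    have h1 := abs_le.1 (abs_curve_re_sub_le (shift_mem hb) (model P.n t))
    have h2 := abs_le.1 ((hb 0).1.trans (le_abs_self _))
    have h3 : ((P.curve (shift b) (model P.n t)).re - model P.n t) / P.n ≤ P.M := by
      rw [div_le_iff₀ P.n_pos]; nlinarith [P.one_lt_n, P.M_pos]
    have h4 : -P.M ≤ ((P.curve (shift b) (model P.n t)).re - model P.n t) / P.n := by
      rw [le_div_iff₀ P.n_pos]; nlinarith [P.one_lt_n, P.M_pos]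
    rw [sub_div] at h3 h4
    constructor <;> linarith
  · rw [curve_zero hb, cosh_mul_I, cos_pi_div_two]; simp
  · have : 2 * cosh (P.curve b (-t)) = -(2 * cosh (P.curve b t)) := by
      rw [two_cosh_curve hb, two_cosh_curve hb, oddExt_neg]
    rwa [this, norm_neg, abs_neg]

lemma im_two_cosh_curve_ge {b : ℕ → ℂ} (hb : b ∈ P.Adm) {t : ℝ} (ht : 0 ≤ t) :
    P.ε * ‖2 * cosh (P.curve b t)‖ ≤ (2 * cosh (P.curve b t)).im := by
  rcases ht.eq_or_lt with h | h
  · rw [← h, curve_zero hb, cosh_mul_I, cos_pi_div_two]; simp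
  · rw [two_cosh_curve hb, oddExt_pos _ h, norm_exp, exp_im, mul_comm]
    gcongr
    exact (affine_mem_band (hb 0) (curve_mem_strip (shift_mem hb) _)).2.2

lemma two_cosh_curve_neg {b : ℕ → ℂ} (hb : b ∈ P.Adm) (t : ℝ) :
    2 * cosh (P.curve b (-t)) = -(2 * cosh (P.curve b t)) := by
  rw [two_cosh_curve hb, two_cosh_curve hb, oddExt_neg]

lemma ε_le_one : P.ε ≤ 1 := Real.sin_le_one _

lemma abs_le_max_of_mem_uIcc {t t₁ t₂ : ℝ} (ht : t ∈ Set.uIcc t₁ t₂) : |t| ≤ max |t₁| |t₂| := by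
  rw [Set.mem_uIcc] at ht
  rcases ht with ⟨h1, h2⟩ | ⟨h1, h2⟩
  · exact abs_le_max_abs_abs h1 h2
  · rw [max_comm]; exact abs_le_max_abs_abs h1 h2

lemma norm_two_cosh_curve_le_add {b : ℕ → ℂ} (hb : b ∈ P.Adm) {t t₁ t₂ : ℝ}
    (ht : t ∈ Set.uIcc t₁ t₂) : ‖2 * cosh (P.curve b t) - 2 * cosh (P.curve b t₁)‖ ≤
      (P.B ^ 2 + 1) * (‖2 * cosh (P.curve b t₁)‖ + ‖2 * cosh (P.curve b t₂)‖) := by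
  have hB := P.one_le_B
  have h1 := (norm_two_cosh_curve_le hb t).1
  have h2 := (norm_two_cosh_curve_le hb t₁).2
  have h3 := (norm_two_cosh_curve_le hb t₂).2
  have h4 : Real.sinh |t| ≤ Real.sinh |t₁| + Real.sinh |t₂| := by
    have p1 := Real.sinh_nonneg_iff.2 (abs_nonneg t₁)
    have p2 := Real.sinh_nonneg_iff.2 (abs_nonneg t₂)
    rcases le_max_iff.1 (abs_le_max_of_mem_uIcc ht) with h | h
    · linarith [Real.sinh_le_sinh.2 h]
    · linarith [Real.sinh_le_sinh.2 h]
  have h5 := norm_sub_le (2 * cosh (P.curve b t)) (2 * cosh (P.curve b t₁))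
  have h6 : ‖2 * cosh (P.curve b t)‖ ≤
      P.B ^ 2 * (‖2 * cosh (P.curve b t₁)‖ + ‖2 * cosh (P.curve b t₂)‖) := by
    refine h1.trans ?_
    rw [pow_two, mul_assoc]
    exact mul_le_mul_of_nonneg_left (by linarith) (by linarith)
  have h7 := norm_nonneg (2 * cosh (P.curve b t₂))
  linarith

/-- Up to sign both image points lie in the sector `Im q ≥ ε |q|`, so imaginary parts of opposite
signs add up. The constant is larger than needed, to agree with `norm_add_le_of_far`. -/
lemma norm_add_le_of_opposite {b : ℕ → ℂ} (hb : b ∈ P.Adm) {t₁ t₂ : ℝ} (h : t₁ * t₂ ≤ 0) :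
    ‖2 * cosh (P.curve b t₁)‖ + ‖2 * cosh (P.curve b t₂)‖ ≤
      4 / P.ε * ‖2 * cosh (P.curve b t₂) - 2 * cosh (P.curve b t₁)‖ := by
  have key : ∀ s t : ℝ, s ≤ 0 → 0 ≤ t →
      ‖2 * cosh (P.curve b s)‖ + ‖2 * cosh (P.curve b t)‖ ≤
      4 / P.ε * ‖2 * cosh (P.curve b t) - 2 * cosh (P.curve b s)‖ := fun s t hs ht => by
    have h1 := im_two_cosh_curve_ge hb ht
    have h2 := im_two_cosh_curve_ge hb (neg_nonneg.2 hs)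
    rw [two_cosh_curve_neg hb, norm_neg, neg_im] at h2
    have h3 := (le_abs_self _).trans
      (abs_im_le_norm (2 * cosh (P.curve b t) - 2 * cosh (P.curve b s)))
    rw [sub_im] at h3
    have h4 := norm_nonneg (2 * cosh (P.curve b t) - 2 * cosh (P.curve b s))
    rw [div_mul_eq_mul_div, le_div_iff₀ P.ε_pos]
    linarith
  rcases mul_nonpos_iff.1 h with ⟨h1, h2⟩ | ⟨h1, h2⟩
  · rw [add_comm, norm_sub_rev]; exact key t₂ t₁ h2 h1
  · exact key t₁ t₂ h1 h2

lemma norm_add_le_of_far {b : ℕ → ℂ} (hb : b ∈ P.Adm) {t₁ t₂ : ℝ} (h₁ : 0 < t₁) (h₂ : 0 < t₂)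
    (h : P.ℓ ≤ |model P.n t₁ - model P.n t₂|) :
    ‖2 * cosh (P.curve b t₁)‖ + ‖2 * cosh (P.curve b t₂)‖ ≤
      4 / P.ε * ‖2 * cosh (P.curve b t₂) - 2 * cosh (P.curve b t₁)‖ := by
  have key : ∀ s t : ℝ, 0 < s → 0 < t → P.ℓ ≤ model P.n t - model P.n s →
      ‖2 * cosh (P.curve b s)‖ + ‖2 * cosh (P.curve b t)‖ ≤
      4 / P.ε * ‖2 * cosh (P.curve b t) - 2 * cosh (P.curve b s)‖ := fun s t hs ht h => by
    have h1 := (norm_two_cosh_curve_le hb s).1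
    have h2 := (norm_two_cosh_curve_le hb t).2
    rw [abs_of_pos hs, ← exp_model_div P.one_le hs] at h1
    rw [abs_of_pos ht, ← exp_model_div P.one_le ht] at h2
    have h3 : 2 * P.B ^ 2 * Real.exp (model P.n s / P.n) ≤ Real.exp (model P.n t / P.n) := by
      -- The summand `1` in `ℓ` supplies a factor `exp 1 ≥ 2`, beyond the `B ^ 2` lost in comparing
      -- moduli with `2 sinh`. Thus one modulus is at least twice the other.
      have e1 : 2 * P.B ^ 2 ≤ Real.exp (2 * (P.M + |P.L|) + 1) := by
        rw [Real.exp_add, B, ← Real.exp_nat_mul, mul_comm]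
        push_cast
        gcongr
        linarith [Real.add_one_le_exp (1 : ℝ)]
      calc _ ≤ Real.exp (2 * (P.M + |P.L|) + 1) * Real.exp (model P.n s / P.n) := by gcongr
        _ ≤ _ := by
          rw [← Real.exp_add, Real.exp_le_exp, ← sub_nonneg]
          have : model P.n t / P.n - (2 * (P.M + |P.L|) + 1 + model P.n s / P.n) =
              (model P.n t - model P.n s - P.n * (2 * (P.M + |P.L|) + 1)) / P.n := by
            have := P.n_pos.ne'
            field_simp
            ring
          rw [this]
          refine div_nonneg ?_ P.n_pos.le
          unfold ℓ at h
          linarith [P.M_pos]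
    have hB := P.one_le_B
    have h4 : 2 * ‖2 * cosh (P.curve b s)‖ ≤ ‖2 * cosh (P.curve b t)‖ := by
      have e2 : P.B * (2 * ‖2 * cosh (P.curve b s)‖) ≤ P.B * ‖2 * cosh (P.curve b t)‖ := by
        refine le_trans ?_ h2
        refine le_trans ?_ h3
        calc P.B * (2 * ‖2 * cosh (P.curve b s)‖)
            ≤ P.B * (2 * (P.B * Real.exp (model P.n s / P.n))) := by gcongr
          _ = _ := by ring
      exact le_of_mul_le_mul_left e2 (by linarith)
    have h5 := norm_sub_norm_le (2 * cosh (P.curve b t)) (2 * cosh (P.curve b s))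
    have h6 : 4 * ‖2 * cosh (P.curve b t) - 2 * cosh (P.curve b s)‖ ≤
        4 / P.ε * ‖2 * cosh (P.curve b t) - 2 * cosh (P.curve b s)‖ := by
      gcongr
      rw [le_div_iff₀ P.ε_pos]
      linarith [P.ε_le_one]
    linarith [norm_nonneg (2 * cosh (P.curve b s))]
  rcases le_total (model P.n t₁) (model P.n t₂) with h3 | h3
  · rw [abs_sub_comm, abs_of_nonneg (sub_nonneg.2 h3)] at h
    exact key t₁ t₂ h₁ h₂ h
  · rw [abs_of_nonneg (sub_nonneg.2 h3)] at h
    rw [add_comm, norm_sub_rev]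
    exact key t₂ t₁ h₂ h₁ h

lemma norm_curve_sub_curve_le {b : ℕ → ℂ} (hb : b ∈ P.Adm) (s t : ℝ) :
    ‖P.curve b s - P.curve b t‖ ≤ |s - t| + 2 * P.M := by
  have h1 := norm_curve_sub_le hb s
  have h2 := norm_curve_sub_le hb t
  have h3 : P.curve b s - P.curve b t = (P.curve b s - (s + Real.pi / 2 * I)) -
      (P.curve b t - (t + Real.pi / 2 * I)) + ((s - t : ℝ) : ℂ) := by push_cast; ring
  rw [h3]
  refine (norm_add_le _ _).trans ?_
  rw [norm_real, Real.norm_eq_abs]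
  linarith [norm_sub_le (P.curve b s - (s + Real.pi / 2 * I)) (P.curve b t - (t + Real.pi / 2 * I))]

lemma le_norm_curve_sub_curve {b : ℕ → ℂ} (hb : b ∈ P.Adm) (s t : ℝ) :
    |s - t| - 2 * P.M ≤ ‖P.curve b s - P.curve b t‖ := by
  have h1 := abs_curve_re_sub_le hb s
  have h2 := abs_curve_re_sub_le hb t
  refine le_trans ?_ (abs_re_le_norm _)
  rw [sub_re]
  have h3 : s - t = ((P.curve b s).re - (P.curve b t).re) - ((P.curve b s).re - s) +
    ((P.curve b t).re - t) := by ring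
  have h4 := abs_add_le (((P.curve b s).re - (P.curve b t).re) - ((P.curve b s).re - s))
    ((P.curve b t).re - t)
  have h5 := abs_sub ((P.curve b s).re - (P.curve b t).re) ((P.curve b s).re - s)
  rw [← h3] at h4
  linarith

variable (P) in
/-- Bound for the diameter of the stopped arcs. -/
def D₀ : ℝ := P.ℓ + 2 * P.M

variable (P) in
/-- Turning constant of the stopped arcs. -/
def K₀ : ℝ := Real.exp ((2 + 1 / P.ε) * P.D₀) * ((P.B ^ 2 + 1) * (4 / P.ε))

variable (P) in
/-- Bound for the hyperbolic diameter of the stopped arcs. -/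
def H : ℝ := Real.cosh P.D₀ / P.ε

variable (P) in
/-- Exponent in the distortion bound. -/
def A : ℝ := (4 + 1 / P.ε) * (Real.pi * P.H)

lemma H_pos : 0 < P.H := div_pos (Real.cosh_pos _) P.ε_pos

lemma K₀_pos : 0 < P.K₀ := by
  have := P.ε_pos
  unfold K₀
  positivity

lemma A_pos : 0 < P.A := by
  have := P.ε_pos
  have := P.H_pos
  have := Real.pi_pos
  unfold A
  positivity

/-! ### The turning estimate at the stopping scale. -/

lemma abs_sub_le_of_mem_uIcc {t t₁ t₂ : ℝ} (ht : t ∈ Set.uIcc t₁ t₂) :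
    |t - t₁| ≤ |t₁ - t₂| ∧ |t - t₂| ≤ |t₁ - t₂| := by
  constructor
  · rw [abs_sub_comm t₁]; exact Set.abs_sub_left_of_mem_uIcc ht
  · rw [abs_sub_comm t, abs_sub_comm t₁]; exact Set.abs_sub_right_of_mem_uIcc ht

/-- After `2 cosh`, every point of the arc has modulus bounded by those of the endpoints, and `h`
bounds these by the distance of the endpoints. The arc has diameter at most `D₀`, so the distortion
of `cosh` transfers the estimate back. -/
lemma turning_of_norm_add_le {b : ℕ → ℂ} (hb : b ∈ P.Adm) {t t₁ t₂ : ℝ}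
    (ht : t ∈ Set.uIcc t₁ t₂) (hℓ : |t₁ - t₂| < P.ℓ)
    (h : ‖2 * cosh (P.curve b t₁)‖ + ‖2 * cosh (P.curve b t₂)‖ ≤
      4 / P.ε * ‖2 * cosh (P.curve b t₂) - 2 * cosh (P.curve b t₁)‖) :
    ‖P.curve b t₁ - P.curve b t‖ ≤ P.K₀ * ‖P.curve b t₁ - P.curve b t₂‖ := by
  have hd : ∀ s s', |s - s'| ≤ |t₁ - t₂| → ‖P.curve b s - P.curve b s'‖ ≤ P.D₀ := fun s s' h => by
    have := norm_curve_sub_curve_le hb s s'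
    unfold D₀
    linarith
  obtain ⟨e1, e2⟩ := abs_sub_le_of_mem_uIcc ht
  have h1 := cosh_distortion P.ε_pos (curve_mem_band hb t₁) (curve_mem_band hb t)
    (hd t₁ t (by rwa [abs_sub_comm])) (hd t₁ t₂ le_rfl) (hd t t₂ e2)
  have h2 := norm_two_cosh_curve_le_add hb ht
  have h3 : ‖2 * cosh (P.curve b t) - 2 * cosh (P.curve b t₁)‖ ≤ (P.B ^ 2 + 1) * (4 / P.ε) *
      ‖2 * cosh (P.curve b t₂) - 2 * cosh (P.curve b t₁)‖ := by
    refine h2.trans ?_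
    rw [mul_assoc]
    gcongr
  rcases eq_or_ne ‖2 * cosh (P.curve b t₂) - 2 * cosh (P.curve b t₁)‖ 0 with h0 | h0
  · rw [h0, mul_zero] at h3
    have h4 := norm_sub_le_norm_cosh_sub P.ε_pos (curve_mem_band hb t) (curve_mem_band hb t₁)
    rw [le_antisymm h3 (norm_nonneg _), mul_zero, norm_sub_rev] at h4
    exact h4.trans (mul_nonneg K₀_pos.le (norm_nonneg _))
  · rw [← mul_sub, norm_mul, norm_ofNat, norm_sub_rev] at h0
    rw [← mul_sub, ← mul_sub, norm_mul, norm_mul, norm_ofNat, norm_sub_rev,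
      norm_sub_rev (cosh (P.curve b t₂))] at h3
    have h5 : 0 < ‖cosh (P.curve b t₁) - cosh (P.curve b t₂)‖ :=
      lt_of_le_of_ne (norm_nonneg _) fun h => h0 (by rw [← h, mul_zero])
    refine le_of_mul_le_mul_right ?_ h5
    refine h1.trans ?_
    unfold K₀
    have h6 : ‖cosh (P.curve b t₁) - cosh (P.curve b t)‖ ≤ (P.B ^ 2 + 1) * (4 / P.ε) *
      ‖cosh (P.curve b t₁) - cosh (P.curve b t₂)‖ := by linarith
    calc _ ≤ Real.exp ((2 + 1 / P.ε) * P.D₀) * (‖P.curve b t₁ - P.curve b t₂‖ *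
          ((P.B ^ 2 + 1) * (4 / P.ε) * ‖cosh (P.curve b t₁) - cosh (P.curve b t₂)‖)) := by
          gcongr
      _ = _ := by ring

/-- A branch is `cosh⁻¹ ∘ exp ∘ affine` up to factors, so the distortion bounds for `cosh` and `exp`
multiply. The exponent is linear in the diameter `D`, so small arcs are distorted by factors close
to `1`. -/
lemma branch_distortion {b x y z : ℂ} (hb : b ∈ P.adm) (hx : x ∈ strip) (hy : y ∈ strip)
    (hz : z ∈ strip) {D : ℝ} (hxy : ‖x - y‖ ≤ D) (hxz : ‖x - z‖ ≤ D) (hyz : ‖y - z‖ ≤ D)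
    (hXY : ‖P.branch b x - P.branch b y‖ ≤ D) (hXZ : ‖P.branch b x - P.branch b z‖ ≤ D)
    (hYZ : ‖P.branch b y - P.branch b z‖ ≤ D) :
    ‖P.branch b x - P.branch b y‖ * ‖x - z‖ ≤
      Real.exp ((4 + 1 / P.ε) * D) * (‖P.branch b x - P.branch b z‖ * ‖x - y‖) := by
  have h1 := cosh_distortion P.ε_pos (branch_mem_band hb hx) (branch_mem_band hb hy) hXY hXZ hYZ
  have hn := P.n_pos
  have hD : 0 ≤ D := (norm_nonneg _).trans hxy
  have hdiv : ∀ u v : ℂ, ‖u / P.n + b - (v / P.n + b)‖ = ‖u - v‖ / P.n := fun u v => by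
    rw [add_sub_add_right_eq_sub, ← sub_div, norm_div]
    simp
  have hle : ∀ u v : ℂ, ‖u - v‖ ≤ D → ‖u / P.n + b - (v / P.n + b)‖ ≤ D := fun u v h => by
    rw [hdiv, div_le_iff₀ hn]
    nlinarith [P.one_lt_n]
  have h2 := exp_distortion (abs_im_affine_sub_le hb hx hz) (hle x y hxy) (hle x z hxz)
    (hle y z hyz)
  rw [hdiv, hdiv, ← norm_two_cosh_sub b x y (branch_spec hb hx).2.2 (branch_spec hb hy).2.2,
    ← norm_two_cosh_sub b x z (branch_spec hb hx).2.2 (branch_spec hb hz).2.2] at h2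
  rcases eq_or_ne x z with hxz' | hxz'
  · rw [hxz', sub_self, norm_zero, mul_zero]; positivity
  have h0 : 0 < ‖cosh (P.branch b x) - cosh (P.branch b z)‖ := by
    rw [norm_pos_iff, sub_ne_zero]
    intro h
    refine hxz' (exp_affine_inj hb hx hz ?_)
    rw [← (branch_spec hb hx).2.2, ← (branch_spec hb hz).2.2, h]
  have h3 : ‖cosh (P.branch b x) - cosh (P.branch b y)‖ * ‖x - z‖ ≤ Real.exp (2 * D) *
      (‖cosh (P.branch b x) - cosh (P.branch b z)‖ * ‖x - y‖) := by
    have := mul_le_mul_of_nonneg_left h2 (by positivity : 0 ≤ (P.n : ℝ) / 2)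
    field_simp at this
    linarith
  refine le_of_mul_le_mul_right ?_ h0
  calc _ = ‖P.branch b x - P.branch b y‖ * ‖cosh (P.branch b x) - cosh (P.branch b z)‖ *
        ‖x - z‖ := by ring
    _ ≤ Real.exp ((2 + 1 / P.ε) * D) * (‖P.branch b x - P.branch b z‖ *
        ‖cosh (P.branch b x) - cosh (P.branch b y)‖) * ‖x - z‖ := by gcongr
    _ = Real.exp ((2 + 1 / P.ε) * D) * ‖P.branch b x - P.branch b z‖ *
        (‖cosh (P.branch b x) - cosh (P.branch b y)‖ * ‖x - z‖) := by ring
    _ ≤ Real.exp ((2 + 1 / P.ε) * D) * ‖P.branch b x - P.branch b z‖ * (Real.exp (2 * D) *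
      (‖cosh (P.branch b x) - cosh (P.branch b z)‖ * ‖x - y‖)) := by gcongr
    _ = (Real.exp ((2 + 1 / P.ε) * D) * Real.exp (2 * D)) * (‖P.branch b x - P.branch b z‖ *
        ‖x - y‖) * ‖cosh (P.branch b x) - cosh (P.branch b z)‖ := by ring
    _ = _ := by
      rw [← Real.exp_add]
      congr 3
      ring

/-- The inductive form of bounded turning: an arc that reaches the stopping scale after `j` steps
has hyperbolic diameter of order `k ^ j` and its turning is controlled by the distortion. -/
def Controlled (P : Params) (b : ℕ → ℂ) (t₁ t t₂ : ℝ) (j : ℕ) : Prop :=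
  hyp (P.curve b t₁) (P.curve b t) ≤ (P.H * P.k ^ j) ^ 2 ∧
  hyp (P.curve b t₁) (P.curve b t₂) ≤ (P.H * P.k ^ j) ^ 2 ∧
  hyp (P.curve b t) (P.curve b t₂) ≤ (P.H * P.k ^ j) ^ 2 ∧
  ‖P.curve b t₁ - P.curve b t‖ ≤ P.K₀ * Real.exp (P.A * ∑ i ∈ Finset.range j, P.k ^ i) *
    ‖P.curve b t₁ - P.curve b t₂‖

lemma Controlled.neg {b : ℕ → ℂ} (hb : b ∈ P.Adm) {t₁ t t₂ : ℝ} {j : ℕ}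
    (h : P.Controlled b t₁ t t₂ j) : P.Controlled b (-t₁) (-t) (-t₂) j := by
  unfold Controlled at *
  simp only [curve_neg hb, hyp_reflect, sub_sub_sub_cancel_left]
  rwa [norm_sub_rev (P.curve b t), norm_sub_rev (P.curve b t₂)]

lemma controlled_zero {b : ℕ → ℂ} (hb : b ∈ P.Adm) {t t₁ t₂ : ℝ}
    (ht : t ∈ Set.uIcc t₁ t₂) (hℓ : |t₁ - t₂| < P.ℓ)
    (h : ‖2 * cosh (P.curve b t₁)‖ + ‖2 * cosh (P.curve b t₂)‖ ≤
      4 / P.ε * ‖2 * cosh (P.curve b t₂) - 2 * cosh (P.curve b t₁)‖) :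
    P.Controlled b t₁ t t₂ 0 := by
  have hd : ∀ s s', |s - s'| ≤ |t₁ - t₂| →
      hyp (P.curve b s) (P.curve b s') ≤ (P.H * P.k ^ 0) ^ 2 := fun s s' h => by
    rw [pow_zero, mul_one]
    refine hyp_le P.ε_pos (curve_mem_band hb _) (curve_mem_band hb _) ?_
    rw [← sub_re]
    refine (abs_re_le_norm _).trans ?_
    have := norm_curve_sub_curve_le hb s s'
    unfold D₀
    linarith
  obtain ⟨e1, e2⟩ := abs_sub_le_of_mem_uIcc ht
  refine ⟨hd t₁ t (by rwa [abs_sub_comm]), hd t₁ t₂ le_rfl, hd t t₂ e2, ?_⟩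
  simpa using turning_of_norm_add_le hb ht hℓ h

lemma Controlled.step {b : ℕ → ℂ} (hb : b ∈ P.Adm) {t₁ t t₂ : ℝ} {j : ℕ}
    (h₁ : 0 < t₁) (h₀ : 0 < t) (h₂ : 0 < t₂) (hne : t₁ ≠ t₂)
    (h : P.Controlled (shift b) (model P.n t₁) (model P.n t) (model P.n t₂) j) :
    P.Controlled b t₁ t t₂ (j + 1) := by
  have hs := curve_mem_strip (shift_mem hb)
  have hk := P.k_pos
  have hH := P.H_pos
  obtain ⟨a1, a2, a3, a4⟩ := h
  have hc : ∀ s, 0 < s → P.curve b s = P.branch (b 0) (P.curve (shift b) (model P.n s)) :=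
    fun s hs => by rw [curve_eq_fold hb, fold_pos hs]
  have hstep : ∀ s s', 0 < s → 0 < s' →
      hyp (P.curve (shift b) (model P.n s)) (P.curve (shift b) (model P.n s')) ≤
        (P.H * P.k ^ j) ^ 2 → hyp (P.curve b s) (P.curve b s') ≤ (P.H * P.k ^ (j + 1)) ^ 2 :=
    fun s s' h1 h2 h => by
      rw [hc s h1, hc s' h2]
      refine (hyp_branch_le (hb 0) (hs _) (hs _)).trans ?_
      calc P.k ^ 2 * _ ≤ P.k ^ 2 * (P.H * P.k ^ j) ^ 2 := by gcongr
        _ = _ := by ring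
  have c1 := hstep t₁ t h₁ h₀ a1
  have c2 := hstep t₁ t₂ h₁ h₂ a2
  have c3 := hstep t t₂ h₀ h₂ a3
  refine ⟨c1, c2, c3, ?_⟩
  set D : ℝ := Real.pi * (P.H * P.k ^ j) with hD
  have hnorm : ∀ {x y : ℂ}, x ∈ strip → y ∈ strip → hyp x y ≤ (P.H * P.k ^ j) ^ 2 →
      ‖x - y‖ ≤ D := fun hx hy h => by
    refine (norm_sub_le_hyp hx hy).trans ?_
    have := Real.pi_pos
    rw [hD]
    gcongr
    exact (Real.sqrt_le_sqrt h).trans (le_of_eq (Real.sqrt_sq (by positivity)))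
  -- Distortion requires the bound `D` both before and after applying the branch; the latter follows
  -- since the hyperbolic diameters decrease.
  have hmono : (P.H * P.k ^ (j + 1)) ^ 2 ≤ (P.H * P.k ^ j) ^ 2 := by
    gcongr ?_ ^ 2
    gcongr P.H * ?_
    exact pow_le_pow_of_le_one hk.le P.k_lt_one.le (Nat.le_succ j)
  have hs' := curve_mem_strip hb
  have d1 := hnorm (hs' t₁) (hs' t) (c1.trans hmono)
  have d2 := hnorm (hs' t₁) (hs' t₂) (c2.trans hmono)
  have d3 := hnorm (hs' t) (hs' t₂) (c3.trans hmono)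
  rw [hc t₁ h₁, hc t h₀] at d1
  rw [hc t₁ h₁, hc t₂ h₂] at d2
  rw [hc t h₀, hc t₂ h₂] at d3
  have h5 := branch_distortion (hb 0) (hs (model P.n t₁)) (hs (model P.n t)) (hs (model P.n t₂))
    (hnorm (hs _) (hs _) a1) (hnorm (hs _) (hs _) a2) (hnorm (hs _) (hs _) a3) d1 d2 d3
  rw [← hc t₁ h₁, ← hc t h₀, ← hc t₂ h₂] at h5
  have h6 : 0 < ‖P.curve (shift b) (model P.n t₁) - P.curve (shift b) (model P.n t₂)‖ := by
    rw [norm_pos_iff, sub_ne_zero]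
    intro h
    have h7 := model_abs_sub_ge P.n h₁ h₂
    rw [curve_injective (shift_mem hb) h, sub_self, abs_zero] at h7
    have h8 : 0 < |t₁ - t₂| := abs_pos.2 (sub_ne_zero.2 hne)
    nlinarith [P.n_pos]
  refine le_of_mul_le_mul_right (h5.trans ?_) h6
  -- One step thus costs `exp (A * k ^ j)`, which is the term that extends the sum from `j` to `j +
  -- 1`.
  have hA : (4 + 1 / P.ε) * D = P.A * P.k ^ j := by rw [hD, A]; ring
  rw [hA, Finset.sum_range_succ, mul_add, Real.exp_add]
  calc _ ≤ Real.exp (P.A * P.k ^ j) * (‖P.curve b t₁ - P.curve b t₂‖ *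
        (P.K₀ * Real.exp (P.A * ∑ i ∈ Finset.range j, P.k ^ i) *
          ‖P.curve (shift b) (model P.n t₁) - P.curve (shift b) (model P.n t₂)‖)) := by gcongr
    _ = _ := by ring

lemma uIcc_pos {t t₁ t₂ : ℝ} (ht : t ∈ Set.uIcc t₁ t₂) (h₁ : 0 < t₁) (h₂ : 0 < t₂) : 0 < t := by
  rw [Set.mem_uIcc] at ht
  rcases ht with ⟨h, -⟩ | ⟨h, -⟩ <;> linarith

/-- The number `q` bounds the time available: `model` expands by `n`, so an arc cannot stay on one
side of `0` and below the scale `ℓ` for `q` steps. The induction stops at the first moment one of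
these fails, and pulls the estimate back. -/
lemma exists_controlled (q : ℕ) {b : ℕ → ℂ} (hb : b ∈ P.Adm) {t t₁ t₂ : ℝ}
    (ht : t ∈ Set.uIcc t₁ t₂) (hℓ : |t₁ - t₂| < P.ℓ) (hq : P.ℓ ≤ P.n ^ q * |t₁ - t₂|) :
    ∃ j, P.Controlled b t₁ t t₂ j := by
  induction q generalizing b t t₁ t₂ with
  | zero => rw [pow_zero, one_mul] at hq; linarith
  | succ q ih =>
    rcases le_or_gt (t₁ * t₂) 0 with h | h
    · exact ⟨0, controlled_zero hb ht hℓ (norm_add_le_of_opposite hb h)⟩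
    have hpos : ∀ {t t₁ t₂ : ℝ}, t ∈ Set.uIcc t₁ t₂ → |t₁ - t₂| < P.ℓ →
        P.ℓ ≤ P.n ^ (q + 1) * |t₁ - t₂| → 0 < t₁ → 0 < t₂ → ∃ j, P.Controlled b t₁ t t₂ j := by
      intro t t₁ t₂ ht hℓ hq h₁ h₂
      have h₀ := uIcc_pos ht h₁ h₂
      rcases le_or_gt P.ℓ |model P.n t₁ - model P.n t₂| with hm | hm
      · exact ⟨0, controlled_zero hb ht hℓ (norm_add_le_of_far hb h₁ h₂ hm)⟩
      have ht' : model P.n t ∈ Set.uIcc (model P.n t₁) (model P.n t₂) := by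
        rw [Set.mem_uIcc] at ht ⊢
        rcases ht with ⟨e1, e2⟩ | ⟨e1, e2⟩
        · exact Or.inl ⟨model_mono h₁ e1, model_mono h₀ e2⟩
        · exact Or.inr ⟨model_mono h₂ e1, model_mono h₀ e2⟩
      obtain ⟨j, hj⟩ := ih (shift_mem hb) ht' hm (hq.trans (by
        rw [pow_succ, mul_assoc]
        gcongr
        exact model_abs_sub_ge P.n h₁ h₂))
      refine ⟨j + 1, hj.step hb h₁ h₀ h₂ fun h => ?_⟩
      rw [h, sub_self, abs_zero, mul_zero] at hq
      exact absurd hq (not_le.2 P.ℓ_pos)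
    rcases mul_pos_iff.1 h with ⟨h1, h2⟩ | ⟨h1, h2⟩
    · exact hpos ht hℓ hq h1 h2
    · have habs : |-t₁ - -t₂| = |t₁ - t₂| := by
        rw [← abs_neg]; congr 1; ring
      obtain ⟨j, hj⟩ := hpos (t := -t) (t₁ := -t₁) (t₂ := -t₂)
        (by rw [Set.mem_uIcc] at ht ⊢
            rcases ht with ⟨e1, e2⟩ | ⟨e1, e2⟩
            · exact Or.inr ⟨neg_le_neg e2, neg_le_neg e1⟩
            · exact Or.inl ⟨neg_le_neg e2, neg_le_neg e1⟩)
        (by rwa [habs]) (by rwa [habs]) (by linarith) (by linarith)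
      refine ⟨j, ?_⟩
      simpa using hj.neg hb

/-- The curves have bounded turning, uniformly. -/
theorem exists_turning_const (P : Params) : ∃ C : ℝ, 0 < C ∧ ∀ b ∈ P.Adm, ∀ t t₁ t₂ : ℝ,
    t ∈ Set.uIcc t₁ t₂ →
      ‖P.curve b t₁ - P.curve b t‖ ≤ C * ‖P.curve b t₁ - P.curve b t₂‖ := by
  set C : ℝ := max 3 (P.K₀ * Real.exp (P.A * (1 - P.k)⁻¹)) with hC
  have hC0 : 0 < C := lt_of_lt_of_le (by norm_num) (le_max_left _ _)
  refine ⟨C, hC0, fun b hb t t₁ t₂ ht => ?_⟩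
  rcases eq_or_ne t₁ t₂ with h | h
  · subst h
    rw [Set.uIcc_self, Set.mem_singleton_iff] at ht
    rw [ht]; simp
  have hpos : 0 < |t₁ - t₂| := abs_pos.2 (sub_ne_zero.2 h)
  -- A long arc is compared with the line directly: `4 * M ≤ |t₁ - t₂|` gives `|t₁ - t₂| + 2 * M ≤ 3
  -- * (|t₁ - t₂| - 2 * M)`.
  rcases le_or_gt P.ℓ |t₁ - t₂| with hℓ | hℓ
  · have h1 := norm_curve_sub_curve_le hb t₁ t
    have h2 := le_norm_curve_sub_curve hb t₁ t₂
    have h3 := (abs_sub_le_of_mem_uIcc ht).1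
    rw [abs_sub_comm] at h3
    have h4 : 4 * P.M ≤ P.ℓ := by
      unfold ℓ
      have := P.M_pos
      have := P.n_pos
      have : 0 ≤ P.n * (2 * (P.M + |P.L|) + 1) := by positivity
      linarith
    calc _ ≤ 3 * ‖P.curve b t₁ - P.curve b t₂‖ := by linarith
      _ ≤ _ := by gcongr; exact le_max_left _ _
  · obtain ⟨q, hq⟩ := pow_unbounded_of_one_lt (P.ℓ / |t₁ - t₂|) P.one_lt_n
    rw [div_lt_iff₀ hpos] at hq
    obtain ⟨j, -, -, -, hj⟩ := exists_controlled q hb ht hℓ hq.le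
    refine hj.trans ?_
    gcongr
    refine le_trans ?_ (le_max_right _ _)
    have hk := K₀_pos (P := P)
    have hA := A_pos (P := P)
    gcongr
    rw [← tsum_geometric_of_lt_one P.k_pos.le P.k_lt_one]
    exact (summable_geometric_of_lt_one P.k_pos.le P.k_lt_one).sum_le_tsum _
      fun i _ => pow_nonneg P.k_pos.le i

end Params

end StripDynamics
end

noncomputable section

namespace McMullen

open Complex Filter Topology StripDynamics

/-! ### Logarithmic coordinates for the McMullen map -/

/-- The logarithm of the critical point `c₀`. -/
def logc (n : ℕ) (lam : ℂ) : ℂ := log lam / (2 * n)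

/-- The translation belonging to a symbol. -/
def translation (n : ℕ) (lam : ℂ) (s : ℕ) : ℂ := s * Real.pi / n * I - (n - 1) * logc n lam

/-- The angle of `c₀ ^ (n - 1)`. -/
def slope (n : ℕ) (lam : ℂ) : ℝ := ((n : ℝ) - 1) * (lam.arg / (2 * n))

lemma logc_im (n : ℕ) (lam : ℂ) : (logc n lam).im = lam.arg / (2 * n) := by
  have : logc n lam = log lam / ((2 * n : ℝ) : ℂ) := by rw [logc]; push_cast; rfl
  rw [this, div_ofReal_im, log_im]

lemma translation_im (n : ℕ) (lam : ℂ) (s : ℕ) :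
    (translation n lam s).im = s * Real.pi / n - slope n lam := by
  have h1 : (s * Real.pi / n * I : ℂ) = ((s * Real.pi / n : ℝ) : ℂ) * I := by push_cast; rfl
  have h2 : ((n : ℂ) - 1) = (((n : ℝ) - 1 : ℝ) : ℂ) := by push_cast; rfl
  rw [translation, h1, h2, sub_im, im_ofReal_mul, slope, ← logc_im]
  simp

lemma translation_re (n : ℕ) (lam : ℂ) (s : ℕ) :
    (translation n lam s).re = -((n - 1) * logc n lam).re := by
  have h1 : (s * Real.pi / n * I : ℂ) = ((s * Real.pi / n : ℝ) : ℂ) * I := by push_cast; rfl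
  rw [translation, h1, sub_re]
  simp

lemma slope_pos {n : ℕ} (hn : 3 ≤ n) {lam : ℂ} (hlam : lam ∈ paramSector n) :
    0 < slope n lam := by
  have hn' : (3 : ℝ) ≤ n := by exact_mod_cast hn
  have := hlam.2.1
  unfold slope
  have : 0 < (n : ℝ) - 1 := by linarith
  positivity

/-- This is the upper bound on `arg lam`: it is equivalent to `arg (c₀ ^ (n - 1)) < π / n`. -/
lemma slope_lt {n : ℕ} (hn : 3 ≤ n) {lam : ℂ} (hlam : lam ∈ paramSector n) :
    slope n lam < Real.pi / n := by
  have hn' : (3 : ℝ) ≤ n := by exact_mod_cast hn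
  have h := hlam.2.2
  have h1 : 0 < (n : ℝ) - 1 := by linarith
  rw [lt_div_iff₀ h1] at h
  unfold slope
  rw [← mul_div_assoc, div_lt_div_iff₀ (by positivity) (by positivity)]
  nlinarith

/-- The parameters of the inverse branches of the McMullen map in logarithmic coordinates. -/
def params {n : ℕ} (hn : 3 ≤ n) {lam : ℂ} (hlam : lam ∈ paramSector n) : Params where
  n := n
  β := min (slope n lam) (Real.pi / n - slope n lam)
  L := |((n - 1) * logc n lam).re|
  two_le := by omega
  pos := lt_min (slope_pos hn hlam) (sub_pos.2 (slope_lt hn hlam))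
  le_half := by
    refine (min_le_left _ _).trans ((slope_lt hn hlam).le.trans ?_)
    have hn' : (3 : ℝ) ≤ n := by exact_mod_cast hn
    have := Real.pi_pos
    gcongr
    linarith

/-- Sequences of positive symbols. -/
def SymbolSeq (n : ℕ) : Type := {σ : ℕ → ℕ // ∀ k, 1 ≤ σ k ∧ σ k + 1 ≤ n}

/-- The shift of symbol sequences. -/
def SymbolSeq.shift {n : ℕ} (σ : SymbolSeq n) : SymbolSeq n :=
  ⟨fun k => σ.1 (k + 1), fun k => σ.2 (k + 1)⟩

/-- The sequence of translations of a symbol sequence. -/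
def transSeq {n : ℕ} (lam : ℂ) (σ : SymbolSeq n) : ℕ → ℂ := fun k => translation n lam (σ.1 k)

lemma cast_n_ne_zero {n : ℕ} (hn : 3 ≤ n) : (n : ℂ) ≠ 0 := by
  have : n ≠ 0 := by omega
  exact_mod_cast this

/-- The image of the strip under the affine map has heights between `s π / n - slope` and `(s + 1) π
/ n - slope`. For `1 ≤ s ≤ n - 1` these keep the distance `π / n - slope` from `0` and `slope` from
`π`, whence the minimum in `β`. -/
lemma translation_mem {n : ℕ} (hn : 3 ≤ n) {lam : ℂ} (hlam : lam ∈ paramSector n) {s : ℕ}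
    (h1 : 1 ≤ s) (h2 : s + 1 ≤ n) : translation n lam s ∈ (params hn hlam).adm := by
  have hp := Real.pi_pos
  have hn0 : (0 : ℝ) < n := by exact_mod_cast (by omega : 0 < n)
  refine ⟨?_, ?_, ?_⟩
  · rw [translation_re, abs_neg]; exact le_rfl
  · rw [translation_im]
    refine (min_le_right _ _).trans ?_
    have : Real.pi / n ≤ s * Real.pi / n := by
      gcongr
      have : (1 : ℝ) ≤ s := by exact_mod_cast h1
      nlinarith
    linarith
  · rw [translation_im]
    have h3 : min (slope n lam) (Real.pi / n - slope n lam) ≤ slope n lam := min_le_left _ _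
    have h4 : s * Real.pi / n + Real.pi / n ≤ Real.pi := by
      rw [← add_div, div_le_iff₀ hn0]
      have : (s : ℝ) + 1 ≤ n := by exact_mod_cast h2
      nlinarith
    simp only [params]
    linarith

lemma transSeq_mem {n : ℕ} (hn : 3 ≤ n) {lam : ℂ} (hlam : lam ∈ paramSector n)
    (σ : SymbolSeq n) : transSeq lam σ ∈ (params hn hlam).Adm :=
  fun k => translation_mem hn hlam (σ.2 k).1 (σ.2 k).2

lemma c₀_eq {n : ℕ} {lam : ℂ} (hlam : lam ∈ paramSector n) : c₀ n lam = exp (logc n lam) := by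
  rw [c₀, cpow_def_of_ne_zero hlam.1, logc, mul_one_div]

lemma exp_logc_pow {n : ℕ} (hn : 3 ≤ n) {lam : ℂ} (hlam : lam ∈ paramSector n) :
    exp (2 * n * logc n lam) = lam := by
  have := cast_n_ne_zero hn
  rw [logc, mul_div_cancel₀ _ (by simpa using this), exp_log hlam.1]

/-- The McMullen map in logarithmic coordinates. -/
lemma map_exp {n : ℕ} (hn : 3 ≤ n) {lam : ℂ} (hlam : lam ∈ paramSector n) (u : ℂ) :
    map n lam ((c₀ n lam * exp u : ℂ) : OnePoint ℂ) =
    ((c₀ n lam ^ n * (2 * cosh (n * u)) : ℂ) : OnePoint ℂ) := by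
  have h0 : c₀ n lam * exp u ≠ 0 := by
    rw [c₀_eq hlam]; exact mul_ne_zero (exp_ne_zero _) (exp_ne_zero _)
  have h1 : map n lam ((c₀ n lam * exp u : ℂ) : OnePoint ℂ) =
      if c₀ n lam * exp u = 0 then ∞
      else (((c₀ n lam * exp u) ^ n + lam / (c₀ n lam * exp u) ^ n : ℂ) : OnePoint ℂ) := rfl
  rw [h1, if_neg h0]
  congr 1
  rw [c₀_eq hlam, ← exp_add, ← exp_nat_mul, ← exp_nat_mul, two_cosh]
  nth_rewrite 2 [← exp_logc_pow hn hlam]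
  rw [← exp_sub, mul_add (exp _), ← exp_add, ← exp_add]
  congr 2
  · ring
  · ring

/-- The point of the plane with logarithmic coordinate `x` in the sector with symbol `s`. -/
def point (n : ℕ) (lam : ℂ) (s : ℕ) (x : ℂ) : ℂ := c₀ n lam * exp ((x + s * Real.pi * I) / n)

/-- Extracting `c₀ ^ n` puts a sector point in the same form as the values `c₀ ^ n * (2 * cosh x)`
of the map, so that the orbit relation becomes the equation defining `Params.branch`. -/
lemma point_eq {n : ℕ} (hn : 3 ≤ n) {lam : ℂ} (hlam : lam ∈ paramSector n) (s : ℕ) (x : ℂ) :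
    point n lam s x = c₀ n lam ^ n * exp (x / n + translation n lam s) := by
  have := cast_n_ne_zero hn
  rw [point, c₀_eq hlam, ← exp_nat_mul, ← exp_add, ← exp_add, translation]
  congr 1
  field_simp
  ring

lemma c₀_ne_zero {n : ℕ} {lam : ℂ} (hlam : lam ∈ paramSector n) : c₀ n lam ≠ 0 := by
  rw [c₀_eq hlam]; exact exp_ne_zero _

lemma point_ne_zero {n : ℕ} {lam : ℂ} (hlam : lam ∈ paramSector n) (s : ℕ) (x : ℂ) :
    point n lam s x ≠ 0 :=
  mul_ne_zero (c₀_ne_zero hlam) (exp_ne_zero _)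

lemma map_point {n : ℕ} (hn : 3 ≤ n) {lam : ℂ} (hlam : lam ∈ paramSector n) (s : ℕ) (x : ℂ) :
    map n lam (point n lam s x) =
    ((c₀ n lam ^ n * (2 * cosh x) : ℂ) : OnePoint ℂ) ∨
    map n lam (point n lam s x) = ((-(c₀ n lam ^ n * (2 * cosh x)) : ℂ) : OnePoint ℂ) := by
  have := cast_n_ne_zero hn
  rw [point, map_exp hn hlam, mul_div_cancel₀ _ this]
  have h : cosh (x + s * Real.pi * I) = cosh x ∨ cosh (x + s * Real.pi * I) = -cosh x := by
    rw [cosh_add, cosh_mul_I, sinh_mul_I, sin_nat_mul_pi, zero_mul, mul_zero, add_zero]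
    have hc : cos (s * Real.pi) = (-1) ^ s := by
      have h := Real.cos_nat_mul_pi s
      rw [← ofReal_natCast, ← ofReal_mul, ← ofReal_cos, h]
      push_cast
      rfl
    rw [hc]
    rcases neg_one_pow_eq_or ℂ s with h | h
    · left; rw [h, mul_one]
    · right; rw [h]; ring
  rcases h with h | h
  · left; rw [h]
  · right; rw [h]; congr 1; ring

/-- The map is even or odd according to the parity of `n`. Both cases respect the double sectors, so
all later arguments work up to sign. -/
lemma map_neg_eq (n : ℕ) (lam z : ℂ) : map n lam ((-z : ℂ) : OnePoint ℂ) = map n lam z ∨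
    ∃ w : ℂ, map n lam z = w ∧ map n lam ((-z : ℂ) : OnePoint ℂ) = ((-w : ℂ) : OnePoint ℂ) := by
  have h1 : ∀ z : ℂ, map n lam z = if z = 0 then ∞ else ((z ^ n + lam / z ^ n : ℂ) : OnePoint ℂ) :=
    fun z => rfl
  rcases eq_or_ne z 0 with h | h
  · left; rw [h, neg_zero]
  · rw [h1, h1, if_neg h, if_neg (neg_ne_zero.2 h)]
    rcases n.even_or_odd with he | ho
    · left; rw [he.neg_pow]
    · right
      refine ⟨_, rfl, ?_⟩
      rw [ho.neg_pow]
      congr 1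
      rw [div_neg]; ring

end McMullen
end

noncomputable section

namespace McMullen

open Complex Filter Topology StripDynamics

/-! ### Description of the cut rays -/

/-- The involution `z ↦ -z` of the Riemann sphere. -/
def negSphere : OnePoint ℂ → OnePoint ℂ := OnePoint.map fun z => -z

lemma negSphere_coe (z : ℂ) : negSphere z = ((-z : ℂ) : OnePoint ℂ) := rfl

lemma map_zero_eq (n : ℕ) (lam : ℂ) : map n lam ((0 : ℂ) : OnePoint ℂ) = ∞ := by
  change (if (0 : ℂ) = 0 then ∞ else _) = _
  rw [if_pos rfl]

lemma map_negSphere (n : ℕ) (lam : ℂ) (z : OnePoint ℂ) :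
    map n lam (negSphere z) = map n lam z ∨ map n lam (negSphere z) = negSphere (map n lam z) := by
  induction z using OnePoint.rec with
  | infty => left; rfl
  | coe z =>
    rcases map_neg_eq n lam z with h | ⟨w, h1, h2⟩
    · left; exact h
    · right; rw [negSphere_coe, h2, h1, negSphere_coe]

/-- The union of a closed sector and its negative in the Riemann sphere. -/
def doubleSector (n : ℕ) (lam : ℂ) (j : ℕ) : Set (OnePoint ℂ) :=
  {z | z = ∞ ∨ ∃ w : ℂ, (w ∈ planeSector n lam j ∨ -w ∈ planeSector n lam j) ∧ z = w}

lemma negSphere_mem_doubleSector {n : ℕ} {lam : ℂ} {j : ℕ} {z : OnePoint ℂ}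
    (hz : z ∈ doubleSector n lam j) : negSphere z ∈ doubleSector n lam j := by
  rcases hz with rfl | ⟨w, hw, rfl⟩
  · left; rfl
  · right; exact ⟨-w, by rw [neg_neg]; exact hw.symm, rfl⟩

/-- The set of points whose orbit follows a symbol sequence up to signs. -/
def symbolSet {n : ℕ} (lam : ℂ) (σ : SymbolSeq n) : Set (OnePoint ℂ) :=
  {z | ∀ k, (map n lam)^[k] z ∈ doubleSector n lam (σ.1 k)}

lemma symbolSet_map {n : ℕ} {lam : ℂ} {σ : SymbolSeq n} {z : OnePoint ℂ}
    (hz : z ∈ symbolSet lam σ) : map n lam z ∈ symbolSet lam σ.shift := fun k => hz (k + 1)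

lemma symbolSet_neg {n : ℕ} {lam : ℂ} {σ : SymbolSeq n} {z : OnePoint ℂ}
    (hz : z ∈ symbolSet lam σ) : negSphere z ∈ symbolSet lam σ := by
  intro k
  have h : (map n lam)^[k] (negSphere z) = (map n lam)^[k] z ∨
      (map n lam)^[k] (negSphere z) = negSphere ((map n lam)^[k] z) := by
    induction k with
    | zero => right; rfl
    | succ k ih =>
      rw [Function.iterate_succ_apply', Function.iterate_succ_apply']
      rcases ih with h | h
      · left; rw [h]
      · rw [h]; exact map_negSphere n lam _
  rcases h with h | h
  · rw [h]; exact hz k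
  · rw [h]; exact negSphere_mem_doubleSector (hz k)

lemma symbolSet_neg_coe {n : ℕ} {lam : ℂ} {σ : SymbolSeq n} {z : ℂ}
    (hz : ((-z : ℂ) : OnePoint ℂ) ∈ symbolSet lam σ) : (z : OnePoint ℂ) ∈ symbolSet lam σ := by
  have := symbolSet_neg hz
  rwa [negSphere_coe, neg_neg] at this

/-- Logarithmic coordinates on the sectors. -/
lemma exists_point_of_mem_planeSector {n : ℕ} (hn : 3 ≤ n) {lam : ℂ} {j : ℕ} {z : ℂ}
    (hz : z ∈ planeSector n lam j) (h0 : z ≠ 0) :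
    ∃ y : ℂ, 0 ≤ y.im ∧ y.im ≤ Real.pi ∧ z = point n lam j y := by
  obtain ⟨r, t, hr, h1, h2, rfl⟩ := hz
  have hn0 : (0 : ℝ) < n := by exact_mod_cast (by omega : 0 < n)
  have hr0 : 0 < r := lt_of_le_of_ne hr fun h => h0 (by rw [← h]; simp)
  rw [div_le_iff₀ hn0, Int.cast_natCast] at h1
  rw [le_div_iff₀ hn0, Int.cast_natCast] at h2
  refine ⟨((n * Real.log r : ℝ) : ℂ) + ((t * n - j * Real.pi : ℝ) : ℂ) * I, ?_, ?_, ?_⟩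
  · simp; linarith
  · simp; linarith
  · have hnc := cast_n_ne_zero hn
    rw [point, mul_comm (r : ℂ), mul_assoc]
    congr 1
    rw [show (r : ℂ) = exp (Real.log r : ℝ) by rw [← ofReal_exp, Real.exp_log hr0], ← exp_add]
    congr 1
    push_cast
    field_simp
    ring

lemma point_mem_planeSector {n : ℕ} (hn : 3 ≤ n) {lam : ℂ} {j : ℕ} {y : ℂ} (hy : y ∈ strip) :
    point n lam j y ∈ planeSector n lam j := by
  have hn0 : (0 : ℝ) < n := by exact_mod_cast (by omega : 0 < n)
  have hnc := cast_n_ne_zero hn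
  refine ⟨Real.exp (y.re / n), (y.im + j * Real.pi) / n, (Real.exp_pos _).le, ?_, ?_, ?_⟩
  · rw [Int.cast_natCast]
    gcongr
    linarith [hy.1]
  · rw [Int.cast_natCast]
    gcongr
    linarith [hy.2]
  · rw [point, mul_comm (_ : ℂ) (c₀ n lam), mul_assoc (c₀ n lam), ofReal_exp, ← exp_add]
    congr 2
    nth_rewrite 1 [← re_add_im y]
    push_cast
    field_simp
    ring

/-- Divided by `c₀ ^ n`, the sectors of the allowed symbols avoid the real axis except at `0`,
because the heights of `translation_mem` lie strictly between `0` and `π`. -/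
lemma im_div_ne_zero {n : ℕ} (hn : 3 ≤ n) {lam : ℂ} (hlam : lam ∈ paramSector n) {j : ℕ}
    (h1 : 1 ≤ j) (h2 : j + 1 ≤ n) {q : ℂ} (hq : q ≠ 0)
    (hz : c₀ n lam ^ n * q ∈ planeSector n lam j ∨ -(c₀ n lam ^ n * q) ∈ planeSector n lam j) :
    q.im ≠ 0 := by
  have hc : c₀ n lam ^ n ≠ 0 := pow_ne_zero _ (c₀_ne_zero hlam)
  have hP := translation_mem hn hlam h1 h2
  have key : ∀ q : ℂ, q ≠ 0 → c₀ n lam ^ n * q ∈ planeSector n lam j → q.im ≠ 0 := by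
    intro q hq hz
    obtain ⟨y, hy0, hy1, hy⟩ := exists_point_of_mem_planeSector hn hz (mul_ne_zero hc hq)
    rw [point_eq hn hlam] at hy
    rw [mul_left_cancel₀ hc hy, exp_im]
    have hn0 : (0 : ℝ) < n := by exact_mod_cast (by omega : 0 < n)
    have h3 : 0 ≤ y.im / n := by positivity
    have h4 : y.im / n ≤ Real.pi / n := by gcongr
    have h5 : (y / n + translation n lam j).im = y.im / n + (translation n lam j).im := by simp
    have hβ := (params hn hlam).pos
    have h6 := hP.2.1
    have h7 : (translation n lam j).im + Real.pi / n ≤ Real.pi - (params hn hlam).β := hP.2.2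
    have : 0 < Real.sin (y / n + translation n lam j).im := by
      rw [h5]
      exact Real.sin_pos_of_pos_of_lt_pi (by linarith) (by linarith)
    positivity
  rcases hz with hz | hz
  · exact key q hq hz
  · rw [← mul_neg] at hz
    have := key (-q) (neg_ne_zero.2 hq) hz
    rwa [neg_im, neg_ne_zero] at this

/-- The logarithmic coordinates of the points that follow a symbol sequence. -/
def logSet {n : ℕ} (lam : ℂ) (σ : SymbolSeq n) : Set ℂ :=
  {x | x ∈ strip ∧ ((c₀ n lam ^ n * (2 * cosh x) : ℂ) : OnePoint ℂ) ∈ symbolSet lam σ}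

lemma exists_logSet {n : ℕ} (hn : 3 ≤ n) {lam : ℂ} (hlam : lam ∈ paramSector n) {σ : SymbolSeq n}
    {z : ℂ} (hz : (z : OnePoint ℂ) ∈ symbolSet lam σ) (h0 : z ≠ 0) :
    ∃ y ∈ logSet lam σ.shift, z = point n lam (σ.1 0) y ∨ z = -point n lam (σ.1 0) y := by
  have key : ∀ z : ℂ, (z : OnePoint ℂ) ∈ symbolSet lam σ → z ≠ 0 →
      z ∈ planeSector n lam (σ.1 0) → ∃ y ∈ logSet lam σ.shift, z = point n lam (σ.1 0) y := by
    intro z hz h0 hs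
    obtain ⟨y, hy0, hy1, rfl⟩ := exists_point_of_mem_planeSector hn hs h0
    have hm : ((c₀ n lam ^ n * (2 * cosh y) : ℂ) : OnePoint ℂ) ∈ symbolSet lam σ.shift := by
      have h1 := symbolSet_map hz
      rcases map_point hn hlam (σ.1 0) y with h | h
      · rwa [h] at h1
      · rw [h] at h1
        exact symbolSet_neg_coe h1
    -- On the boundary rays of a sector `cosh y` is real and nonzero, so the image is a nonzero real
    -- multiple of `c₀ ^ n`, which lies in no allowed sector. Hence `y` is in the open strip.
    have hboundary : Real.sin y.im ≠ 0 := by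
      intro hsin
      have h2 := hm 0
      have hq : 2 * cosh y ≠ 0 := by
        intro h
        have h3 : ‖cosh y‖ ^ 2 = 0 := by
          rw [(mul_eq_zero.1 h).resolve_left two_ne_zero]; simp
        rw [norm_cosh_sq] at h3
        have := Real.sin_sq_add_cos_sq y.im
        nlinarith [sq_nonneg (Real.sinh y.re)]
      rcases h2 with h2 | ⟨w, hw, h2⟩
      · exact OnePoint.coe_ne_infty _ h2
      · rw [Function.iterate_zero, id, OnePoint.coe_eq_coe] at h2
        rw [← h2] at hw
        refine im_div_ne_zero hn hlam (σ.shift.2 0).1 (σ.shift.2 0).2 hq hw ?_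
        rw [show (2 * cosh y).im = 2 * (cosh y).im by simp, StripDynamics.cosh_im, hsin]
        ring
    refine ⟨y, ⟨⟨lt_of_le_of_ne hy0 fun h => hboundary (by rw [← h]; simp),
      lt_of_le_of_ne hy1 fun h => hboundary (by rw [h]; simp)⟩, hm⟩, rfl⟩
  rcases hz 0 with h | ⟨w, hw, h⟩
  · exact absurd h (OnePoint.coe_ne_infty _)
  · rw [Function.iterate_zero, id, OnePoint.coe_eq_coe] at h
    subst h
    rcases hw with hw | hw
    · obtain ⟨y, hy, h⟩ := key z hz h0 hw
      exact ⟨y, hy, Or.inl h⟩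
    · obtain ⟨y, hy, h⟩ := key (-z) (symbolSet_neg hz) (neg_ne_zero.2 h0) hw
      exact ⟨y, hy, Or.inr (by rw [← h, neg_neg])⟩

lemma eq_center_of_cosh_eq_zero {x : ℂ} (hx : x ∈ strip) (h : cosh x = 0) :
    x = Real.pi / 2 * I := by
  have h1 := norm_cosh_sq x
  rw [h, norm_zero] at h1
  have h2 : Real.sinh x.re = 0 := by
    nlinarith [sq_nonneg (Real.sinh x.re), sq_nonneg (Real.cos x.im)]
  have h3 : Real.cos x.im = 0 := by
    nlinarith [sq_nonneg (Real.sinh x.re), sq_nonneg (Real.cos x.im)]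
  have hp := Real.pi_pos
  have h4 : x.im = Real.pi / 2 := by
    refine Real.injOn_cos ⟨hx.1.le, hx.2.le⟩ ⟨by linarith, by linarith⟩ ?_
    rw [h3, Real.cos_pi_div_two]
  rw [← re_add_im x, Real.sinh_eq_zero.1 h2, h4]
  push_cast
  ring

lemma logSet_subset_range {n : ℕ} (hn : 3 ≤ n) {lam : ℂ} (hlam : lam ∈ paramSector n)
    (σ : SymbolSeq n) :
    logSet lam σ ⊆ Set.range ((params hn hlam).curve (transSeq lam σ)) := by
  intro x hx
  refine Params.mem_range_curve SymbolSeq.shift (transSeq lam) (transSeq_mem hn hlam)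
    (fun σ => rfl) (logSet lam) (fun σ x hx => hx.1) ?_ hx
  intro σ x hx
  have hc : c₀ n lam ^ n ≠ 0 := pow_ne_zero _ (c₀_ne_zero hlam)
  -- If `cosh x = 0`, the point has value `0`, which has no logarithmic coordinate; it is the centre
  -- through which all curves pass.
  rcases eq_or_ne (cosh x) 0 with h | h
  · exact Or.inl (eq_center_of_cosh_eq_zero hx.1 h)
  right
  obtain ⟨y, hy, h1⟩ := exists_logSet hn hlam hx.2 (mul_ne_zero hc (mul_ne_zero two_ne_zero h))
  refine ⟨y, hy, ?_⟩
  rw [point_eq hn hlam, ← mul_neg, mul_right_inj' hc, mul_right_inj' hc] at h1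
  have hb := transSeq_mem hn hlam σ 0
  -- The right side lies in the upper half plane, and this selects `Re x > 0`. The other sign of the
  -- orbit equation is reduced to this one by `x ↦ π i - x`.
  have key : ∀ x : ℂ, x ∈ strip → 2 * cosh x = exp (y / n + translation n lam (σ.1 0)) →
      x = (params hn hlam).branch (transSeq lam σ 0) y := by
    intro x hx h
    refine (Params.branch_unique hb hy.1 hx ?_ h).symm
    have h2 : 0 < (2 * cosh x).im := by
      rw [h, exp_im]
      have := sin_im_pos ((params hn hlam).band_subset (Params.affine_mem_band hb hy.1))
      exact mul_pos (Real.exp_pos _) this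
    rw [show (2 * cosh x).im = 2 * (cosh x).im by simp, StripDynamics.cosh_im] at h2
    have h3 : 0 < Real.sinh x.re * Real.sin x.im := by linarith
    exact Real.sinh_pos_iff.1 ((mul_pos_iff_of_pos_right (sin_im_pos hx)).1 h3)
  rcases h1 with h1 | h1
  · left; exact key x hx.1 h1
  · right
    rw [← key _ (reflect_mem_strip hx.1) ?_]
    · ring
    · rw [cosh_sub, cosh_mul_I, sinh_mul_I, cos_pi, sin_pi]
      linear_combination -h1

/-- The finite part of a cut ray, parametrized by the real line. -/
def planeCurve {n : ℕ} (hn : 3 ≤ n) {lam : ℂ} (hlam : lam ∈ paramSector n) (σ : SymbolSeq n) :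
    ℝ → ℂ :=
  oddExt fun r => point n lam (σ.1 0)
    ((params hn hlam).curve (transSeq lam σ.shift) (Real.log r))

/-- The functional equation of the curves says that the map sends the curve of `σ` into the curve of
the shifted sequence. Signs are absorbed by oddness, and the parameter `0` goes to `∞`. -/
lemma map_planeCurve {n : ℕ} (hn : 3 ≤ n) {lam : ℂ} (hlam : lam ∈ paramSector n)
    (σ : SymbolSeq n) (r : ℝ) : map n lam (planeCurve hn hlam σ r) = ∞ ∨
      ∃ s, map n lam (planeCurve hn hlam σ r) = (planeCurve hn hlam σ.shift s : OnePoint ℂ) := by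
  have hcosh : ∀ u, ∃ s, c₀ n lam ^ n * (2 * cosh ((params hn hlam).curve
      (transSeq lam σ.shift) u)) = planeCurve hn hlam σ.shift s := by
    have hpos : ∀ u : ℝ, 0 < u → c₀ n lam ^ n * oddExt (fun t => exp
        ((params hn hlam).curve (Params.shift (transSeq lam σ.shift)) (model (params hn hlam).n t) /
          (params hn hlam).n + transSeq lam σ.shift 0)) u =
        planeCurve hn hlam σ.shift (Real.exp (model n u)) := fun u hu => by
      rw [planeCurve, oddExt_pos _ hu, oddExt_pos _ (Real.exp_pos _), Real.log_exp,
        point_eq hn hlam]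
      rfl
    intro u
    rw [Params.two_cosh_curve (transSeq_mem hn hlam σ.shift)]
    rcases lt_trichotomy u 0 with h | h | h
    · refine ⟨-Real.exp (model n (-u)), ?_⟩
      rw [planeCurve, oddExt_neg, ← planeCurve, ← hpos _ (neg_pos.2 h), oddExt_neg]
      ring
    · exact ⟨0, by rw [h, planeCurve, oddExt_zero, oddExt_zero, mul_zero]⟩
    · exact ⟨_, hpos u h⟩
  have hneg : ∀ z : ℂ, (∃ s, z = planeCurve hn hlam σ.shift s) →
      ∃ s, -z = planeCurve hn hlam σ.shift s := by
    rintro z ⟨s, rfl⟩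
    exact ⟨-s, by rw [planeCurve, oddExt_neg]⟩
  have hpt : ∀ u, ∃ s, map n lam (point n lam (σ.1 0) ((params hn hlam).curve
      (transSeq lam σ.shift) u)) = (planeCurve hn hlam σ.shift s : OnePoint ℂ) := fun u => by
    rcases map_point hn hlam (σ.1 0) ((params hn hlam).curve (transSeq lam σ.shift) u) with h | h
    · obtain ⟨s, hs⟩ := hcosh u
      exact ⟨s, by rw [h, hs]⟩
    · obtain ⟨s, hs⟩ := hneg _ (hcosh u)
      exact ⟨s, by rw [h, hs]⟩
  rcases lt_trichotomy r 0 with h | h | h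
  · right
    obtain ⟨s, hs⟩ := hpt (Real.log (-r))
    have hr : planeCurve hn hlam σ r = -point n lam (σ.1 0) ((params hn hlam).curve
        (transSeq lam σ.shift) (Real.log (-r))) := by
      rw [← neg_neg (planeCurve hn hlam σ r), planeCurve, ← oddExt_neg,
        oddExt_pos _ (neg_pos.2 h)]
    rw [hr]
    rcases map_neg_eq n lam (point n lam (σ.1 0) ((params hn hlam).curve
        (transSeq lam σ.shift) (Real.log (-r)))) with h1 | ⟨w, h1, h2⟩
    · exact ⟨s, by rw [h1, hs]⟩
    · rw [h1, OnePoint.coe_eq_coe] at hs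
      obtain ⟨s', hs'⟩ := hneg w ⟨s, hs⟩
      exact ⟨s', by rw [h2, hs']⟩
  · left; rw [h, planeCurve, oddExt_zero]; exact map_zero_eq n lam
  · right
    rw [planeCurve, oddExt_pos _ h]
    exact hpt _

lemma planeCurve_mem_doubleSector {n : ℕ} (hn : 3 ≤ n) {lam : ℂ} (hlam : lam ∈ paramSector n)
    (σ : SymbolSeq n) (r : ℝ) :
    (planeCurve hn hlam σ r : OnePoint ℂ) ∈ doubleSector n lam (σ.1 0) := by
  have hs := fun u => Params.curve_mem_strip (transSeq_mem hn hlam σ.shift) u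
  refine Params.of_pos (p := fun r =>
    (planeCurve hn hlam σ r : OnePoint ℂ) ∈ doubleSector n lam (σ.1 0)) (fun r hr => ?_) ?_
    (fun r hr => ?_) r
  · right
    refine ⟨_, Or.inl ?_, rfl⟩
    rw [planeCurve, oddExt_pos _ hr]
    exact point_mem_planeSector hn (hs _)
  · right
    refine ⟨_, Or.inl ?_, rfl⟩
    rw [planeCurve, oddExt_zero]
    have hn0 : (0 : ℝ) < n := by exact_mod_cast (by omega : 0 < n)
    have := Real.pi_pos
    refine ⟨0, _, le_rfl, le_rfl, ?_, by simp⟩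
    gcongr
    linarith
  · rw [planeCurve, oddExt_neg, ← planeCurve]
    exact negSphere_mem_doubleSector hr

/-- Backward invariance puts the logarithmic coordinates of nonzero finite points on the curves;
conversely the curves are forward invariant and each starts in its own double sector. -/
lemma symbolSet_eq {n : ℕ} (hn : 3 ≤ n) {lam : ℂ} (hlam : lam ∈ paramSector n)
    (σ : SymbolSeq n) :
    symbolSet lam σ = Set.range (OnePoint.map (planeCurve hn hlam σ)) := by
  ext z
  constructor
  · intro hz
    induction z using OnePoint.rec with
    | infty => exact ⟨∞, rfl⟩
    | coe z =>
      rcases eq_or_ne z 0 with h | h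
      · refine ⟨((0 : ℝ) : OnePoint ℝ), ?_⟩
        rw [OnePoint.map_some, planeCurve, oddExt_zero, h]
      · obtain ⟨y, hy, h1⟩ := exists_logSet hn hlam hz h
        obtain ⟨u, rfl⟩ := logSet_subset_range hn hlam σ.shift hy
        have hpos : planeCurve hn hlam σ (Real.exp u) = point n lam (σ.1 0)
            ((params hn hlam).curve (transSeq lam σ.shift) u) := by
          rw [planeCurve, oddExt_pos _ (Real.exp_pos _), Real.log_exp]
        rcases h1 with h1 | h1
        · exact ⟨(Real.exp u : ℝ), by rw [OnePoint.map_some, hpos, h1]⟩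
        · refine ⟨((-Real.exp u : ℝ) : OnePoint ℝ), ?_⟩
          rw [OnePoint.map_some, h1, ← hpos, planeCurve, oddExt_neg]
  · rintro ⟨r, rfl⟩ k
    induction k generalizing σ r with
    | zero =>
      induction r using OnePoint.rec with
      | infty => exact Or.inl rfl
      | coe r => exact planeCurve_mem_doubleSector hn hlam σ r
    | succ k ih =>
      rw [Function.iterate_succ_apply]
      induction r using OnePoint.rec with
      | infty => exact ih σ.shift ∞
      | coe r =>
        rw [OnePoint.map_some]
        rcases map_planeCurve hn hlam σ r with h | ⟨s, h⟩
        · rw [h]; exact ih σ.shift ∞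
        · rw [h]; exact ih σ.shift (s : OnePoint ℝ)

/-! ### Itineraries of angles and symbol sequences. -/

lemma sector_union_eq (n : ℕ) (lam : ℂ) {s : ℤ} (hs : s ∈ symbols n) :
    sector n lam s ∪ sector n lam (-s) = doubleSector n lam s.natAbs := by
  have h1 : 1 ≤ |s| := hs.1
  have key : ∀ s : ℤ, 0 < s → sector n lam s ∪ sector n lam (-s) = doubleSector n lam s.natAbs := by
    intro s hs
    have habs : ((s.natAbs : ℕ) : ℤ) = s := by omega
    ext z
    unfold sector doubleSector
    rw [if_pos hs.le, if_neg (by omega), neg_neg, habs]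
    constructor
    · rintro ((h | ⟨w, hw, rfl⟩) | (h | ⟨w, hw, rfl⟩))
      · exact Or.inl h
      · exact Or.inr ⟨w, Or.inl hw, rfl⟩
      · exact Or.inl h
      · exact Or.inr ⟨w, Or.inr hw, rfl⟩
    · rintro (h | ⟨w, hw | hw, rfl⟩)
      · exact Or.inl (Or.inl h)
      · exact Or.inl (Or.inr ⟨w, hw, rfl⟩)
      · exact Or.inr (Or.inr ⟨w, hw, rfl⟩)
  rcases lt_trichotomy s 0 with h | h | h
  · have := key (-s) (by omega)
    rwa [neg_neg, Set.union_comm, Int.natAbs_neg] at this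
  · rw [h] at h1; simp at h1
  · exact key s h

/-- Scaled by `2 n`, the arcs are unit intervals `(j, j + 1]` with integer `j`: `j = s` for positive
symbols and `j = n - s` for negative ones. These integers are distinct, since `|s| ≤ n - 1`. -/
lemma arc_symbol_unique {n : ℕ} (hn : 3 ≤ n) {s s' : ℤ} (hs : s ∈ symbols n)
    (hs' : s' ∈ symbols n) {x : ℝ} (hx : x ∈ arc n s) (hx' : x ∈ arc n s') : s = s' := by
  have hn0 : (0 : ℝ) < 2 * n := by
    have : (0 : ℝ) < n := by exact_mod_cast (by omega : 0 < n)
    linarith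
  have hpos : ∀ {s : ℤ}, 0 ≤ s → x ∈ arc n s → (s : ℝ) < x * (2 * n) ∧ x * (2 * n) ≤ s + 1 := by
    intro s h hx
    rw [arc, if_pos h] at hx
    exact ⟨(div_lt_iff₀ hn0).1 hx.1, (le_div_iff₀ hn0).1 hx.2⟩
  have hneg : ∀ {s : ℤ}, s < 0 → x ∈ arc n s →
      (-s : ℝ) + n < x * (2 * n) ∧ x * (2 * n) ≤ -s + 1 + n := by
    intro s h hx
    rw [arc, if_neg (not_le.2 h)] at hx
    have h1 := hx.1
    have h2 := hx.2
    rw [← lt_sub_iff_add_lt, div_lt_iff₀ hn0] at h1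
    rw [← sub_le_iff_le_add, le_div_iff₀ hn0] at h2
    constructor <;> nlinarith
  have b1 := hs.2
  have b2 := hs'.2
  have a1 := abs_le.1 b1
  have a2 := abs_le.1 b2
  rcases lt_or_ge s 0 with h | h <;> rcases lt_or_ge s' 0 with h' | h'
  · obtain ⟨p1, p2⟩ := hneg h hx
    obtain ⟨q1, q2⟩ := hneg h' hx'
    have e1 : -s < -s' + 1 := by
      exact_mod_cast (by push_cast; linarith : ((-s : ℤ) : ℝ) < ((-s' + 1 : ℤ) : ℝ))
    have e2 : -s' < -s + 1 := by
      exact_mod_cast (by push_cast; linarith : ((-s' : ℤ) : ℝ) < ((-s + 1 : ℤ) : ℝ))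
    omega
  · obtain ⟨p1, p2⟩ := hneg h hx
    obtain ⟨q1, q2⟩ := hpos h' hx'
    have e1 : (-s : ℤ) + n < s' + 1 := by
      exact_mod_cast (by push_cast; linarith : ((-s + n : ℤ) : ℝ) < ((s' + 1 : ℤ) : ℝ))
    omega
  · obtain ⟨p1, p2⟩ := hpos h hx
    obtain ⟨q1, q2⟩ := hneg h' hx'
    have e1 : (-s' : ℤ) + n < s + 1 := by
      exact_mod_cast (by push_cast; linarith : ((-s' + n : ℤ) : ℝ) < ((s + 1 : ℤ) : ℝ))
    omega
  · obtain ⟨p1, p2⟩ := hpos h hx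
    obtain ⟨q1, q2⟩ := hpos h' hx'
    have e1 : s < s' + 1 := by
      exact_mod_cast (by push_cast; linarith : (s : ℝ) < ((s' + 1 : ℤ) : ℝ))
    have e2 : s' < s + 1 := by
      exact_mod_cast (by push_cast; linarith : (s' : ℝ) < ((s + 1 : ℤ) : ℝ))
    omega

/-- A double sector depends only on the absolute value of the symbol, so the sequence of absolute
values determines the cut ray. -/
lemma exists_cutRay_eq {n : ℕ} (hn : 3 ≤ n) {lam : ℂ} (hlam : lam ∈ paramSector n) {θ : ℝ}
    (hθ : θ ∈ Theta n) :
    ∃ σ : SymbolSeq n, cutRay n lam θ = Set.range (OnePoint.map (planeCurve hn hlam σ)) := by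
  choose s hs hmem using hθ.2
  have hσ : ∀ k, 1 ≤ (s k).natAbs ∧ (s k).natAbs + 1 ≤ n := fun k => by
    have h1 : 1 ≤ |s k| := (hs k).1
    have h2 : |s k| ≤ (n : ℤ) - 1 := (hs k).2
    rw [Int.abs_eq_natAbs] at h1 h2
    omega
  refine ⟨⟨fun k => (s k).natAbs, hσ⟩, Eq.trans ?_ (symbolSet_eq hn hlam _)⟩
  ext z
  constructor
  · intro hz k
    have := hz k (s k) (hs k) (hmem k)
    rwa [sector_union_eq n lam (hs k)] at this
  · intro hz k s' hs' hmem'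
    rw [arc_symbol_unique hn hs' (hs k) hmem' (hmem k), sector_union_eq n lam (hs k)]
    exact hz k

end McMullen
end

noncomputable section

namespace McMullen

open Complex Filter Topology

/-! ### Quasicircles from parametrized curves -/

/-- The weight `√(1 + |z|²)` of the chordal metric. -/
def weight (z : ℂ) : ℝ := √(1 + ‖z‖ ^ 2)

lemma weight_pos (z : ℂ) : 0 < weight z := Real.sqrt_pos.2 (by positivity)

lemma one_le_weight (z : ℂ) : 1 ≤ weight z := by
  rw [weight, Real.one_le_sqrt]
  linarith [sq_nonneg ‖z‖]

lemma norm_le_weight (z : ℂ) : ‖z‖ ≤ weight z := Real.le_sqrt_of_sq_le (by linarith)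

lemma weight_le (z : ℂ) : weight z ≤ 1 + ‖z‖ := by
  rw [weight, Real.sqrt_le_left (by positivity)]
  nlinarith [norm_nonneg z]

lemma weight_le_mul {B : ℝ} (hB : 1 ≤ B) {z w : ℂ} (h : ‖z‖ ≤ B * ‖w‖) :
    weight z ≤ B * weight w := by
  have hw := weight_pos w
  have hw2 : weight w ^ 2 = 1 + ‖w‖ ^ 2 := Real.sq_sqrt (by positivity)
  rw [weight, Real.sqrt_le_left (by positivity), mul_pow, hw2]
  have : ‖z‖ ^ 2 ≤ (B * ‖w‖) ^ 2 := by gcongr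
  nlinarith

lemma chordal_coe (z w : ℂ) : chordal z w = 2 * ‖z - w‖ / (weight z * weight w) := rfl

lemma chordal_infty (z : ℂ) : chordal z ∞ = 2 / weight z := rfl

lemma chordal_infty_left (z : ℂ) : chordal ∞ z = 2 / weight z := rfl

lemma chordal_comm (a b : OnePoint ℂ) : chordal a b = chordal b a := by
  induction a using OnePoint.rec with
  | infty => induction b using OnePoint.rec <;> rfl
  | coe z =>
    induction b using OnePoint.rec with
    | infty => rfl
    | coe w => rw [chordal_coe, chordal_coe, norm_sub_rev, mul_comm (weight z)]

lemma chordal_nonneg (a b : OnePoint ℂ) : 0 ≤ chordal a b := by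
  induction a using OnePoint.rec with
  | infty =>
    induction b using OnePoint.rec with
    | infty => exact le_rfl
    | coe w => rw [chordal_infty_left]; exact div_nonneg zero_le_two (weight_pos w).le
  | coe z =>
    induction b using OnePoint.rec with
    | infty => rw [chordal_infty]; exact div_nonneg zero_le_two (weight_pos z).le
    | coe w =>
      rw [chordal_coe]
      exact div_nonneg (by positivity) (mul_pos (weight_pos z) (weight_pos w)).le

lemma chordal_le_add (a b : OnePoint ℂ) : chordal a b ≤ chordal a ∞ + chordal b ∞ := by
  have h0 : ∀ c : OnePoint ℂ, 0 ≤ chordal c ∞ := fun c => chordal_nonneg c ∞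
  induction a using OnePoint.rec with
  | infty => rw [chordal_comm]; exact le_add_of_nonneg_left (h0 ∞)
  | coe z =>
    induction b using OnePoint.rec with
    | infty => exact le_add_of_nonneg_right (h0 ∞)
    | coe w =>
      have hz := weight_pos z
      have hw := weight_pos w
      rw [chordal_coe, chordal_infty, chordal_infty, div_add_div _ _ hz.ne' hw.ne']
      gcongr
      linarith [norm_sub_le z w, norm_le_weight z, norm_le_weight w]

lemma chordal_infty_le_two (a : OnePoint ℂ) : chordal a ∞ ≤ 2 := by
  induction a using OnePoint.rec with
  | infty => exact zero_le_two
  | coe z =>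
    rw [chordal_infty, div_le_iff₀ (weight_pos z)]
    linarith [one_le_weight z]

lemma chordal_le_four (a b : OnePoint ℂ) : chordal a b ≤ 4 := by
  linarith [chordal_le_add a b, chordal_infty_le_two a, chordal_infty_le_two b]

/-- One of the components of the complement of two points on a curve is controlled. -/
def HasTurning (K : ℝ) (Γ : Set (OnePoint ℂ)) (z₁ z₂ : OnePoint ℂ) : Prop :=
  ∃ w ∈ Γ \ {z₁, z₂}, ∀ a ∈ connectedComponentIn (Γ \ {z₁, z₂}) w,
    ∀ b ∈ connectedComponentIn (Γ \ {z₁, z₂}) w, chordal a b ≤ K * chordal z₁ z₂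

lemma HasTurning.mono {K K' : ℝ} (hK : K ≤ K') {Γ : Set (OnePoint ℂ)} {z₁ z₂ : OnePoint ℂ}
    (h : HasTurning K Γ z₁ z₂) : HasTurning K' Γ z₁ z₂ := by
  obtain ⟨w, hw, h⟩ := h
  exact ⟨w, hw, fun a ha b hb => (h a ha b hb).trans
    (mul_le_mul_of_nonneg_right hK (chordal_nonneg _ _))⟩

lemma HasTurning.symm {K : ℝ} {Γ : Set (OnePoint ℂ)} {z₁ z₂ : OnePoint ℂ}
    (h : HasTurning K Γ z₁ z₂) : HasTurning K Γ z₂ z₁ := by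
  unfold HasTurning at *
  rwa [Set.pair_comm, chordal_comm]

section Curve

variable {Φ : OnePoint ℝ → OnePoint ℂ}

/-- A connected subset of the curve minus two points that meets `U` stays in `U`, because `U` and
`V` disconnect the parameters. It thus suffices to bound the diameter of one parameter arc. -/
lemma hasTurning_of_separation (hc : Continuous Φ) (hi : Function.Injective Φ)
    {U V : Set (OnePoint ℝ)} (hU : IsOpen U) (hV : IsOpen V) (hUV : Disjoint U V)
    {p q : OnePoint ℝ} (hp : p ∉ U) (hq : q ∉ U) (hcov : ∀ x, x ≠ p → x ≠ q → x ∈ U ∪ V)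
    (hne : U.Nonempty) {K : ℝ}
    (hK : ∀ a ∈ U, ∀ b ∈ U, chordal (Φ a) (Φ b) ≤ K * chordal (Φ p) (Φ q)) :
    HasTurning K (Set.range Φ) (Φ p) (Φ q) := by
  obtain ⟨w, hw⟩ := hne
  have hwp : w ≠ p := fun h => hp (h ▸ hw)
  have hwq : w ≠ q := fun h => hq (h ▸ hw)
  have hmem : Φ w ∈ Set.range Φ \ {Φ p, Φ q} := by
    refine ⟨Set.mem_range_self w, ?_⟩
    rintro (h | h)
    · exact hwp (hi h)
    · exact hwq (hi h)
  refine ⟨Φ w, hmem, ?_⟩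
  set A := connectedComponentIn (Set.range Φ \ {Φ p, Φ q}) (Φ w) with hA
  have hAsub : A ⊆ Set.range Φ \ {Φ p, Φ q} := connectedComponentIn_subset _ _
  have himg : Φ '' (Φ ⁻¹' A) = A :=
    Set.image_preimage_eq_of_subset fun x hx => (hAsub hx).1
  have hpre : IsPreconnected (Φ ⁻¹' A) := by
    have hemb : Topology.IsClosedEmbedding Φ := hc.isClosedEmbedding hi
    rw [← hemb.isInducing.isPreconnected_image, himg]
    exact isPreconnected_connectedComponentIn
  have hsub : Φ ⁻¹' A ⊆ U := by
    refine hpre.subset_left_of_subset_union hU hV hUV (fun x hx => ?_)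
      ⟨w, mem_connectedComponentIn hmem, hw⟩
    refine hcov x ?_ ?_
    · rintro rfl; exact (hAsub hx).2 (Or.inl rfl)
    · rintro rfl; exact (hAsub hx).2 (Or.inr rfl)
  intro a ha b hb
  obtain ⟨x, rfl⟩ := (hAsub ha).1
  obtain ⟨y, rfl⟩ := (hAsub hb).1
  exact hK x (hsub ha) y (hsub hb)

lemma isOpen_coe_image {s : Set ℝ} (hs : IsOpen s) :
    IsOpen ((fun r : ℝ => (r : OnePoint ℝ)) '' s) :=
  OnePoint.isOpenEmbedding_coe.isOpenMap s hs

lemma isOpen_compl_coe_Icc (r s : ℝ) :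
    IsOpen ((fun r : ℝ => (r : OnePoint ℝ)) '' Set.Icc r s)ᶜ :=
  (isCompact_Icc.image OnePoint.continuous_coe).isClosed.isOpen_compl

lemma mem_Ioo_or_compl {r s : ℝ} (x : OnePoint ℝ) (hr : x ≠ r) (hs : x ≠ s) :
    x ∈ (fun r : ℝ => (r : OnePoint ℝ)) '' Set.Ioo r s ∨
      x ∈ ((fun r : ℝ => (r : OnePoint ℝ)) '' Set.Icc r s)ᶜ := by
  by_cases h : x ∈ (fun r : ℝ => (r : OnePoint ℝ)) '' Set.Icc r s
  · left
    obtain ⟨t, ht, rfl⟩ := h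
    refine ⟨t, ⟨lt_of_le_of_ne ht.1 ?_, lt_of_le_of_ne ht.2 ?_⟩, rfl⟩
    · rintro rfl; exact hr rfl
    · rintro rfl; exact hs rfl
  · exact Or.inr h

lemma disjoint_Ioo_compl (r s : ℝ) : Disjoint ((fun r : ℝ => (r : OnePoint ℝ)) '' Set.Ioo r s)
    ((fun r : ℝ => (r : OnePoint ℝ)) '' Set.Icc r s)ᶜ :=
  Set.disjoint_compl_right_iff_subset.2 (Set.image_mono Set.Ioo_subset_Icc_self)

lemma hasTurning_inner (hc : Continuous Φ) (hi : Function.Injective Φ) {r s : ℝ} (hrs : r < s)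
    {K : ℝ} (hK : ∀ a ∈ Set.Ioo r s, ∀ b ∈ Set.Ioo r s,
      chordal (Φ a) (Φ b) ≤ K * chordal (Φ r) (Φ s)) :
    HasTurning K (Set.range Φ) (Φ r) (Φ s) := by
  refine hasTurning_of_separation hc hi (isOpen_coe_image isOpen_Ioo) (isOpen_compl_coe_Icc r s)
    (disjoint_Ioo_compl r s) ?_ ?_ (fun x => mem_Ioo_or_compl x)
    ((Set.nonempty_Ioo.2 hrs).image _) ?_
  · rintro ⟨t, ht, h⟩; exact ht.1.ne' (OnePoint.coe_injective h)
  · rintro ⟨t, ht, h⟩; exact ht.2.ne (OnePoint.coe_injective h)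
  · rintro _ ⟨a, ha, rfl⟩ _ ⟨b, hb, rfl⟩
    exact hK a ha b hb

lemma hasTurning_outer (hc : Continuous Φ) (hi : Function.Injective Φ) {r s : ℝ} (hrs : r < s)
    {K : ℝ} (hK : ∀ a ∈ ((fun r : ℝ => (r : OnePoint ℝ)) '' Set.Icc r s)ᶜ,
      ∀ b ∈ ((fun r : ℝ => (r : OnePoint ℝ)) '' Set.Icc r s)ᶜ,
      chordal (Φ a) (Φ b) ≤ K * chordal (Φ r) (Φ s)) :
    HasTurning K (Set.range Φ) (Φ r) (Φ s) := by
  refine hasTurning_of_separation hc hi (isOpen_compl_coe_Icc r s) (isOpen_coe_image isOpen_Ioo)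
    (disjoint_Ioo_compl r s).symm ?_ ?_ (fun x hr hs => (mem_Ioo_or_compl x hr hs).symm)
    ⟨∞, ?_⟩ hK
  · exact fun h => h ⟨r, ⟨le_rfl, hrs.le⟩, rfl⟩
  · exact fun h => h ⟨s, ⟨hrs.le, le_rfl⟩, rfl⟩
  · rintro ⟨t, -, h⟩; exact OnePoint.coe_ne_infty t h

lemma hasTurning_infty (hc : Continuous Φ) (hi : Function.Injective Φ) {r : ℝ} {K : ℝ}
    (hK : ∀ a b : ℝ, |r| ≤ |a| → |r| ≤ |b| → chordal (Φ a) (Φ b) ≤ K * chordal (Φ r) (Φ ∞)) :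
    HasTurning K (Set.range Φ) (Φ r) (Φ ∞) := by
  have hcov : ∀ x : OnePoint ℝ, x ≠ r → x ≠ ∞ →
      x ∈ (fun r : ℝ => (r : OnePoint ℝ)) '' Set.Ioi r ∪
        (fun r : ℝ => (r : OnePoint ℝ)) '' Set.Iio r := by
    intro x hr hx
    induction x using OnePoint.rec with
    | infty => exact absurd rfl hx
    | coe x =>
      rcases lt_trichotomy x r with h | h | h
      · exact Or.inr ⟨x, h, rfl⟩
      · exact absurd (congrArg _ h) hr
      · exact Or.inl ⟨x, h, rfl⟩
  have hdisj : Disjoint ((fun r : ℝ => (r : OnePoint ℝ)) '' Set.Ioi r)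
      ((fun r : ℝ => (r : OnePoint ℝ)) '' Set.Iio r) := by
    rw [Set.disjoint_image_iff OnePoint.coe_injective, Set.disjoint_left]
    exact fun x h1 h2 => lt_asymm (Set.mem_Ioi.1 h1) (Set.mem_Iio.1 h2)
  have hinf : ∀ s : Set ℝ, (∞ : OnePoint ℝ) ∉ (fun r : ℝ => (r : OnePoint ℝ)) '' s := by
    rintro s ⟨t, -, h⟩; exact OnePoint.coe_ne_infty t h
  rcases le_total 0 r with h | h
  · refine hasTurning_of_separation hc hi (isOpen_coe_image isOpen_Ioi)
      (isOpen_coe_image isOpen_Iio) hdisj ?_ (hinf _) hcov ((Set.nonempty_Ioi).image _) ?_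
    · rintro ⟨t, ht, h⟩; exact (Set.mem_Ioi.1 ht).ne' (OnePoint.coe_injective h)
    · rintro _ ⟨a, ha, rfl⟩ _ ⟨b, hb, rfl⟩
      exact hK a b (abs_le_abs_of_nonneg h (Set.mem_Ioi.1 ha).le)
        (abs_le_abs_of_nonneg h (Set.mem_Ioi.1 hb).le)
  · refine hasTurning_of_separation hc hi (isOpen_coe_image isOpen_Iio)
      (isOpen_coe_image isOpen_Ioi) hdisj.symm ?_ (hinf _)
      (fun x h1 h2 => (hcov x h1 h2).symm) ((Set.nonempty_Iio).image _) ?_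
    · rintro ⟨t, ht, h⟩; exact (Set.mem_Iio.1 ht).ne (OnePoint.coe_injective h)
    · rintro _ ⟨a, ha, rfl⟩ _ ⟨b, hb, rfl⟩
      exact hK a b (abs_le_abs_of_nonpos h (Set.mem_Iio.1 ha).le)
        (abs_le_abs_of_nonpos h (Set.mem_Iio.1 hb).le)

end Curve

/-! ### The chordal estimates -/

lemma chordal_infty_le {B : ℝ} (hB : 1 ≤ B) {z a : ℂ} (h : ‖z‖ ≤ B * ‖a‖) :
    chordal a ∞ ≤ 2 * B / weight z := by
  rw [chordal_infty, div_le_div_iff₀ (weight_pos a) (weight_pos z)]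
  linarith [weight_le_mul hB h]

/-- Bounded turning in the plane implies bounded turning in the sphere for arcs on which the
modulus is at least the modulus of the first endpoint. -/
lemma chordal_le_of_turning {B C : ℝ} (hB : 1 ≤ B) (hC : 0 ≤ C) {z₁ z₂ a b : ℂ}
    (ha : ‖z₁‖ ≤ B * ‖a‖) (hb : ‖z₁‖ ≤ B * ‖b‖) (hab : ‖a - b‖ ≤ C * ‖z₁ - z₂‖) :
    chordal a b ≤ (8 * C * B ^ 2 + 8 * B) * chordal z₁ z₂ := by
  have h1 := weight_pos z₁
  have h2 := weight_pos z₂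
  have wa := weight_pos a
  have wb := weight_pos b
  have ha' := weight_le_mul hB ha
  have hb' := weight_le_mul hB hb
  have hch := chordal_nonneg z₁ z₂
  have hB0 : 0 < B := by linarith
  -- If the weights are comparable, the planar bound rescales. Otherwise `z₂` is much farther out
  -- than `z₁`, so `chordal z₁ z₂` is at least of order `1 / weight z₁`, and this bounds the
  -- distances of `a` and `b` to `∞`.
  rcases le_or_gt (weight z₂) (4 * weight z₁) with h | h
  · have h3 : chordal a b ≤ (8 * C * B ^ 2) * chordal z₁ z₂ := by
      rw [chordal_coe, chordal_coe, ← mul_div_assoc,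
        div_le_div_iff₀ (by positivity) (by positivity)]
      have h4 : weight z₁ * weight z₂ ≤ 4 * B ^ 2 * (weight a * weight b) := by
        calc weight z₁ * weight z₂ ≤ weight z₁ * (4 * weight z₁) := by gcongr
          _ = 4 * (weight z₁ * weight z₁) := by ring
          _ ≤ 4 * ((B * weight a) * (B * weight b)) := by gcongr
          _ = _ := by ring
      calc 2 * ‖a - b‖ * (weight z₁ * weight z₂)
          ≤ 2 * (C * ‖z₁ - z₂‖) * (4 * B ^ 2 * (weight a * weight b)) := by gcongr
        _ = 8 * C * B ^ 2 * (1 * ‖z₁ - z₂‖) * (weight a * weight b) := by ring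
        _ ≤ 8 * C * B ^ 2 * (2 * ‖z₁ - z₂‖) * (weight a * weight b) := by
          gcongr
          norm_num
    nlinarith
  · have h3 : chordal a b ≤ (8 * B) * chordal z₁ z₂ := by
      have h4 := chordal_le_add a b
      have h5 := chordal_infty_le hB ha
      have h6 := chordal_infty_le hB hb
      have h7 : 1 / weight z₁ ≤ 2 * chordal z₁ z₂ := by
        rw [chordal_coe, ← mul_div_assoc, div_le_div_iff₀ h1 (by positivity)]
        have h8 : weight z₂ ≤ 4 * ‖z₁ - z₂‖ := by
          have e1 := weight_le z₂
          have e2 := norm_le_weight z₁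
          have e3 := one_le_weight z₁
          have e4 := norm_sub_norm_le z₂ z₁
          rw [norm_sub_rev] at e4
          linarith
        calc 1 * (weight z₁ * weight z₂) ≤ 1 * (weight z₁ * (4 * ‖z₁ - z₂‖)) := by gcongr
          _ = _ := by ring
      have h9 : 2 * B / weight z₁ ≤ 4 * B * chordal z₁ z₂ := by
        calc 2 * B / weight z₁ = 2 * B * (1 / weight z₁) := by ring
          _ ≤ 2 * B * (2 * chordal z₁ z₂) := by gcongr
          _ = _ := by ring
      linarith
    have : 0 ≤ 8 * C * B ^ 2 * chordal z₁ z₂ := by positivity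
    linarith

/-- Points in opposite sectors, one of them close to the origin. -/
lemma chordal_le_of_opposite {C C' : ℝ} (hC : 0 ≤ C) (hC' : 0 < C') {z₁ z₂ a b : ℂ}
    (h : ‖z₁‖ + ‖z₂‖ ≤ C' * ‖z₁ - z₂‖) (hab : ‖a - b‖ ≤ C * ‖z₁ - z₂‖) (h₁ : ‖z₁‖ ≤ 1) :
    chordal a b ≤ (4 * C + 8 * C') * chordal z₁ z₂ := by
  have hch := chordal_nonneg z₁ z₂
  have w1 := weight_pos z₁
  have w2 := weight_pos z₂
  have e1 := weight_le z₁
  have e2 := weight_le z₂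
  rcases le_total ‖z₂‖ 1 with h2 | h2
  · have h3 : chordal a b ≤ 4 * C * chordal z₁ z₂ := by
      have wa := one_le_weight a
      have wb := one_le_weight b
      have h4 : weight z₁ * weight z₂ ≤ 4 * (weight a * weight b) := by nlinarith
      have := weight_pos a
      have := weight_pos b
      rw [chordal_coe, chordal_coe, ← mul_div_assoc,
        div_le_div_iff₀ (by positivity) (by positivity)]
      calc 2 * ‖a - b‖ * (weight z₁ * weight z₂)
          ≤ 2 * (C * ‖z₁ - z₂‖) * (4 * (weight a * weight b)) := by gcongr
        _ = _ := by ring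
    nlinarith
  · have h3 : chordal a b ≤ 8 * C' * chordal z₁ z₂ := by
      refine (chordal_le_four a b).trans ?_
      rw [chordal_coe, ← mul_div_assoc, le_div_iff₀ (by positivity)]
      have h5 : weight z₁ * weight z₂ ≤ 2 * (2 * ‖z₂‖) := by
        refine mul_le_mul (by linarith) (by linarith) w2.le (by norm_num)
      have h6 := norm_nonneg z₁
      linarith
    nlinarith

/-- Points in opposite sectors far away from the origin. -/
lemma chordal_le_of_opposite_far {B C' : ℝ} (hB : 1 ≤ B) {z₁ z₂ : ℂ}
    (h : ‖z₁‖ + ‖z₂‖ ≤ C' * ‖z₁ - z₂‖) (h₁ : 1 ≤ ‖z₁‖) (h₂ : 1 ≤ ‖z₂‖)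
    {a b : OnePoint ℂ} (ha : chordal a ∞ ≤ 2 * B / weight z₁ ∨ chordal a ∞ ≤ 2 * B / weight z₂)
    (hb : chordal b ∞ ≤ 2 * B / weight z₁ ∨ chordal b ∞ ≤ 2 * B / weight z₂) :
    chordal a b ≤ 4 * B * C' * chordal z₁ z₂ := by
  have w1 := weight_pos z₁
  have w2 := weight_pos z₂
  have e1 := weight_le z₁
  have e2 := weight_le z₂
  have key : ∀ c : OnePoint ℂ, (chordal c ∞ ≤ 2 * B / weight z₁ ∨ chordal c ∞ ≤ 2 * B / weight z₂) →
      chordal c ∞ ≤ 2 * B * C' * chordal z₁ z₂ := by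
    intro c hc
    have h3 : chordal c ∞ ≤ 2 * B * (weight z₁ + weight z₂) / (weight z₁ * weight z₂) := by
      have e3 : 2 * B * (weight z₁ + weight z₂) / (weight z₁ * weight z₂) =
          2 * B / weight z₁ + 2 * B / weight z₂ := by
        field_simp
        ring
      have e4 : 0 ≤ 2 * B / weight z₁ := by positivity
      have e5 : 0 ≤ 2 * B / weight z₂ := by positivity
      rw [e3]
      rcases hc with hc | hc <;> linarith
    refine h3.trans ?_
    rw [chordal_coe, ← mul_div_assoc]
    refine div_le_div_of_nonneg_right ?_ (mul_pos w1 w2).le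
    have : weight z₁ + weight z₂ ≤ 2 * (C' * ‖z₁ - z₂‖) := by linarith
    calc 2 * B * (weight z₁ + weight z₂) ≤ 2 * B * (2 * (C' * ‖z₁ - z₂‖)) := by gcongr
      _ = _ := by ring
  have := chordal_le_add a b
  linarith [key a ha, key b hb]

/-! ### From planar turning to quasicircles in the sphere. -/

lemma nonempty_onePoint_homeomorph_circle : Nonempty (OnePoint ℝ ≃ₜ Circle) := by
  have e₁ := onePointEquivSphereOfFinrankEq (ι := Fin 2) (V := ℝ) (by simp)
  have e₂ : {x : EuclideanSpace ℝ (Fin 2) // x ∈ Metric.sphere (0 : EuclideanSpace ℝ (Fin 2)) 1} ≃ₜ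
      {z : ℂ // z ∈ Submonoid.unitSphere ℂ} :=
    (Complex.orthonormalBasisOneI.repr.symm.toHomeomorph).subtype fun x => by
      change x ∈ Metric.sphere _ 1 ↔
        Complex.orthonormalBasisOneI.repr.symm x ∈ Metric.sphere (0 : ℂ) 1
      rw [mem_sphere_zero_iff_norm, mem_sphere_zero_iff_norm, LinearIsometryEquiv.norm_map]
  exact ⟨e₁.trans e₂⟩

/-- A curve through `0` and `∞` with bounded turning in the plane, whose modulus is comparable to a
monotone function on both sides and whose two sides lie in opposite sectors, is a quasicircle. -/
theorem isQuasicircle_range {F : ℝ → ℂ} (hc : Continuous F) (hi : Function.Injective F)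
    (hlim : Tendsto (fun r => ‖F r‖) (cocompact ℝ) atTop) {B C C' : ℝ} (hB : 1 ≤ B) (hC : 0 ≤ C)
    (hC' : 0 < C') (hmono : ∀ r s, |r| ≤ |s| → ‖F r‖ ≤ B * ‖F s‖)
    (hopp : ∀ r s, r * s ≤ 0 → ‖F r‖ + ‖F s‖ ≤ C' * ‖F r - F s‖)
    (hturn : ∀ r s t, t ∈ Set.uIcc r s → ‖F r - F t‖ ≤ C * ‖F r - F s‖) :
    IsQuasicircle (Set.range (OnePoint.map F)) := by
  set Φ : OnePoint ℝ → OnePoint ℂ := OnePoint.map F with hΦ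
  have hΦc : Continuous Φ := by
    refine OnePoint.continuous_map hc ?_
    rw [coclosedCompact_eq_cocompact, coclosedCompact_eq_cocompact,
      ← Metric.cobounded_eq_cocompact (α := ℂ), ← tendsto_norm_atTop_iff_cobounded]
    exact hlim
  have hΦi : Function.Injective Φ := by
    intro a b h
    induction a using OnePoint.rec with
    | infty =>
      induction b using OnePoint.rec with
      | infty => rfl
      | coe s => exact absurd h.symm (OnePoint.coe_ne_infty _)
    | coe r =>
      induction b using OnePoint.rec with
      | infty => exact absurd h (OnePoint.coe_ne_infty _)
      | coe s => exact congrArg _ (hi (OnePoint.coe_injective h))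
  have hΦs : ∀ r : ℝ, Φ r = F r := fun r => rfl
  -- Turning is measured from the endpoint `r`, so a diameter bound costs a factor `2`.
  have hab : ∀ {r s a b : ℝ}, a ∈ Set.Ioo r s → b ∈ Set.Ioo r s →
      ‖F a - F b‖ ≤ 2 * C * ‖F r - F s‖ := by
    intro r s a b ha hb
    have h1 := hturn r s a (Set.Icc_subset_uIcc (Set.Ioo_subset_Icc_self ha))
    have h2 := hturn r s b (Set.Icc_subset_uIcc (Set.Ioo_subset_Icc_self hb))
    have h3 := norm_sub_le (F r - F b) (F r - F a)
    rw [sub_sub_sub_cancel_left] at h3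
    linarith
  set K : ℝ := (8 * (2 * C) * B ^ 2 + 8 * B) + (4 * (2 * C) + 8 * C') + 4 * B * C' + 2 * B with hK
  have p1 : 0 ≤ 8 * (2 * C) * B ^ 2 + 8 * B := by positivity
  have p2 : 0 ≤ 4 * (2 * C) + 8 * C' := by positivity
  have p3 : 0 ≤ 4 * B * C' := by positivity
  have p4 : 0 ≤ 2 * B := by positivity
  have hfin : ∀ r s : ℝ, r < s → HasTurning K (Set.range Φ) (Φ r) (Φ s) := by
    intro r s hrs
    -- Parameters of opposite signs are separated either by an arc through `0` or by one through
    -- `∞`. The inner arc is used when an endpoint lies in the unit disc, the outer arc when neither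
    -- is inside.
    rcases le_or_gt (r * s) 0 with h | h
    · have h0 := hopp r s h
      have hsign : r ≤ 0 ∧ 0 ≤ s := by
        rcases mul_nonpos_iff.1 h with ⟨h1, h2⟩ | ⟨h1, h2⟩
        · exact ⟨by linarith, by linarith⟩
        · exact ⟨h1, h2⟩
      rcases le_total ‖F r‖ 1 with h1 | h1
      · refine (hasTurning_inner hΦc hΦi hrs fun a ha b hb => ?_).mono
          (by linarith : 4 * (2 * C) + 8 * C' ≤ K)
        exact chordal_le_of_opposite (by positivity) hC' h0 (hab ha hb) h1
      rcases le_total ‖F s‖ 1 with h2 | h2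
      · refine (hasTurning_inner hΦc hΦi hrs fun a ha b hb => ?_).mono
          (by linarith : 4 * (2 * C) + 8 * C' ≤ K)
        rw [chordal_comm (Φ r)]
        rw [add_comm, norm_sub_rev] at h0
        have h3 := hab ha hb
        rw [norm_sub_rev (F r)] at h3
        exact chordal_le_of_opposite (by positivity) hC' h0 h3 h2
      · refine (hasTurning_outer hΦc hΦi hrs ?_).mono (by linarith : 4 * B * C' ≤ K)
        have key : ∀ a ∈ ((fun r : ℝ => (r : OnePoint ℝ)) '' Set.Icc r s)ᶜ,
            chordal (Φ a) ∞ ≤ 2 * B / weight (F r) ∨ chordal (Φ a) ∞ ≤ 2 * B / weight (F s) := by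
          intro a ha
          induction a using OnePoint.rec with
          | infty =>
            left
            exact div_nonneg p4 (weight_pos _).le
          | coe a =>
            rcases lt_or_ge a r with h3 | h3
            · left
              exact chordal_infty_le hB (hmono r a (abs_le_abs_of_nonpos hsign.1 h3.le))
            · right
              refine chordal_infty_le hB (hmono s a (abs_le_abs_of_nonneg hsign.2 ?_))
              by_contra! h4
              exact ha ⟨a, ⟨h3, h4.le⟩, rfl⟩
        intro a ha b hb
        exact chordal_le_of_opposite_far hB h0 h1 h2 (key a ha) (key b hb)
    · refine (hasTurning_inner hΦc hΦi hrs fun a ha b hb => ?_).mono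
        (by linarith : 8 * (2 * C) * B ^ 2 + 8 * B ≤ K)
      -- The reference endpoint for the chordal estimate is the one nearer to `0` in parameter, as
      -- the modulus must not drop much along the arc.
      rcases mul_pos_iff.1 h with ⟨h1, h2⟩ | ⟨h1, h2⟩
      · exact chordal_le_of_turning hB (by positivity)
          (hmono r a (abs_le_abs_of_nonneg h1.le ha.1.le))
          (hmono r b (abs_le_abs_of_nonneg h1.le hb.1.le)) (hab ha hb)
      · rw [chordal_comm (Φ r)]
        have h3 := hab ha hb
        rw [norm_sub_rev (F r)] at h3
        exact chordal_le_of_turning hB (by positivity)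
          (hmono s a (abs_le_abs_of_nonpos h2.le ha.2.le))
          (hmono s b (abs_le_abs_of_nonpos h2.le hb.2.le)) h3
  have hinf : ∀ r : ℝ, HasTurning K (Set.range Φ) (Φ r) (Φ ∞) := by
    intro r
    refine (hasTurning_infty hΦc hΦi fun a b ha hb => ?_).mono (by linarith : 2 * B ≤ K)
    have h1 := chordal_le_add (Φ a) (Φ b)
    have h2 := chordal_infty_le hB (hmono r a ha)
    have h3 := chordal_infty_le hB (hmono r b hb)
    have h4 : chordal (Φ r) (Φ ∞) = 2 / weight (F r) := rfl
    rw [h4, show 2 * B * (2 / weight (F r)) = 2 * B / weight (F r) + 2 * B / weight (F r) by ring]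
    rw [hΦs] at h1 ⊢
    rw [hΦs] at h1 ⊢
    linarith
  refine ⟨?_, K, ?_⟩
  · obtain ⟨e⟩ := nonempty_onePoint_homeomorph_circle
    exact ⟨Φ ∘ e.symm, hΦc.comp e.symm.continuous, hΦi.comp e.symm.injective, by
      rw [Set.range_comp, e.symm.surjective.range_eq, Set.image_univ]⟩
  · rintro _ ⟨p, rfl⟩ _ ⟨q, rfl⟩ hne
    change HasTurning K (Set.range Φ) (Φ p) (Φ q)
    induction p using OnePoint.rec with
    | infty =>
      induction q using OnePoint.rec with
      | infty => exact absurd rfl hne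
      | coe s => exact (hinf s).symm
    | coe r =>
      induction q using OnePoint.rec with
      | infty => exact hinf r
      | coe s =>
        rcases lt_trichotomy r s with h | h | h
        · exact hfin r s h
        · exact absurd (by rw [h]) hne
        · exact (hfin s r h).symm

end McMullen
end

noncomputable section

namespace McMullen

open Complex Filter Topology StripDynamics

/-! ### The cut rays are quasicircles -/

section

variable {n : ℕ} (hn : 3 ≤ n) {lam : ℂ} (hlam : lam ∈ paramSector n) (σ : SymbolSeq n)

lemma planeCurve_pos {r : ℝ} (hr : 0 < r) : planeCurve hn hlam σ r =
    point n lam (σ.1 0) ((params hn hlam).curve (transSeq lam σ.shift) (Real.log r)) :=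
  oddExt_pos _ hr

lemma planeCurve_zero : planeCurve hn hlam σ 0 = 0 := oddExt_zero _

lemma planeCurve_neg (r : ℝ) : planeCurve hn hlam σ (-r) = -planeCurve hn hlam σ r :=
  oddExt_neg _ r

lemma norm_planeCurve_abs (r : ℝ) : ‖planeCurve hn hlam σ |r|‖ = ‖planeCurve hn hlam σ r‖ := by
  rcases abs_choice r with h | h
  · rw [h]
  · rw [h, planeCurve_neg, norm_neg]

lemma norm_point (hn : 3 ≤ n) (hlam : lam ∈ paramSector n) (s : ℕ) (x : ℂ) : ‖point n lam s x‖ =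
    ‖c₀ n lam ^ n‖ * Real.exp (translation n lam s).re * Real.exp (x.re / n) := by
  rw [point_eq hn hlam, norm_mul, norm_exp, mul_assoc, ← Real.exp_add]
  congr 2
  simp
  ring

lemma norm_point_le_mul (hn : 3 ≤ n) (hlam : lam ∈ paramSector n) (s : ℕ) {x y : ℂ} {d : ℝ}
    (h : x.re ≤ y.re + n * d) : ‖point n lam s x‖ ≤ Real.exp d * ‖point n lam s y‖ := by
  have hn0 : (0 : ℝ) < n := by exact_mod_cast (by omega : 0 < n)
  rw [norm_point hn hlam, norm_point hn hlam]
  have h1 : Real.exp (x.re / n) ≤ Real.exp d * Real.exp (y.re / n) := by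
    rw [← Real.exp_add, Real.exp_le_exp, div_le_iff₀ hn0, add_mul, div_mul_cancel₀ _ hn0.ne']
    linarith
  calc _ ≤ ‖c₀ n lam ^ n‖ * Real.exp (translation n lam s).re *
        (Real.exp d * Real.exp (y.re / n)) := by gcongr
    _ = _ := by ring

/-- The comparison constant for the moduli of the points of a cut ray. -/
def modulusConst : ℝ := Real.exp (2 * (params hn hlam).M)

lemma one_le_modulusConst : 1 ≤ modulusConst hn hlam := by
  rw [modulusConst, Real.one_le_exp_iff]
  linarith [(params hn hlam).M_pos]

lemma abs_re_curve_sub_le (t : ℝ) :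
    |((params hn hlam).curve (transSeq lam σ.shift) t).re - t| ≤ (params hn hlam).M :=
  Params.abs_curve_re_sub_le (transSeq_mem hn hlam σ.shift) t

lemma norm_planeCurve_mono {r s : ℝ} (h : |r| ≤ |s|) :
    ‖planeCurve hn hlam σ r‖ ≤ modulusConst hn hlam * ‖planeCurve hn hlam σ s‖ := by
  rw [← norm_planeCurve_abs hn hlam σ r, ← norm_planeCurve_abs hn hlam σ s]
  rcases (abs_nonneg r).eq_or_lt with h0 | h0
  · rw [← h0, planeCurve_zero, norm_zero, modulusConst]
    positivity
  · have h1 := abs_le.1 (abs_re_curve_sub_le hn hlam σ (Real.log |r|))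
    have h2 := abs_le.1 (abs_re_curve_sub_le hn hlam σ (Real.log |s|))
    have h3 := Real.log_le_log h0 h
    have hM := (params hn hlam).M_pos
    have hn1 : (1 : ℝ) ≤ n := by exact_mod_cast (by omega : 1 ≤ n)
    rw [planeCurve_pos hn hlam σ h0, planeCurve_pos hn hlam σ (h0.trans_le h)]
    refine norm_point_le_mul hn hlam _ ?_
    nlinarith

lemma im_planeCurve_ge {r : ℝ} (hr : 0 ≤ r) :
    (params hn hlam).ε * ‖planeCurve hn hlam σ r / c₀ n lam ^ n‖ ≤
      (planeCurve hn hlam σ r / c₀ n lam ^ n).im := by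
  have hc : c₀ n lam ^ n ≠ 0 := pow_ne_zero _ (c₀_ne_zero hlam)
  rcases hr.eq_or_lt with h | h
  · rw [← h, planeCurve_zero]; simp
  · rw [planeCurve_pos hn hlam σ h, point_eq hn hlam, mul_div_cancel_left₀ _ hc, norm_exp, exp_im,
      mul_comm]
    gcongr
    exact (Params.affine_mem_band (translation_mem hn hlam (σ.2 0).1 (σ.2 0).2)
      (Params.curve_mem_strip (transSeq_mem hn hlam σ.shift) _)).2.2

/-- After division by `c₀ ^ n`, the two halves of the curve lie in opposite sectors around the
imaginary axis, and imaginary parts add. -/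
lemma norm_add_le_planeCurve {r s : ℝ} (h : r * s ≤ 0) :
    ‖planeCurve hn hlam σ r‖ + ‖planeCurve hn hlam σ s‖ ≤
      1 / (params hn hlam).ε * ‖planeCurve hn hlam σ r - planeCurve hn hlam σ s‖ := by
  have hc : c₀ n lam ^ n ≠ 0 := pow_ne_zero _ (c₀_ne_zero hlam)
  have hc' : 0 < ‖c₀ n lam ^ n‖ := norm_pos_iff.2 hc
  have hε := (params hn hlam).ε_pos
  have key : ∀ r s : ℝ, 0 ≤ r → s ≤ 0 → ‖planeCurve hn hlam σ r‖ + ‖planeCurve hn hlam σ s‖ ≤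
      1 / (params hn hlam).ε * ‖planeCurve hn hlam σ r - planeCurve hn hlam σ s‖ := by
    intro r s hr hs
    have h1 := im_planeCurve_ge hn hlam σ hr
    have h2 := im_planeCurve_ge hn hlam σ (neg_nonneg.2 hs)
    rw [planeCurve_neg, neg_div, norm_neg, neg_im] at h2
    have h3 := (le_abs_self _).trans (abs_im_le_norm
      (planeCurve hn hlam σ r / c₀ n lam ^ n - planeCurve hn hlam σ s / c₀ n lam ^ n))
    rw [sub_im, ← sub_div, norm_div] at h3
    rw [norm_div] at h1 h2
    rw [one_div_mul_eq_div, le_div_iff₀ hε]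
    have h4 : (params hn hlam).ε * (‖planeCurve hn hlam σ r‖ / ‖c₀ n lam ^ n‖) +
        (params hn hlam).ε * (‖planeCurve hn hlam σ s‖ / ‖c₀ n lam ^ n‖) ≤
        ‖planeCurve hn hlam σ r - planeCurve hn hlam σ s‖ / ‖c₀ n lam ^ n‖ := by linarith
    rw [← mul_div_assoc, ← mul_div_assoc, ← add_div, div_le_div_iff_of_pos_right hc'] at h4
    linarith
  rcases mul_nonpos_iff.1 h with ⟨h1, h2⟩ | ⟨h1, h2⟩
  · exact key r s h1 h2
  · rw [add_comm, norm_sub_rev]; exact key s r h2 h1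

lemma continuous_planeCurve : Continuous (planeCurve hn hlam σ) := by
  refine continuous_oddExt ?_ ?_
  · unfold point
    refine ContinuousOn.mul continuousOn_const (ContinuousOn.cexp (ContinuousOn.div_const
      (ContinuousOn.add ?_ continuousOn_const) _))
    exact (Params.continuous_curve (transSeq_mem hn hlam σ.shift)).comp_continuousOn
      (Real.continuousOn_log.mono fun r hr => (Set.mem_Ioi.1 hr).ne')
  · rw [tendsto_zero_iff_norm_tendsto_zero]
    have hn0 : (0 : ℝ) < n := by exact_mod_cast (by omega : 0 < n)
    have h1 : Tendsto (fun r => ‖c₀ n lam ^ n‖ * Real.exp (translation n lam (σ.1 0)).re *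
        Real.exp ((Real.log r + (params hn hlam).M) / n)) (𝓝[>] 0) (𝓝 0) := by
      have h2 : Tendsto (fun r => (Real.log r + (params hn hlam).M) / n) (𝓝[>] 0) atBot :=
        (tendsto_atBot_add_const_right _ _ Real.tendsto_log_nhdsGT_zero).atBot_div_const hn0
      simpa using (Real.tendsto_exp_atBot.comp h2).const_mul
        (‖c₀ n lam ^ n‖ * Real.exp (translation n lam (σ.1 0)).re)
    refine squeeze_zero (fun _ => norm_nonneg _) (fun r => ?_) h1
    rw [norm_point hn hlam]
    have h2 := (abs_le.1 (abs_re_curve_sub_le hn hlam σ (Real.log r))).2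
    have h3 : ((params hn hlam).curve (transSeq lam σ.shift) (Real.log r)).re / n ≤
        (Real.log r + (params hn hlam).M) / n :=
      div_le_div_of_nonneg_right (by linarith) hn0.le
    gcongr

lemma tendsto_norm_planeCurve :
    Tendsto (fun r => ‖planeCurve hn hlam σ r‖) (cocompact ℝ) atTop := by
  have hn0 : (0 : ℝ) < n := by exact_mod_cast (by omega : 0 < n)
  have hc : c₀ n lam ^ n ≠ 0 := pow_ne_zero _ (c₀_ne_zero hlam)
  have hc' : 0 < ‖c₀ n lam ^ n‖ := norm_pos_iff.2 hc
  have h1 : Tendsto (fun r : ℝ => |r|) (cocompact ℝ) atTop := tendsto_norm_cocompact_atTop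
  have h2 : Tendsto (fun r => ‖planeCurve hn hlam σ r‖) atTop atTop := by
    have h3 : Tendsto (fun r => ‖c₀ n lam ^ n‖ * Real.exp (translation n lam (σ.1 0)).re *
        Real.exp ((Real.log r - (params hn hlam).M) / n)) atTop atTop := by
      have h4 : Tendsto (fun r => (Real.log r - (params hn hlam).M) / n) atTop atTop :=
        (tendsto_atTop_add_const_right _ _ Real.tendsto_log_atTop).atTop_div_const hn0
      exact (Real.tendsto_exp_atTop.comp h4).const_mul_atTop (mul_pos hc' (Real.exp_pos _))
    refine tendsto_atTop_mono' _ ?_ h3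
    filter_upwards [eventually_gt_atTop 0] with r hr
    rw [planeCurve_pos hn hlam σ hr, norm_point hn hlam]
    have h4 := (abs_le.1 (abs_re_curve_sub_le hn hlam σ (Real.log r))).1
    have h5 : (Real.log r - (params hn hlam).M) / n ≤
        ((params hn hlam).curve (transSeq lam σ.shift) (Real.log r)).re / n :=
      div_le_div_of_nonneg_right (by linarith) hn0.le
    gcongr
  refine (h2.comp h1).congr fun r => ?_
  exact norm_planeCurve_abs hn hlam σ r

lemma planeCurve_injective : Function.Injective (planeCurve hn hlam σ) := by
  have hc : c₀ n lam ^ n ≠ 0 := pow_ne_zero _ (c₀_ne_zero hlam)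
  have hne : ∀ r : ℝ, 0 < r → planeCurve hn hlam σ r ≠ 0 := fun r hr => by
    rw [planeCurve_pos hn hlam σ hr]; exact point_ne_zero hlam _ _
  have hpos : ∀ r s : ℝ, 0 < r → 0 < s → planeCurve hn hlam σ r = planeCurve hn hlam σ s →
      r = s := by
    intro r s hr hs h
    rw [planeCurve_pos hn hlam σ hr, planeCurve_pos hn hlam σ hs, point_eq hn hlam,
      point_eq hn hlam, mul_right_inj' hc] at h
    have hs' := Params.curve_mem_strip (transSeq_mem hn hlam σ.shift)
    exact Real.log_injOn_pos hr hs (Params.curve_injective (transSeq_mem hn hlam σ.shift)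
      (Params.exp_affine_inj (translation_mem hn hlam (σ.2 0).1 (σ.2 0).2) (hs' _) (hs' _) h))
  have hopp : ∀ r s : ℝ, r * s ≤ 0 → planeCurve hn hlam σ r = planeCurve hn hlam σ s →
      r = s := by
    intro r s h he
    have h1 := norm_add_le_planeCurve hn hlam σ h
    rw [he, sub_self, norm_zero, mul_zero, ← he] at h1
    have h2 : planeCurve hn hlam σ r = 0 := norm_le_zero_iff.1 (by
      linarith [norm_nonneg (planeCurve hn hlam σ r)])
    have h0 : ∀ t : ℝ, planeCurve hn hlam σ t = 0 → t = 0 := by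
      intro t ht
      by_contra hne'
      refine hne |t| (abs_pos.2 hne') (norm_eq_zero.1 ?_)
      rw [norm_planeCurve_abs, ht, norm_zero]
    rw [h0 r h2, h0 s (he ▸ h2)]
  intro r s h
  rcases le_or_gt (r * s) 0 with h1 | h1
  · exact hopp r s h1 h
  rcases mul_pos_iff.1 h1 with ⟨h2, h3⟩ | ⟨h2, h3⟩
  · exact hpos r s h2 h3 h
  · have := hpos (-r) (-s) (by linarith) (by linarith)
      (by rw [planeCurve_neg, planeCurve_neg, h])
    linarith

/-! ### Bounded turning of the finite part of a cut ray. -/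

lemma norm_sub_le_of_norm_add_le {r s t : ℝ} (ht : t ∈ Set.uIcc r s) {C : ℝ}
    (h : ‖planeCurve hn hlam σ r‖ + ‖planeCurve hn hlam σ s‖ ≤
      C * ‖planeCurve hn hlam σ r - planeCurve hn hlam σ s‖) :
    ‖planeCurve hn hlam σ r - planeCurve hn hlam σ t‖ ≤
      (modulusConst hn hlam + 1) * C * ‖planeCurve hn hlam σ r - planeCurve hn hlam σ s‖ := by
  have hB := one_le_modulusConst hn hlam
  have h1 : ‖planeCurve hn hlam σ t‖ ≤ modulusConst hn hlam *
      (‖planeCurve hn hlam σ r‖ + ‖planeCurve hn hlam σ s‖) := by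
    rcases le_max_iff.1 (Params.abs_le_max_of_mem_uIcc ht) with h1 | h1
    · refine (norm_planeCurve_mono hn hlam σ h1).trans ?_
      exact mul_le_mul_of_nonneg_left (le_add_of_nonneg_right (norm_nonneg _)) (by linarith)
    · refine (norm_planeCurve_mono hn hlam σ h1).trans ?_
      exact mul_le_mul_of_nonneg_left (le_add_of_nonneg_left (norm_nonneg _)) (by linarith)
  have h2 := norm_sub_le (planeCurve hn hlam σ r) (planeCurve hn hlam σ t)
  have h3 := norm_nonneg (planeCurve hn hlam σ s)
  rw [mul_assoc]
  refine le_trans ?_ (mul_le_mul_of_nonneg_left h (by linarith))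
  linarith

/-- The scale that separates close and distant points on one side of a cut ray. -/
def splitScale : ℝ := 2 * (params hn hlam).M + n

/-- In `splitScale`, the summand `2 * M` absorbs the deviation of the curve from the line, and `n`
becomes a factor `exp 1` after the real part is divided by `n`. -/
lemma norm_add_le_planeCurve_of_far {r s : ℝ} (hr : 0 < r) (hs : 0 < s)
    (h : splitScale hn hlam ≤ |Real.log r - Real.log s|) :
    ‖planeCurve hn hlam σ r‖ + ‖planeCurve hn hlam σ s‖ ≤
      3 * ‖planeCurve hn hlam σ r - planeCurve hn hlam σ s‖ := by
  have key : ∀ r s : ℝ, 0 < r → 0 < s → splitScale hn hlam ≤ Real.log s - Real.log r →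
      ‖planeCurve hn hlam σ r‖ + ‖planeCurve hn hlam σ s‖ ≤
      3 * ‖planeCurve hn hlam σ r - planeCurve hn hlam σ s‖ := by
    intro r s hr hs h
    have h1 := abs_le.1 (abs_re_curve_sub_le hn hlam σ (Real.log r))
    have h2 := abs_le.1 (abs_re_curve_sub_le hn hlam σ (Real.log s))
    have h3 : ‖planeCurve hn hlam σ r‖ ≤ Real.exp (-1) * ‖planeCurve hn hlam σ s‖ := by
      rw [planeCurve_pos hn hlam σ hr, planeCurve_pos hn hlam σ hs]
      refine norm_point_le_mul hn hlam _ ?_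
      unfold splitScale at h
      linarith
    have h4 : Real.exp (-1) ≤ 1 / 2 := by
      rw [Real.exp_neg, inv_eq_one_div]
      gcongr
      linarith [Real.add_one_le_exp (1 : ℝ)]
    have h5 : ‖planeCurve hn hlam σ r‖ ≤ 1 / 2 * ‖planeCurve hn hlam σ s‖ :=
      h3.trans (mul_le_mul_of_nonneg_right h4 (norm_nonneg _))
    have h6 := norm_sub_norm_le (planeCurve hn hlam σ s) (planeCurve hn hlam σ r)
    rw [norm_sub_rev] at h6
    linarith
  rcases le_total (Real.log r) (Real.log s) with h1 | h1
  · rw [abs_sub_comm, abs_of_nonneg (sub_nonneg.2 h1)] at h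
    exact key r s hr hs h
  · rw [abs_of_nonneg (sub_nonneg.2 h1)] at h
    rw [add_comm, norm_sub_rev]
    exact key s r hs hr h

lemma exists_planeCurve_turning : ∃ C : ℝ, 0 ≤ C ∧ ∀ r s t : ℝ, t ∈ Set.uIcc r s →
    ‖planeCurve hn hlam σ r - planeCurve hn hlam σ t‖ ≤
      C * ‖planeCurve hn hlam σ r - planeCurve hn hlam σ s‖ := by
  obtain ⟨C₁, hC₁, hturn⟩ := Params.exists_turning_const (params hn hlam)
  have hn0 : (0 : ℝ) < n := by exact_mod_cast (by omega : 0 < n)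
  have hn1 : (1 : ℝ) ≤ n := by exact_mod_cast (by omega : 1 ≤ n)
  have hB := one_le_modulusConst hn hlam
  have hε := (params hn hlam).ε_pos
  have hb := transSeq_mem hn hlam σ.shift
  have ht₀ := translation_mem hn hlam (σ.2 0).1 (σ.2 0).2
  set D : ℝ := splitScale hn hlam + 2 * (params hn hlam).M with hD
  set K₁ : ℝ := (modulusConst hn hlam + 1) * (1 / (params hn hlam).ε) with hK₁
  set K₂ : ℝ := (modulusConst hn hlam + 1) * 3 with hK₂
  set K₃ : ℝ := Real.exp (2 * D) * C₁ with hK₃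
  have q1 : 0 ≤ K₁ := by positivity
  have q2 : 0 ≤ K₂ := by positivity
  have q3 : 0 ≤ K₃ := by positivity
  have mono : ∀ {K x y : ℝ}, 0 ≤ y → x ≤ K * y → K ≤ K₁ + K₂ + K₃ → x ≤ (K₁ + K₂ + K₃) * y :=
    fun hy h hK => h.trans (mul_le_mul_of_nonneg_right hK hy)
  have hpos : ∀ r s t : ℝ, 0 < r → 0 < s → t ∈ Set.uIcc r s →
      ‖planeCurve hn hlam σ r - planeCurve hn hlam σ t‖ ≤
      (K₁ + K₂ + K₃) * ‖planeCurve hn hlam σ r - planeCurve hn hlam σ s‖ := by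
    intro r s t hr hs ht
    have ht0 := Params.uIcc_pos ht hr hs
    rcases le_or_gt (splitScale hn hlam) |Real.log r - Real.log s| with h | h
    · exact mono (norm_nonneg _) (norm_sub_le_of_norm_add_le hn hlam σ ht
        (norm_add_le_planeCurve_of_far hn hlam σ hr hs h)) (by linarith)
    -- On the remaining arcs the exponential acts at bounded scale `D`: the turning constant `C₁` of
    -- the curve in logarithmic coordinates is multiplied by the distortion `exp (2 * D)`.
    · refine mono (K := K₃) (norm_nonneg _) ?_ (by linarith)
      have hlog : Real.log t ∈ Set.uIcc (Real.log r) (Real.log s) := by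
        rw [Set.mem_uIcc] at ht ⊢
        rcases ht with ⟨e1, e2⟩ | ⟨e1, e2⟩
        · exact Or.inl ⟨Real.log_le_log hr e1, Real.log_le_log ht0 e2⟩
        · exact Or.inr ⟨Real.log_le_log hs e1, Real.log_le_log ht0 e2⟩
      have h1 := hturn _ hb (Real.log t) (Real.log r) (Real.log s) hlog
      set x := (params hn hlam).curve (transSeq lam σ.shift) (Real.log r) with hx
      set y := (params hn hlam).curve (transSeq lam σ.shift) (Real.log t) with hy
      set z := (params hn hlam).curve (transSeq lam σ.shift) (Real.log s) with hz
      have hxs : x ∈ strip := Params.curve_mem_strip hb _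
      have hzs : z ∈ strip := Params.curve_mem_strip hb _
      obtain ⟨e1, e2⟩ := Params.abs_sub_le_of_mem_uIcc hlog
      have hdiv : ∀ u v : ℂ, ‖u / n + translation n lam (σ.1 0) -
          (v / n + translation n lam (σ.1 0))‖ = ‖u - v‖ / n := fun u v => by
        rw [add_sub_add_right_eq_sub, ← sub_div, norm_div]
        simp
      have hle : ∀ u v : ℝ, |u - v| ≤ |Real.log r - Real.log s| →
          ‖(params hn hlam).curve (transSeq lam σ.shift) u / n + translation n lam (σ.1 0) -
          ((params hn hlam).curve (transSeq lam σ.shift) v / n + translation n lam (σ.1 0))‖ ≤ D :=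
        fun u v huv => by
          rw [hdiv, div_le_iff₀ hn0]
          have h2 := Params.norm_curve_sub_curve_le hb u v
          have h3 : 0 ≤ D := by
            have := (params hn hlam).M_pos
            have : 0 ≤ splitScale hn hlam := (abs_nonneg _).trans h.le
            positivity
          nlinarith
      have h2 := exp_distortion (Params.abs_im_affine_sub_le ht₀ hxs hzs)
        (hle (Real.log r) (Real.log t) (by rwa [abs_sub_comm]))
        (hle (Real.log r) (Real.log s) le_rfl) (hle (Real.log t) (Real.log s) e2)
      change ‖exp (x / n + translation n lam (σ.1 0)) - exp (y / n + translation n lam (σ.1 0))‖ *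
        ‖x / n + translation n lam (σ.1 0) - (z / n + translation n lam (σ.1 0))‖ ≤
        Real.exp (2 * D) *
        (‖exp (x / n + translation n lam (σ.1 0)) - exp (z / n + translation n lam (σ.1 0))‖ *
        ‖x / n + translation n lam (σ.1 0) - (y / n + translation n lam (σ.1 0))‖) at h2
      rw [hdiv, hdiv] at h2
      rw [planeCurve_pos hn hlam σ hr, planeCurve_pos hn hlam σ hs, planeCurve_pos hn hlam σ ht0,
        ← hx, ← hy, ← hz, point_eq hn hlam, point_eq hn hlam, point_eq hn hlam, ← mul_sub,
        ← mul_sub, norm_mul, norm_mul]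
      -- If the endpoints coincide, turning forces `y` to coincide with them. Otherwise the
      -- distortion inequality may be divided by `‖x - z‖ / n`.
      rcases eq_or_ne x z with hxz | hxz
      · have hxy : x = y := by
          rw [hxz, sub_self, norm_zero, mul_zero] at h1
          rw [← hxz] at h1
          exact sub_eq_zero.1 (norm_le_zero_iff.1 h1)
        rw [← hxy, sub_self, norm_zero, mul_zero]
        positivity
      · have h0 : 0 < ‖x - z‖ := norm_pos_iff.2 (sub_ne_zero.2 hxz)
        have h3 : ‖exp (x / n + translation n lam (σ.1 0)) -
            exp (y / n + translation n lam (σ.1 0))‖ ≤ K₃ *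
            ‖exp (x / n + translation n lam (σ.1 0)) -
              exp (z / n + translation n lam (σ.1 0))‖ := by
          refine le_of_mul_le_mul_right ?_ (div_pos h0 hn0)
          refine h2.trans ?_
          calc _ ≤ Real.exp (2 * D) *
              (‖exp (x / n + translation n lam (σ.1 0)) - exp (z / n + translation n lam (σ.1 0))‖ *
              ((C₁ * ‖x - z‖) / n)) := by gcongr
            _ = _ := by rw [hK₃]; ring
        calc _ ≤ ‖c₀ n lam ^ n‖ * (K₃ * ‖exp (x / n + translation n lam (σ.1 0)) -
              exp (z / n + translation n lam (σ.1 0))‖) := by gcongr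
          _ = _ := by ring
  refine ⟨K₁ + K₂ + K₃, by positivity, fun r s t ht => ?_⟩
  rcases le_or_gt (r * s) 0 with h | h
  · exact mono (norm_nonneg _) (norm_sub_le_of_norm_add_le hn hlam σ ht
      (norm_add_le_planeCurve hn hlam σ h)) (by linarith)
  rcases mul_pos_iff.1 h with ⟨h1, h2⟩ | ⟨h1, h2⟩
  · exact hpos r s t h1 h2 ht
  · have h3 := hpos (-r) (-s) (-t) (by linarith) (by linarith) (by
      rw [Set.mem_uIcc] at ht ⊢
      rcases ht with ⟨e1, e2⟩ | ⟨e1, e2⟩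
      · exact Or.inr ⟨neg_le_neg e2, neg_le_neg e1⟩
      · exact Or.inl ⟨neg_le_neg e2, neg_le_neg e1⟩)
    simp only [planeCurve_neg, neg_sub_neg] at h3
    rwa [norm_sub_rev, norm_sub_rev (planeCurve hn hlam σ s)] at h3

end

/-- Every cut ray is a quasicircle. -/
theorem isQuasicircle_cutRay {n : ℕ} (hn : 3 ≤ n) {lam : ℂ} (hlam : lam ∈ paramSector n) {θ : ℝ}
    (hθ : θ ∈ Theta n) : IsQuasicircle (cutRay n lam θ) := by
  obtain ⟨σ, hσ⟩ := exists_cutRay_eq hn hlam hθ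
  obtain ⟨C, hC, hturn⟩ := exists_planeCurve_turning hn hlam σ
  rw [hσ]
  exact isQuasicircle_range (continuous_planeCurve hn hlam σ) (planeCurve_injective hn hlam σ)
    (tendsto_norm_planeCurve hn hlam σ) (one_le_modulusConst hn hlam) hC
    (one_div_pos.2 (params hn hlam).ε_pos) (fun r s => norm_planeCurve_mono hn hlam σ)
    (fun r s => norm_add_le_planeCurve hn hlam σ) hturn

end McMullen
end

theorem lemma3 (n : ℕ) (hn : 3 ≤ n) (lam : ℂ) (hlam : lam ∈ McMullen.paramSector n)
    (θ : ℝ) (hθ : θ ∈ McMullen.Theta n)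
    (hper : ∃ p : ℕ, 0 < p ∧ (McMullen.tau n)^[p] θ = θ) :
    McMullen.IsQuasicircle (McMullen.cutRay n lam θ) :=
  McMullen.isQuasicircle_cutRay hn hlam hθ
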